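/- **Setting.** Let $n\ge 1$ and let $(M^{2n+1},J,\theta)$ be a strictly pseudoconvex pseudohermitian manifold: $\theta$ is a contact form, $J$ is a formally integrable complex structure on $H=\ker\theta$, and $d\theta(X,JX)>0$ for $0\ne X\in H$. Let $T$ be the Reeb field ($\theta(T)=1$, $d\theta(T,\cdot)=0$), and, on an open set, let $\{\theta^\alpha\}_{\alpha=1}^n$ be an admissible coframe, with $\{T,Z_\alpha,Z_{\bar\alpha}\}$ the frame dual to $\{\theta,\theta^\alpha,\theta^{\bar\alpha}\}$ and $Z_\alpha\in T^{1,0}$. Write $d\theta=ih_{\alpha\bar\beta}\theta^\alpha\wedge\theta^{\bar\beta}$ and raise and lower indices with $h$. The Tanaka--Webster connection forms $\omega_\alpha{}^\beta$ and the torsion $A_{\alpha\beta}$ are defined by $$d\theta^\beta=\theta^\alpha\wedge\omega_\alpha{}^\beta+\theta\wedge A^\beta{}_{\bar\gamma}\theta^{\bar\gamma},\qquad \omega_{\alpha\bar\beta}+\omega_{\bar\beta\alpha}=dh_{\alpha\bar\beta},\qquad A_{\alpha\beta}=A_{\beta\alpha};$$ $\nabla$ is the associated covariant derivative and $\nabla_0$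 is the derivative along $T$. The curvature is $R_\alpha{}^\beta{}_{\gamma\bar\delta}=(d\omega_\alpha{}^\beta-\omega_\alpha{}^\mu\wedge\omega_\mu{}^\beta)(Z_\gamma,Z_{\bar\delta})$; put $R_{\alpha\bar\beta}=R_\gamma{}^\gamma{}_{\alpha\bar\beta}$, $R=R_\alpha{}^\alpha$ (Webster scalar curvature), $P_{\alpha\bar\beta}=\frac1{n+2}\bigl(R_{\alpha\bar\beta}-\frac{1}{2(n+1)}Rh_{\alpha\bar\beta}\bigr)$, $P=P_\alpha{}^\alpha$, $\mathring P_{\alpha\bar\beta}=P_{\alpha\bar\beta}-\frac Pn h_{\alpha\bar\beta}$, $W_\alpha=\nabla_\alpha R-i\nabla^\beta A_{\alpha\beta}$, and $\Delta_b=-(\nabla^\alpha\nabla_\alpha+\nabla_\alpha\nabla^\alpha)$. A real function $f\in C^\infty(M)$ is CR pluriharmonic if locally it is the real part of a CR function, i.e. of a smooth $v$ with $\nabla_{\bar\alpha}v=0$. The CR Paneitz operator is $$P_4f=\Delta_b^2f+\nabla_0^2f-4\operatorname{Im}\nabla^\alpha(A_{\alpha\beta}\nabla^\beta f)+4\operatorname{Re}\nabla_{\bar\beta}(\mathring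 P^{\alpha\bar\beta}\nabla_\alpha f)-\tfrac{4(n^2-1)}{n}\operatorname{Re}\nabla^\beta(P\nabla_\beta f)+\tfrac{n-1}{2}Q_4f,$$ $$Q_4=\tfrac{2(n+1)^2}{n(n+2)}\Delta_bP-\tfrac{4}{n(n+2)}\operatorname{Im}\nabla^\alpha\nabla^\beta A_{\alpha\beta}-\tfrac{2(n-1)}{n}|A_{\alpha\beta}|^2-\tfrac{2(n+1)}{n}|\mathring P_{\alpha\bar\beta}|^2+\tfrac{2(n-1)(n+1)^2}{n^2}P^2 .$$ For a real number $\nu>0$ put $$\begin{aligned}\mathcal P_\nu f={}&\tfrac{2(\nu+1)}{\nu^2}\Delta_b^2f-\tfrac8\nu\operatorname{Im}\nabla^\alpha(A_{\alpha\beta}\nabla^\beta f)-\tfrac{8(\nu+1)}{\nu}\operatorname{Re}\nabla^\alpha(P\nabla_\alpha f)\\&+\tfrac{16(\nu+1)}{\nu(\nu+2)}\operatorname{Re}\Bigl(\bigl(\nabla_\alpha P-\tfrac{i\nu}{2(\nu+1)}\nabla^\beta A_{\alpha\beta}\bigr)\nabla^\alpha f\Bigr)+\Bigl[\tfrac{2(\nu+1)^2}{\nu(\nu+2)}\Delta_bP-\tfrac{4}{\nu(\nu+2)}\operatorname{Im}\nabla^\alpha\nabla^\beta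 A_{\alpha\beta}\\&\quad-\tfrac{2(\nu-1)}{\nu}|A_{\alpha\beta}|^2-\tfrac{2(\nu+1)}{\nu}|\mathring P_{\alpha\bar\beta}|^2+\tfrac{2(\nu-1)(\nu+1)^2}{\nu^2}P^2\Bigr]f .\end{aligned}$$ **Lemma.** Let $f$ be CR pluriharmonic on $(M^{2n+1},J,\theta)$. In every local admissible frame: 1. If $n\ge2$, then the $P'$-operator $P_4'f:=\frac{2}{n-1}P_4f$ is given by $P_4'f=\mathcal P_n f$. 2. The expression $\mathcal P_\nu f$ is rational in the dimensional parameter without a pole at $1$: it is a linear combination of the operators $\Delta_b^2f$, $\operatorname{Im}\nabla^\alpha(A_{\alpha\beta}\nabla^\beta f)$, $\operatorname{Re}\nabla^\alpha(P\nabla_\alpha f)$, $\operatorname{Re}(\nabla_\alpha P\,\nabla^\alpha f)$, $\operatorname{Re}(i\nabla^\beta A_{\alpha\beta}\nabla^\alpha f)$, $(\Delta_bP)f$, $(\operatorname{Im}\nabla^\alpha\nabla^\beta A_{\alpha\beta})f$, $|A_{\alpha\beta}|^2f$, $|\mathring P_{\alpha\bar\beta}|^2f$, $P^2f$, whose coefficients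 are universal rational functions of $\nu$ that are regular at $\nu=1$. 3. If $n=1$, then the critical $P'$-operator, defined as the formal limit $P_4'f:=\lim_{\nu\to1}\mathcal P_\nu f$ of this expression (with the geometric quantities those of the three-manifold), exists and equals $$P_4'f=4\Delta_b^2f-8\operatorname{Im}\nabla^\alpha(A_{\alpha\beta}\nabla^\beta f)-4\operatorname{Re}\nabla^\alpha(R\nabla_\alpha f)+\tfrac83\operatorname{Re}(W_\alpha\nabla^\alpha f)+\tfrac23\bigl(\Delta_bR-2\operatorname{Im}\nabla^\alpha\nabla^\beta A_{\alpha\beta}\bigr)f .$$ -/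

import Mathlib

open scoped Manifold ContDiff Topology

noncomputable section

namespace CRGeom

section VectorFields

variable {n : ℕ} {M : Type*} [TopologicalSpace M]
  [ChartedSpace (EuclideanSpace ℝ (Fin (2 * n + 1))) M]

variable (n M) in
/-- Real vector fields on a `(2n+1)`-dimensional manifold (no regularity built in). -/
abbrev RealField : Type _ := ∀ x : M, TangentSpace (𝓡 (2 * n + 1)) x

variable (n M) in
/-- Complex-valued `1`-forms, i.e. sections of the complexified cotangent bundle
(no regularity built in). -/
abbrev ComplexForm : Type _ := ∀ x : M, TangentSpace (𝓡 (2 * n + 1)) x →L[ℝ] ℂ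

variable (n M) in
/-- Complex vector fields `re + i im`, i.e. sections of the complexified tangent bundle
(no regularity built in). -/
structure ComplexField where
  /-- The real part. -/
  re : RealField n M
  /-- The imaginary part. -/
  im : RealField n M

/-- Smoothness of a real vector field on a set. -/
def RealField.SmoothOn [IsManifold (𝓡 (2 * n + 1)) ∞ M] (X : RealField n M) (U : Set M) : Prop :=
  ContMDiffOn (𝓡 (2 * n + 1)) (𝓡 (2 * n + 1)).tangent ∞
    (fun x => (⟨x, X x⟩ : TangentBundle (𝓡 (2 * n + 1)) M)) U

/-- Smoothness of a complex vector field on a set. -/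
def ComplexField.SmoothOn [IsManifold (𝓡 (2 * n + 1)) ∞ M] (V : ComplexField n M) (U : Set M) : Prop :=
  RealField.SmoothOn V.re U ∧ RealField.SmoothOn V.im U

/-- Smoothness of a complex-valued `1`-form on a set. -/
def ComplexForm.SmoothOn [IsManifold (𝓡 (2 * n + 1)) ∞ M] (η : ComplexForm n M) (U : Set M) :
    Prop :=
  ContMDiffOn (𝓡 (2 * n + 1))
    ((𝓡 (2 * n + 1)).prod 𝓘(ℝ, EuclideanSpace ℝ (Fin (2 * n + 1)) →L[ℝ] ℂ)) ∞
    (fun x => Bundle.TotalSpace.mk' (EuclideanSpace ℝ (Fin (2 * n + 1)) →L[ℝ] ℂ)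
      (E := fun x : M => TangentSpace (𝓡 (2 * n + 1)) x →L[ℝ] Bundle.Trivial M ℂ x) x (η x)) U

/-- A real vector field, regarded as a complex one. -/
def RealField.toComplex (X : RealField n M) : ComplexField n M := ⟨X, fun _ => 0⟩

/-- The complex conjugate of a complex vector field. -/
def ComplexField.conj (V : ComplexField n M) : ComplexField n M := ⟨V.re, fun x => -V.im x⟩

/-- The differential `df` of a complex-valued function. -/
def differential (f : M → ℂ) : ComplexForm n M := fun x => mfderiv (𝓡 (2 * n + 1)) 𝓘(ℝ, ℂ) f x

/-- The derivative `V f` of a complex-valued function along a complex vector field. -/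
def ComplexField.deriv (V : ComplexField n M) (f : M → ℂ) (x : M) : ℂ :=
  differential f x (V.re x) + Complex.I * differential f x (V.im x)

/-- The complex bilinear extension of the Lie bracket of vector fields. -/
def ComplexField.bracket (V W : ComplexField n M) : ComplexField n M where
  re x := VectorField.mlieBracket (𝓡 (2 * n + 1)) V.re W.re x -
    VectorField.mlieBracket (𝓡 (2 * n + 1)) V.im W.im x
  im x := VectorField.mlieBracket (𝓡 (2 * n + 1)) V.re W.im x +
    VectorField.mlieBracket (𝓡 (2 * n + 1)) V.im W.re x

/-- The value `η(V)` of a form on a complex vector field (complex linear extension). -/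
def ComplexForm.app (η : ComplexForm n M) (V : ComplexField n M) (x : M) : ℂ :=
  η x (V.re x) + Complex.I * η x (V.im x)

/-- The conjugate form. -/
def ComplexForm.conj (η : ComplexForm n M) : ComplexForm n M :=
  fun x => (Complex.conjCLE : ℂ →L[ℝ] ℂ) ∘L η x

/-- The exterior derivative `dη(V, W) = V(η(W)) - W(η(V)) - η([V, W])`. With this normalization
`(η ∧ ζ)(V, W) = η(V) ζ(W) - η(W) ζ(V)`. -/
def ComplexForm.d (η : ComplexForm n M) (V W : ComplexField n M) (x : M) : ℂ :=
  V.deriv (η.app W) x - W.deriv (η.app V) x - η.app (V.bracket W) x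

end VectorFields

section Pseudohermitian

/-- A strictly pseudoconvex pseudohermitian structure `(J, θ)` on a manifold of dimension `2n+1`.
The contact distribution is `H = ker θ`; `J` is an almost complex structure on `H` (it is recorded
as a fibrewise endomorphism of the tangent bundle, but only its restriction to `H` is
meaningful or ever used). -/
structure PseudohermitianStructure (n : ℕ) (M : Type*) [TopologicalSpace M]
    [ChartedSpace (EuclideanSpace ℝ (Fin (2 * n + 1))) M]
    [IsManifold (𝓡 (2 * n + 1)) ∞ M] where
  /-- The contact form. -/
  form : ∀ x : M, TangentSpace (𝓡 (2 * n + 1)) x →L[ℝ] ℝ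
  /-- The complex structure on `H = ker θ`. -/
  J : ∀ x : M, TangentSpace (𝓡 (2 * n + 1)) x →ₗ[ℝ] TangentSpace (𝓡 (2 * n + 1)) x
  form_ne_zero : ∀ x, form x ≠ 0
  form_smooth : ComplexForm.SmoothOn (fun x => Complex.ofRealCLM ∘L form x) Set.univ
  J_mem : ∀ x v, form x v = 0 → form x (J x v) = 0
  J_sq : ∀ x v, form x v = 0 → J x (J x v) = -v
  /-- `J` is smooth: it maps smooth local sections of `H` to smooth local sections. -/
  J_smooth : ∀ U : Set M, IsOpen U → ∀ X : RealField n M, X.SmoothOn U →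
    (∀ x ∈ U, form x (X x) = 0) → RealField.SmoothOn (fun x => J x (X x)) U
  /-- Formal integrability: the smooth local sections of `T^{1,0}`, i.e. the fields
  `X - i J X` with `X` in `H`, are closed under the Lie bracket. -/
  integrable : ∀ U : Set M, IsOpen U → ∀ V W : ComplexField n M, V.SmoothOn U → W.SmoothOn U →
    (∀ x ∈ U, form x (V.re x) = 0 ∧ V.im x = -J x (V.re x)) →
    (∀ x ∈ U, form x (W.re x) = 0 ∧ W.im x = -J x (W.re x)) →
    ∀ x ∈ U, form x ((V.bracket W).re x) = 0 ∧
      (V.bracket W).im x = -J x ((V.bracket W).re x)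
  /-- Strict pseudoconvexity: `dθ(X, J X) > 0` for nonzero `X` in `H` (as `θ` vanishes on
  sections of `H`, `dθ(X, J X) = -θ([X, J X])`). In particular `θ` is a contact form. -/
  pseudoconvex : ∀ U : Set M, IsOpen U → ∀ X : RealField n M, X.SmoothOn U →
    (∀ x ∈ U, form x (X x) = 0) → ∀ x ∈ U, X x ≠ 0 →
    0 < -form x (VectorField.mlieBracket (𝓡 (2 * n + 1)) X (fun y => J y (X y)) x)

variable {n : ℕ} {M : Type*} [TopologicalSpace M]
  [ChartedSpace (EuclideanSpace ℝ (Fin (2 * n + 1))) M]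
  [IsManifold (𝓡 (2 * n + 1)) ∞ M]

namespace PseudohermitianStructure

variable (S : PseudohermitianStructure n M)

/-- The contact form `θ` as a complex-valued form. -/
def theta : ComplexForm n M := fun x => Complex.ofRealCLM ∘L S.form x

/-- The value of `V` at `x` lies in `T^{1,0}`, the `+i`-eigenspace of `J` on `H ⊗ ℂ`. -/
def IsT10At (V : ComplexField n M) (x : M) : Prop :=
  S.form x (V.re x) = 0 ∧ V.im x = -S.J x (V.re x)

/-- `v` is a CR function on `U`: it is smooth and annihilated by all vectors of type `(0,1)`,
that is, by all `w + i J w` with `w` in `H`. -/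
def IsCRFunctionOn (v : M → ℂ) (U : Set M) : Prop :=
  ContMDiffOn (𝓡 (2 * n + 1)) 𝓘(ℝ, ℂ) ∞ v U ∧
    ∀ x ∈ U, ∀ w : TangentSpace (𝓡 (2 * n + 1)) x, S.form x w = 0 →
      differential v x w + Complex.I * differential v x (S.J x w) = 0

/-- CR pluriharmonic functions: real-valued smooth functions that are locally the real part of a
CR function. -/
def IsPluriharmonic (f : M → ℝ) : Prop :=
  ContMDiff (𝓡 (2 * n + 1)) 𝓘(ℝ, ℝ) ∞ f ∧
    ∀ x : M, ∃ U : Set M, IsOpen U ∧ x ∈ U ∧ ∃ v : M → ℂ, S.IsCRFunctionOn v U ∧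
      ∀ y ∈ U, f y = (v y).re

/-- An admissible coframe `{θ^α}` on the open set `U`, together with the frame `{T, Z_α, Z_ᾱ}`
dual to `{θ, θ^α, θ^ᾱ}`. -/
structure AdmissibleFrame (U : Set M) where
  /-- The Reeb field `T`. -/
  T : RealField n M
  /-- The frame `Z_α` of `T^{1,0}`. -/
  Z : Fin n → ComplexField n M
  /-- The admissible coframe `θ^α`. -/
  coframe : Fin n → ComplexForm n M
  T_smooth : T.SmoothOn U
  Z_smooth : ∀ α, (Z α).SmoothOn U
  coframe_smooth : ∀ α, (coframe α).SmoothOn U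
  form_T : ∀ x ∈ U, S.form x (T x) = 1
  d_form_T : ∀ Y : RealField n M, Y.SmoothOn U →
    ∀ x ∈ U, S.theta.d T.toComplex Y.toComplex x = 0
  Z_mem : ∀ α, ∀ x ∈ U, S.IsT10At (Z α) x
  coframe_T : ∀ α, ∀ x ∈ U, coframe α x (T x) = 0
  coframe_Z : ∀ α β, ∀ x ∈ U, (coframe α).app (Z β) x = if α = β then 1 else 0
  coframe_Zbar : ∀ α β, ∀ x ∈ U, (coframe α).app (Z β).conj x = 0

end PseudohermitianStructure

/-- The directions `0, α, ᾱ` of an admissible frame. -/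
inductive Dir (n : ℕ) where
  /-- The direction of the Reeb field. -/
  | zero : Dir n
  /-- The direction `α`. -/
  | hol (α : Fin n) : Dir n
  /-- The direction `ᾱ`. -/
  | anti (α : Fin n) : Dir n

/-- Conjugation of directions. -/
def Dir.conj : Dir n → Dir n
  | .zero => .zero
  | .hol α => .anti α
  | .anti α => .hol α

namespace PseudohermitianStructure.AdmissibleFrame

variable {S : PseudohermitianStructure n M} {U : Set M} (F : S.AdmissibleFrame U)

/-- The frame fields `T`, `Z_α`, `Z_ᾱ`. -/
def field : Dir n → ComplexField n M
  | .zero => F.T.toComplex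
  | .hol α => F.Z α
  | .anti α => (F.Z α).conj

/-- The Levi form: `dθ = i h_{αβ̄} θ^α ∧ θ^β̄`, that is `h_{αβ̄} = -i dθ(Z_α, Z_β̄)`. -/
def h (α β : Fin n) (x : M) : ℂ := -Complex.I * S.theta.d (F.Z α) (F.Z β).conj x

/-- The inverse `h^{αβ̄}` of the Levi form: `h^{αβ̄} h_{γβ̄} = δ^α_γ`. -/
def hInv (α β : Fin n) (x : M) : ℂ := (Matrix.of fun γ δ => F.h γ δ x)⁻¹ β α

/-- The torsion `A_{αβ}`. The structure equation `dθ^γ = θ^δ ∧ ω_δ^γ + θ ∧ τ^γ`, where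
`τ^γ = h^{γᾱ} A_{ᾱβ̄} θ^β̄`, says that `A_{ᾱβ̄} = h_{γᾱ} dθ^γ(T, Z_β̄)`. -/
def A (α β : Fin n) (x : M) : ℂ :=
  starRingEnd ℂ (∑ γ, F.h γ α x * (F.coframe γ).d F.T.toComplex (F.Z β).conj x)

/-- The value `ω_α^γ(e)` of the Tanaka--Webster connection form on a frame field `e`. The structure
equations `dθ^γ = θ^α ∧ ω_α^γ + θ ∧ τ^γ` and `dh_{αδ̄} = h_{γδ̄} ω_α^γ + h_{αγ̄} ω_δ̄^γ̄`
(with `ω_δ̄^γ̄` the conjugate of `ω_δ^γ`) are solved for `ω`: the first one gives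
`ω_α^γ(T) = dθ^γ(Z_α, T)` and `ω_α^γ(Z_β̄) = dθ^γ(Z_α, Z_β̄)`, and the second one then gives
`ω_α^γ(Z_β)`. -/
def omega (α γ : Fin n) : Dir n → M → ℂ
  | .zero => fun x => (F.coframe γ).d (F.Z α) F.T.toComplex x
  | .anti β => fun x => (F.coframe γ).d (F.Z α) (F.Z β).conj x
  | .hol β => fun x => ∑ δ, F.hInv γ δ x * ((F.Z β).deriv (F.h α δ) x -
      ∑ σ, F.h α σ x * starRingEnd ℂ ((F.coframe σ).d (F.Z δ) (F.Z β).conj x))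

/-- The value `ω_ᾱ^γ̄(e)` of the conjugate connection form on a frame field. -/
def omegaBar (α γ : Fin n) (d : Dir n) (x : M) : ℂ := starRingEnd ℂ (F.omega α γ d.conj x)

/-- The connection form `ω_α^γ` evaluated on an arbitrary complex vector field. -/
def omegaApp (α γ : Fin n) (V : ComplexField n M) (x : M) : ℂ :=
  S.theta.app V x * F.omega α γ .zero x +
    ∑ μ, (F.coframe μ).app V x * F.omega α γ (.hol μ) x +
    ∑ μ, (F.coframe μ).conj.app V x * F.omega α γ (.anti μ) x

/-- The curvature `R_α^β_{γδ̄} = Π_α^β(Z_γ, Z_δ̄)`, where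
`Π_α^β = dω_α^β - ω_α^μ ∧ ω_μ^β`. -/
def curvature (α β γ δ : Fin n) (x : M) : ℂ :=
  (F.Z γ).deriv (F.omega α β (.anti δ)) x - (F.Z δ).conj.deriv (F.omega α β (.hol γ)) x -
    F.omegaApp α β ((F.Z γ).bracket (F.Z δ).conj) x -
    ∑ μ, (F.omega α μ (.hol γ) x * F.omega μ β (.anti δ) x -
      F.omega α μ (.anti δ) x * F.omega μ β (.hol γ) x)

/-- The pseudohermitian Ricci tensor `R_{αβ̄} = R_γ^γ_{αβ̄}`. -/
def ricci (α β : Fin n) (x : M) : ℂ := ∑ γ, F.curvature γ γ α β x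

/-- The trace `h^{αβ̄} t_{αβ̄}`. -/
def trace (t : Fin n → Fin n → M → ℂ) (x : M) : ℂ := ∑ α, ∑ β, F.hInv α β x * t α β x

/-- The pseudohermitian (Webster) scalar curvature `R = R_α^α`. -/
def R (x : M) : ℂ := F.trace F.ricci x

/-- The pseudohermitian Schouten tensor
`P_{αβ̄} = (R_{αβ̄} - R h_{αβ̄} / (2(n+1))) / (n+2)`. -/
def schouten (α β : Fin n) (x : M) : ℂ :=
  1 / ((n : ℂ) + 2) * (F.ricci α β x - 1 / (2 * ((n : ℂ) + 1)) * F.R x * F.h α β x)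

/-- The trace `P = P_α^α` of the Schouten tensor. -/
def P (x : M) : ℂ := F.trace F.schouten x

/-- The tracefree part `P_{αβ̄} - (P / n) h_{αβ̄}` of the Schouten tensor. -/
def schouten0 (α β : Fin n) (x : M) : ℂ := F.schouten α β x - F.P x / (n : ℂ) * F.h α β x

/-- `∇_α u`. -/
def grad (u : M → ℂ) (α : Fin n) (x : M) : ℂ := (F.Z α).deriv u x

/-- `∇_ᾱ u`. -/
def gradBar (u : M → ℂ) (α : Fin n) (x : M) : ℂ := (F.Z α).conj.deriv u x

/-- `∇_0 u = T u`. -/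
def nabla0 (u : M → ℂ) (x : M) : ℂ := F.T.toComplex.deriv u x

/-- `∇^α u = h^{αβ̄} ∇_β̄ u`. -/
def gradUp (u : M → ℂ) (α : Fin n) (x : M) : ℂ := ∑ β, F.hInv α β x * F.gradBar u β x

/-- `∇^ᾱ u = h^{βᾱ} ∇_β u`. -/
def gradBarUp (u : M → ℂ) (α : Fin n) (x : M) : ℂ := ∑ β, F.hInv β α x * F.grad u β x

/-- The covariant derivative `∇_d σ_α` of a form `σ_α` of type `(1,0)`. -/
def cov (d : Dir n) (σ : Fin n → M → ℂ) (α : Fin n) (x : M) : ℂ :=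
  (F.field d).deriv (σ α) x - ∑ γ, F.omega α γ d x * σ γ x

/-- The covariant derivative `∇_d σ_ᾱ` of a form `σ_ᾱ` of type `(0,1)`. -/
def covBar (d : Dir n) (σ : Fin n → M → ℂ) (α : Fin n) (x : M) : ℂ :=
  (F.field d).deriv (σ α) x - ∑ γ, F.omegaBar α γ d x * σ γ x

/-- The covariant derivative `∇_d t_{αβ}` of a tensor `t_{αβ}`. -/
def cov2 (d : Dir n) (t : Fin n → Fin n → M → ℂ) (α β : Fin n) (x : M) : ℂ :=
  (F.field d).deriv (t α β) x - ∑ γ, F.omega α γ d x * t γ β x - ∑ γ, F.omega β γ d x * t α γ x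

/-- The divergence `∇^α σ_α = h^{αβ̄} ∇_β̄ σ_α`. -/
def div (σ : Fin n → M → ℂ) (x : M) : ℂ := ∑ α, ∑ β, F.hInv α β x * F.cov (.anti β) σ α x

/-- The divergence `∇^ᾱ σ_ᾱ = h^{αβ̄} ∇_α σ_β̄`. -/
def divBar (σ : Fin n → M → ℂ) (x : M) : ℂ := ∑ α, ∑ β, F.hInv α β x * F.covBar (.hol α) σ β x

/-- The sublaplacian `Δ_b u = -(∇^α ∇_α u + ∇_α ∇^α u)`. -/
def sublaplacian (u : M → ℂ) (x : M) : ℂ := -(F.div (F.grad u) x + F.divBar (F.gradBar u) x)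

/-- `∇^α (A_{αβ} ∇^β u)`. -/
def torsionDiv (u : M → ℂ) (x : M) : ℂ :=
  F.div (fun α y => ∑ β, F.A α β y * F.gradUp u β y) x

/-- `∇^β A_{αβ}`. -/
def divA (α : Fin n) (x : M) : ℂ := ∑ β, ∑ γ, F.hInv β γ x * F.cov2 (.anti γ) F.A α β x

/-- `|A_{αβ}|^2 = A_{αβ} A^{αβ}`. -/
def normSqA (x : M) : ℂ :=
  ∑ α, ∑ β, ∑ γ, ∑ δ,
    F.A α β x * F.hInv α γ x * F.hInv β δ x * starRingEnd ℂ (F.A γ δ x)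

/-- `|t_{αβ̄}|^2 = t_{αβ̄} t^{αβ̄}` for the tracefree Schouten tensor `t`. -/
def normSqSchouten0 (x : M) : ℂ :=
  ∑ α, ∑ β, ∑ γ, ∑ δ,
    F.schouten0 α β x * F.hInv α γ x * F.hInv δ β x * F.schouten0 δ γ x

/-- `∇_β̄ (t^{αβ̄} ∇_α u) = ∇_β̄ (h^{δβ̄} t_{δγ̄} ∇^γ̄ u) = ∇^δ (t_{δγ̄} ∇^γ̄ u)` for the tracefree
Schouten tensor `t`. -/
def schoutenDiv (u : M → ℂ) (x : M) : ℂ :=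
  F.div (fun δ y => ∑ γ, F.schouten0 δ γ y * F.gradBarUp u γ y) x

/-- `W_α = ∇_α R - i ∇^β A_{αβ}`. -/
def W (α : Fin n) (x : M) : ℂ := F.grad F.R α x - Complex.I * F.divA α x

/-- The zeroth order part `Q_4` of the CR Paneitz operator. -/
def Q4 (x : M) : ℂ :=
  2 * ((n : ℂ) + 1) ^ 2 / (n * (n + 2)) * F.sublaplacian F.P x -
    4 / (n * ((n : ℂ) + 2)) * (F.div F.divA x).im -
    2 * ((n : ℂ) - 1) / n * F.normSqA x -
    2 * ((n : ℂ) + 1) / n * F.normSqSchouten0 x +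
    2 * ((n : ℂ) - 1) * (n + 1) ^ 2 / n ^ 2 * F.P x ^ 2

/-- The CR Paneitz operator `P_4` in dimension `2n+1`. -/
def paneitz (u : M → ℂ) (x : M) : ℂ :=
  F.sublaplacian (F.sublaplacian u) x + F.nabla0 (F.nabla0 u) x -
    4 * (F.torsionDiv u x).im + 4 * (F.schoutenDiv u x).re -
    4 * ((n : ℂ) ^ 2 - 1) / n * (F.div (fun β y => F.P y * F.grad u β y) x).re +
    ((n : ℂ) - 1) / 2 * F.Q4 x * u x

/-- The explicit expression for the `P'`-operator; the real parameter `ν` stands for the dimensional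
parameter `n` in the coefficients. -/
def pPrime (ν : ℝ) (u : M → ℂ) (x : M) : ℂ :=
  2 * ((ν : ℂ) + 1) / ν ^ 2 * F.sublaplacian (F.sublaplacian u) x -
    8 / (ν : ℂ) * (F.torsionDiv u x).im -
    8 * ((ν : ℂ) + 1) / ν * (F.div (fun α y => F.P y * F.grad u α y) x).re +
    16 * ((ν : ℂ) + 1) / (ν * (ν + 2)) *
      (∑ α, (F.grad F.P α x - Complex.I * ν / (2 * ((ν : ℂ) + 1)) * F.divA α x) *
        F.gradUp u α x).re +
    (2 * ((ν : ℂ) + 1) ^ 2 / (ν * (ν + 2)) * F.sublaplacian F.P x -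
      4 / (ν * ((ν : ℂ) + 2)) * (F.div F.divA x).im -
      2 * ((ν : ℂ) - 1) / ν * F.normSqA x -
      2 * ((ν : ℂ) + 1) / ν * F.normSqSchouten0 x +
      2 * ((ν : ℂ) - 1) * (ν + 1) ^ 2 / ν ^ 2 * F.P x ^ 2) * u x

/-- The explicit expression for the critical `P'`-operator (`n = 1`). -/
def criticalPPrime (u : M → ℂ) (x : M) : ℂ :=
  4 * F.sublaplacian (F.sublaplacian u) x - 8 * (F.torsionDiv u x).im -
    4 * (F.div (fun α y => F.R y * F.grad u α y) x).re +
    8 / 3 * (∑ α, F.W α x * F.gradUp u α x).re +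
    2 / 3 * (F.sublaplacian F.R x - 2 * (F.div F.divA x).im) * u x

end PseudohermitianStructure.AdmissibleFrame

end Pseudohermitian

section Rationality

/-- The pseudohermitian operators, defined in all dimensions, of which the `P'`-operator is a
combination with coefficients depending only on the dimension. -/
inductive PPrimeTerm where
  | sublaplacianSq
  | imTorsionDiv
  | reDivPGrad
  | reGradPGrad
  | reIDivAGrad
  | sublaplacianP
  | imDivDivA
  | normSqA
  | normSqSchouten0
  | PSq
  deriving DecidableEq

instance : Fintype PPrimeTerm where
  elems := {.sublaplacianSq, .imTorsionDiv, .reDivPGrad, .reGradPGrad, .reIDivAGrad,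
    .sublaplacianP, .imDivDivA, .normSqA, .normSqSchouten0, .PSq}
  complete t := by cases t <;> simp

variable {n : ℕ} {M : Type*} [TopologicalSpace M]
  [ChartedSpace (EuclideanSpace ℝ (Fin (2 * n + 1))) M]
  [IsManifold (𝓡 (2 * n + 1)) ∞ M]
  {S : PseudohermitianStructure n M} {U : Set M}

/-- The operator named by a term. -/
def PPrimeTerm.eval (F : S.AdmissibleFrame U) (u : M → ℂ) (x : M) : PPrimeTerm → ℂ
  | .sublaplacianSq => F.sublaplacian (F.sublaplacian u) x
  | .imTorsionDiv => (F.torsionDiv u x).im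
  | .reDivPGrad => (F.div (fun α y => F.P y * F.grad u α y) x).re
  | .reGradPGrad => (∑ α, F.grad F.P α x * F.gradUp u α x).re
  | .reIDivAGrad => (∑ α, Complex.I * F.divA α x * F.gradUp u α x).re
  | .sublaplacianP => F.sublaplacian F.P x * u x
  | .imDivDivA => (F.div F.divA x).im * u x
  | .normSqA => F.normSqA x * u x
  | .normSqSchouten0 => F.normSqSchouten0 x * u x
  | .PSq => F.P x ^ 2 * u x

/-- The coefficient of a term in the `P'`-operator, as a function of the dimensional parameter. -/
def PPrimeTerm.coeff (ν : ℝ) : PPrimeTerm → ℝ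
  | .sublaplacianSq => 2 * (ν + 1) / ν ^ 2
  | .imTorsionDiv => -(8 / ν)
  | .reDivPGrad => -(8 * (ν + 1) / ν)
  | .reGradPGrad => 16 * (ν + 1) / (ν * (ν + 2))
  | .reIDivAGrad => -(8 / (ν + 2))
  | .sublaplacianP => 2 * (ν + 1) ^ 2 / (ν * (ν + 2))
  | .imDivDivA => -(4 / (ν * (ν + 2)))
  | .normSqA => -(2 * (ν - 1) / ν)
  | .normSqSchouten0 => -(2 * (ν + 1) / ν)
  | .PSq => 2 * (ν - 1) * (ν + 1) ^ 2 / ν ^ 2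

/-- `c` is a rational function of the real parameter without a pole at `a`. -/
def IsRationalRegularAt (c : ℝ → ℝ) (a : ℝ) : Prop :=
  ∃ p q : Polynomial ℝ, q.eval a ≠ 0 ∧ ∀ ν, q.eval ν ≠ 0 → c ν = p.eval ν / q.eval ν

end Rationality

end CRGeom

end

/-!
The structure equations of a pseudohermitian manifold only involve the frame fields as derivations
and their commutators, so the curvature identities hold in any complex `*`-algebra with such a
frame: they follow from the Jacobi identity for the structure functions and from `d² = 0` for the
trace of the connection form. In particular
`∇^β̄ R_{αβ̄} = ∇_α R - i (n - 1) ∇^β A_{αβ}`.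

If `v` is a CR function then `Δ_b v` is a multiple of `T v`, and commuting derivatives gives, for
`u = v + v̄`, the identity `Δ_b² u + n² T² u = 4 n Im ∇^α (A_{αβ} ∇^β u)`. This eliminates `T² u`
from `P₄ u`. For such `u` the divergence of the tracefree Ricci tensor contracted with `∇u` has no
second order part, and by the identity above it is `n - 1` times a first order term. Every
remaining term of `P₄ u` then carries the factor `n - 1`, and dividing by it yields the
`P'`-operator. Its coefficients are rational functions of the dimension, regular at `1`, so the
critical operator is its value at `1`.
-/

noncomputable section

namespace CRGeom

/-! ### Moving frames -/

/-- A moving frame on a commutative algebra: derivations `e i` that are linearly independent over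
the algebra and closed under commutators, with structure functions `C`. -/
structure MovingFrame (R κ A : Type*) [Fintype κ] [CommRing R] [CommRing A] [Algebra R A] where
  e : κ → Derivation R A A
  C : κ → κ → κ → A
  lie : ∀ i j f, e i (e j f) - e j (e i f) = ∑ k, C i j k * e k f
  indep : ∀ a : κ → A, (∀ f, ∑ k, a k * e k f = 0) → ∀ k, a k = 0

namespace MovingFrame

variable {R κ A : Type*} [Fintype κ] [CommRing R] [CommRing A] [Algebra R A]
  (F : MovingFrame R κ A)

theorem C_antisymm (i j k : κ) : F.C i j k = -F.C j i k :=
  eq_neg_of_add_eq_zero_left <| F.indep (fun k => F.C i j k + F.C j i k) (fun f => by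
    simp only [add_mul, Finset.sum_add_distrib, ← F.lie]
    ring) k

@[simp]
theorem C_self (i k : κ) : F.C i i k = 0 :=
  F.indep (F.C i i) (fun f => by rw [← F.lie, sub_self]) k

theorem sum_jacobi_mul_e (i j k : κ) (f : A) :
    ∑ l, (F.e i (F.C j k l) + ∑ m, F.C j k m * F.C i m l) * F.e l f =
      F.e i (F.e j (F.e k f)) - F.e i (F.e k (F.e j f)) -
        (F.e j (F.e k (F.e i f)) - F.e k (F.e j (F.e i f))) := by
  have derivative_of_bracket : F.e i (F.e j (F.e k f)) - F.e i (F.e k (F.e j f)) =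
      ∑ l, (F.C j k l * F.e i (F.e l f) + F.e i (F.C j k l) * F.e l f) := by
    rw [← map_sub, F.lie, map_sum]
    refine Finset.sum_congr rfl fun l _ => ?_
    rw [Derivation.leibniz, smul_eq_mul, smul_eq_mul, mul_comm (F.e l f)]
  have bracket_of_bracket : ∑ l, (∑ m, F.C j k m * F.C i m l) * F.e l f =
      ∑ m, F.C j k m * (F.e i (F.e m f) - F.e m (F.e i f)) := by
    simp only [F.lie i _ f, Finset.mul_sum, Finset.sum_mul, ← mul_assoc]
    exact Finset.sum_comm
  simp only [derivative_of_bracket, F.lie j k (F.e i f), add_mul, Finset.sum_add_distrib,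
    bracket_of_bracket, mul_sub, Finset.sum_sub_distrib]
  ring

theorem jacobi (i j k l : κ) :
    (F.e i (F.C j k l) + ∑ m, F.C j k m * F.C i m l) +
      (F.e j (F.C k i l) + ∑ m, F.C k i m * F.C j m l) +
      (F.e k (F.C i j l) + ∑ m, F.C i j m * F.C k m l) = 0 := by
  refine F.indep (fun l => (F.e i (F.C j k l) + ∑ m, F.C j k m * F.C i m l) +
    (F.e j (F.C k i l) + ∑ m, F.C k i m * F.C j m l) +
    (F.e k (F.C i j l) + ∑ m, F.C i j m * F.C k m l)) (fun f => ?_) l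
  have cyclic_sum := congrArg₂ (· + ·)
    (congrArg₂ (· + ·) (F.sum_jacobi_mul_e i j k f) (F.sum_jacobi_mul_e j k i f))
    (F.sum_jacobi_mul_e k i j f)
  simp only [← Finset.sum_add_distrib, ← add_mul] at cyclic_sum
  rw [cyclic_sum]
  ring

/-- The exterior derivative `(dϖ)(e_i, e_j)` of the `1`-form with components `ϖ i = ϖ(e_i)`. -/
def extDeriv (ϖ : κ → A) (i j : κ) : A := F.e i (ϖ j) - F.e j (ϖ i) - ∑ k, F.C i j k * ϖ k

theorem extDeriv_antisymm (ϖ : κ → A) (i j : κ) : F.extDeriv ϖ i j = -F.extDeriv ϖ j i := by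
  simp only [extDeriv, F.C_antisymm i j, neg_mul, Finset.sum_neg_distrib]
  ring

theorem extDeriv_add (ϖ η : κ → A) (i j : κ) :
    F.extDeriv (fun k => ϖ k + η k) i j = F.extDeriv ϖ i j + F.extDeriv η i j := by
  simp only [extDeriv, map_add, mul_add, Finset.sum_add_distrib]
  ring

theorem e_extDeriv (ϖ : κ → A) (i j k : κ) :
    F.e i (F.extDeriv ϖ j k) = F.e i (F.e j (ϖ k)) - F.e i (F.e k (ϖ j)) -
      (∑ l, F.C j k l * F.e i (ϖ l) + ∑ l, F.e i (F.C j k l) * ϖ l) := by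
  rw [extDeriv, map_sub, map_sub, map_sum, ← Finset.sum_add_distrib]
  congr 1
  refine Finset.sum_congr rfl fun l _ => ?_
  rw [Derivation.leibniz, smul_eq_mul, smul_eq_mul, mul_comm (ϖ l)]

theorem sum_C_mul_extDeriv (ϖ : κ → A) (i j k : κ) :
    ∑ m, F.C i j m * F.extDeriv ϖ m k =
      (F.e i (F.e j (ϖ k)) - F.e j (F.e i (ϖ k))) - ∑ m, F.C i j m * F.e k (ϖ m) +
        ∑ l, (∑ m, F.C i j m * F.C k m l) * ϖ l := by
  have swap : ∑ m, F.C i j m * ∑ l, F.C m k l * ϖ l =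
      -∑ l, (∑ m, F.C i j m * F.C k m l) * ϖ l := by
    simp only [Finset.mul_sum, Finset.sum_mul, ← Finset.sum_neg_distrib]
    rw [Finset.sum_comm]
    refine Finset.sum_congr rfl fun l _ => Finset.sum_congr rfl fun m _ => ?_
    rw [F.C_antisymm m k]
    ring
  simp only [extDeriv, mul_sub, Finset.sum_sub_distrib, F.lie i j (ϖ k), swap, sub_neg_eq_add]

theorem extDeriv_extDeriv (ϖ : κ → A) (i j k : κ) :
    (F.e i (F.extDeriv ϖ j k) - ∑ m, F.C i j m * F.extDeriv ϖ m k) +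
      (F.e j (F.extDeriv ϖ k i) - ∑ m, F.C j k m * F.extDeriv ϖ m i) +
      (F.e k (F.extDeriv ϖ i j) - ∑ m, F.C k i m * F.extDeriv ϖ m j) = 0 := by
  have jacobi_mul : ∑ l, ((F.e i (F.C j k l) + ∑ m, F.C j k m * F.C i m l) +
      (F.e j (F.C k i l) + ∑ m, F.C k i m * F.C j m l) +
      (F.e k (F.C i j l) + ∑ m, F.C i j m * F.C k m l)) * ϖ l = 0 :=
    Finset.sum_eq_zero fun l _ => by rw [F.jacobi, zero_mul]
  simp only [add_mul _ _ (ϖ _), Finset.sum_add_distrib] at jacobi_mul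
  simp only [e_extDeriv, sum_C_mul_extDeriv]
  linear_combination -jacobi_mul

end MovingFrame

section ComplexAlgebra

variable (𝒜 : Type*) [CommRing 𝒜] [Algebra ℂ 𝒜]

/-- The imaginary unit of a complex algebra, as an element of the algebra. -/
def imagUnit : 𝒜 := algebraMap ℂ 𝒜 Complex.I

theorem imagUnit_mul_self : imagUnit 𝒜 * imagUnit 𝒜 = -1 := by
  rw [imagUnit, ← map_mul, Complex.I_mul_I, map_neg, map_one]

theorem star_imagUnit [StarRing 𝒜] [StarModule ℂ 𝒜] : star (imagUnit 𝒜) = -imagUnit 𝒜 := by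
  rw [imagUnit, ← algebraMap_star_comm, Complex.star_def, Complex.conj_I, map_neg]

variable {𝒜}

@[simp]
theorem derivation_imagUnit (D : Derivation ℂ 𝒜 𝒜) : D (imagUnit 𝒜) = 0 :=
  D.map_algebraMap Complex.I

theorem imagUnit_mul_cancel {a b : 𝒜} (hab : imagUnit 𝒜 * a = imagUnit 𝒜 * b) : a = b := by
  linear_combination -imagUnit 𝒜 * hab + (a - b) * imagUnit_mul_self 𝒜

theorem algebraMap_inv_natCast_mul {n : ℕ} (hn : n ≠ 0) :
    algebraMap ℂ 𝒜 (n : ℂ)⁻¹ * n = 1 := by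
  rw [← map_natCast (algebraMap ℂ 𝒜) n, ← map_mul, inv_mul_cancel₀ (by exact_mod_cast hn),
    map_one]

end ComplexAlgebra

namespace Dir

variable {n : ℕ}

theorem conj_conj (d : Dir n) : d.conj.conj = d := by cases d <;> rfl

theorem conj_involutive : Function.Involutive (Dir.conj (n := n)) := conj_conj

/-- The enumeration of the directions `0, α, ᾱ` that gives sums over directions their meaning. -/
def equivOption (n : ℕ) : Option (Fin n ⊕ Fin n) ≃ Dir n where
  toFun := fun | none => .zero | some (.inl α) => .hol α | some (.inr α) => .anti α
  invFun := fun | .zero => none | .hol α => some (.inl α) | .anti α => some (.inr α)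
  left_inv := by rintro (_ | _ | _) <;> rfl
  right_inv := by rintro (_ | _ | _) <;> rfl

instance (n : ℕ) : Fintype (Dir n) := Fintype.ofEquiv _ (equivOption n)

theorem sum_eq {B : Type*} [AddCommMonoid B] (f : Dir n → B) :
    ∑ d, f d = f .zero + ∑ α, f (.hol α) + ∑ α, f (.anti α) := by
  rw [← Equiv.sum_comp (equivOption n) f, Fintype.sum_option, Fintype.sum_sum_type, ← add_assoc]
  rfl

end Dir

/-! ### Algebraic admissible frames -/

/-- The algebraic counterpart of an admissible frame `T, Z_α, Z_ᾱ` on a complex `*`-algebra, which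
plays the role of the smooth functions. The conditions on the structure functions say that `T` is
the Reeb field and that `T^{1,0}` is closed under brackets; the Levi form is
`h_{αβ̄} = i θ([Z_α, Z_β̄])`, and `hInv` is its inverse. -/
structure CRFrame (n : ℕ) (𝒜 : Type*) [CommRing 𝒜] [StarRing 𝒜] [Algebra ℂ 𝒜] [StarModule ℂ 𝒜]
    extends MovingFrame ℂ (Dir n) 𝒜 where
  hInv : Fin n → Fin n → 𝒜
  star_e : ∀ d f, star (e d f) = e d.conj (star f)
  C_zero_hol_zero : ∀ α, C .zero (.hol α) .zero = 0
  C_hol_hol_zero : ∀ α β, C (.hol α) (.hol β) .zero = 0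
  C_hol_hol_anti : ∀ α β γ, C (.hol α) (.hol β) (.anti γ) = 0
  sum_hInv_mul_levi : ∀ α γ, ∑ β, hInv α β * (imagUnit 𝒜 * C (.hol γ) (.anti β) .zero) =
    if α = γ then 1 else 0

namespace CRFrame

attribute [simp] C_zero_hol_zero C_hol_hol_zero C_hol_hol_anti

variable {n : ℕ} {𝒜 : Type*} [CommRing 𝒜] [StarRing 𝒜] [Algebra ℂ 𝒜] [StarModule ℂ 𝒜]
  (F : CRFrame n 𝒜)

theorem star_C (i j k : Dir n) : star (F.C i j k) = F.C i.conj j.conj k.conj := by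
  rw [← sub_eq_zero, ← Dir.conj_conj k]
  refine F.indep (fun k => star (F.C i j k.conj) - F.C i.conj j.conj k.conj.conj)
    (fun f => ?_) k.conj
  have star_lie : ∑ k, F.C i.conj j.conj k * F.e k f = ∑ k, star (F.C i j k) * F.e k.conj f := by
    simpa only [star_sub, star_sum, star_mul', F.star_e, star_star, F.lie i.conj j.conj f]
      using congrArg star (F.lie i j (star f))
  simp only [Dir.conj_conj, sub_mul, Finset.sum_sub_distrib, star_lie]
  rw [← Equiv.sum_comp Dir.conj_involutive.toPerm, sub_eq_zero]
  simp only [Function.Involutive.coe_toPerm, Dir.conj_conj]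

/-! ### The Levi form -/

/-- The Levi form `h_{αβ̄}`. -/
def h (α β : Fin n) : 𝒜 := imagUnit 𝒜 * F.C (.hol α) (.anti β) .zero

@[simp]
theorem C_hol_anti_zero (α β : Fin n) :
    F.C (.hol α) (.anti β) .zero = -(imagUnit 𝒜 * F.h α β) := by
  rw [h, ← mul_assoc, imagUnit_mul_self, neg_one_mul, neg_neg]

@[simp]
theorem C_anti_hol_zero (β α : Fin n) :
    F.C (.anti β) (.hol α) .zero = imagUnit 𝒜 * F.h α β := by
  rw [F.C_antisymm, C_hol_anti_zero, neg_neg]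

theorem star_h (α β : Fin n) : star (F.h α β) = F.h β α := by
  rw [h, star_mul', star_imagUnit, star_C]
  simp only [Dir.conj]
  rw [F.C_antisymm, neg_mul_neg, h]

theorem sum_hInv_mul_h (α γ : Fin n) :
    ∑ β, F.hInv α β * F.h γ β = if α = γ then 1 else 0 := F.sum_hInv_mul_levi α γ

theorem sum_hInv_mul_h_left (β δ : Fin n) :
    ∑ α, F.hInv α β * F.h α δ = if β = δ then 1 else 0 := by
  have hInv_mul_h : Matrix.of F.hInv * (Matrix.of F.h).transpose = 1 := by
    ext α γ
    simp [Matrix.mul_apply, F.sum_hInv_mul_h, Matrix.one_apply]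
  have h_mul_hInv := mul_eq_one_comm.mp hInv_mul_h
  simpa [Matrix.mul_apply, Matrix.one_apply, mul_comm, eq_comm] using
    Matrix.ext_iff.mpr h_mul_hInv δ β

theorem eq_sum_hInv_mul_sum_h (a : Fin n → 𝒜) (μ : Fin n) :
    a μ = ∑ γ, F.hInv μ γ * ∑ δ, a δ * F.h δ γ := by
  simp only [Finset.mul_sum]
  rw [Finset.sum_comm]
  simp only [mul_left_comm _ (a _), ← Finset.mul_sum, sum_hInv_mul_h, mul_ite, mul_one, mul_zero,
    Finset.sum_ite_eq, Finset.mem_univ, if_true]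

theorem eq_of_sum_mul_h_eq {a b : Fin n → 𝒜}
    (hab : ∀ γ, ∑ δ, a δ * F.h δ γ = ∑ δ, b δ * F.h δ γ) (μ : Fin n) : a μ = b μ := by
  rw [F.eq_sum_hInv_mul_sum_h a, F.eq_sum_hInv_mul_sum_h b]
  simp only [hab]

theorem star_hInv (α β : Fin n) : star (F.hInv α β) = F.hInv β α := by
  refine F.eq_of_sum_mul_h_eq (a := fun β => star (F.hInv α β)) (b := fun β => F.hInv β α)
    (fun γ => ?_) β
  rw [F.sum_hInv_mul_h_left]
  simpa [F.star_h, mul_comm, apply_ite star] using congrArg star (F.sum_hInv_mul_h α γ)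

/-! ### The Tanaka–Webster connection -/

/-- The value `ω_α^γ(e_d)` of the Tanaka–Webster connection form on a frame field. -/
def omega (α γ : Fin n) : Dir n → 𝒜
  | .zero => F.C .zero (.hol α) (.hol γ)
  | .hol β => ∑ δ, F.hInv γ δ * (F.e (.hol β) (F.h α δ) -
      ∑ σ, F.h α σ * star (F.C (.anti β) (.hol δ) (.hol σ)))
  | .anti β => F.C (.anti β) (.hol α) (.hol γ)

/-- The torsion `A_{αβ}`: lowering an index gives the `(0,1)` part of `[Z_β, T]`. -/
def A (α β : Fin n) : 𝒜 := -∑ γ, F.h α γ * F.C .zero (.hol β) (.anti γ)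

@[simp]
theorem C_hol_zero (α : Fin n) (k : Dir n) : F.C (.hol α) .zero k = -F.C .zero (.hol α) k :=
  F.C_antisymm _ _ _

@[simp]
theorem C_anti_zero (α : Fin n) (k : Dir n) : F.C (.anti α) .zero k = -F.C .zero (.anti α) k :=
  F.C_antisymm _ _ _

@[simp]
theorem C_zero_anti_zero (α : Fin n) : F.C .zero (.anti α) .zero = 0 := by
  simpa [Dir.conj] using (F.star_C .zero (.hol α) .zero).symm

@[simp]
theorem C_anti_anti_zero (α β : Fin n) : F.C (.anti α) (.anti β) .zero = 0 := by
  simpa [Dir.conj] using (F.star_C (.hol α) (.hol β) .zero).symm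

@[simp]
theorem C_anti_anti_hol (α β γ : Fin n) : F.C (.anti α) (.anti β) (.hol γ) = 0 := by
  simpa [Dir.conj] using (F.star_C (.hol α) (.hol β) (.anti γ)).symm

@[simp]
theorem C_zero_hol_hol (α γ : Fin n) : F.C .zero (.hol α) (.hol γ) = F.omega α γ .zero := rfl

@[simp]
theorem C_zero_anti_hol (α γ : Fin n) :
    F.C .zero (.anti α) (.hol γ) = star (F.C .zero (.hol α) (.anti γ)) :=
  (F.star_C .zero (.hol α) (.anti γ)).symm

@[simp]
theorem C_zero_anti_anti (α γ : Fin n) :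
    F.C .zero (.anti α) (.anti γ) = star (F.omega α γ .zero) :=
  (F.star_C .zero (.hol α) (.hol γ)).symm

@[simp]
theorem C_anti_hol_hol (β α γ : Fin n) :
    F.C (.anti β) (.hol α) (.hol γ) = F.omega α γ (.anti β) := rfl

@[simp]
theorem C_hol_anti_hol (α β γ : Fin n) :
    F.C (.hol α) (.anti β) (.hol γ) = -F.omega α γ (.anti β) := F.C_antisymm _ _ _

@[simp]
theorem C_hol_anti_anti (α β γ : Fin n) :
    F.C (.hol α) (.anti β) (.anti γ) = star (F.omega β γ (.anti α)) :=
  (F.star_C (.anti α) (.hol β) (.hol γ)).symm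

@[simp]
theorem C_anti_hol_anti (β α γ : Fin n) :
    F.C (.anti β) (.hol α) (.anti γ) = -star (F.omega β γ (.anti α)) := by
  rw [F.C_antisymm, C_hol_anti_anti]

theorem sum_omega_hol_mul_h (α β δ : Fin n) : ∑ γ, F.omega α γ (.hol β) * F.h γ δ =
    F.e (.hol β) (F.h α δ) - ∑ σ, F.h α σ * star (F.omega δ σ (.anti β)) := by
  simp only [omega, Finset.sum_mul]
  rw [Finset.sum_comm]
  simp only [mul_right_comm (F.hInv _ _), ← Finset.sum_mul, sum_hInv_mul_h_left, ite_mul,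
    one_mul, zero_mul, Finset.sum_ite_eq', Finset.mem_univ, if_true]

theorem C_hol_hol_hol (α β δ : Fin n) :
    F.C (.hol α) (.hol β) (.hol δ) = F.omega β δ (.hol α) - F.omega α δ (.hol β) := by
  refine F.eq_of_sum_mul_h_eq (a := fun δ => F.C (.hol α) (.hol β) (.hol δ))
    (b := fun δ => F.omega β δ (.hol α) - F.omega α δ (.hol β)) (fun γ => ?_) δ
  simp only [sub_mul, Finset.sum_sub_distrib, sum_omega_hol_mul_h]
  have jacobi : -(imagUnit 𝒜 * F.e (.hol α) (F.h β γ)) +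
      -(imagUnit 𝒜 * ∑ σ, F.h α σ * star (F.omega γ σ (.anti β))) +
      (imagUnit 𝒜 * F.e (.hol β) (F.h α γ) +
        imagUnit 𝒜 * ∑ σ, F.h β σ * star (F.omega γ σ (.anti α))) +
      imagUnit 𝒜 * ∑ δ, F.C (.hol α) (.hol β) (.hol δ) * F.h δ γ = 0 := by
    simpa [Dir.sum_eq, mul_left_comm _ (imagUnit 𝒜), ← Finset.mul_sum,
      mul_comm (star _) (F.h _ _)] using F.jacobi (.hol α) (.hol β) (.anti γ) .zero
  apply imagUnit_mul_cancel
  linear_combination jacobi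

theorem A_symm (α β : Fin n) : F.A α β = F.A β α := by
  have jacobi : imagUnit 𝒜 * ∑ γ, F.h α γ * F.C .zero (.hol β) (.anti γ) +
      -(imagUnit 𝒜 * ∑ γ, F.h β γ * F.C .zero (.hol α) (.anti γ)) = 0 := by
    simpa [Dir.sum_eq, mul_left_comm _ (imagUnit 𝒜), ← Finset.mul_sum,
      mul_comm (F.C _ _ _) (F.h _ _)] using F.jacobi .zero (.hol α) (.hol β) .zero
  rw [A, A]
  apply imagUnit_mul_cancel
  linear_combination -jacobi

theorem e_zero_h (α δ : Fin n) : F.e .zero (F.h α δ) =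
    ∑ γ, F.omega α γ .zero * F.h γ δ + ∑ σ, F.h α σ * star (F.omega δ σ .zero) := by
  have jacobi : -(imagUnit 𝒜 * F.e .zero (F.h α δ)) +
      imagUnit 𝒜 * ∑ σ, F.h α σ * star (F.omega δ σ .zero) +
      imagUnit 𝒜 * ∑ γ, F.omega α γ .zero * F.h γ δ = 0 := by
    simpa [Dir.sum_eq, mul_left_comm _ (imagUnit 𝒜), ← Finset.mul_sum,
      mul_comm (star _) (F.h _ _)] using F.jacobi .zero (.hol α) (.anti δ) .zero
  apply imagUnit_mul_cancel
  linear_combination -jacobi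

theorem e_h (d : Dir n) (α δ : Fin n) : F.e d (F.h α δ) =
    ∑ γ, F.omega α γ d * F.h γ δ + ∑ σ, F.h α σ * star (F.omega δ σ d.conj) := by
  have e_hol_h (β α δ : Fin n) : F.e (.hol β) (F.h α δ) =
      ∑ γ, F.omega α γ (.hol β) * F.h γ δ + ∑ σ, F.h α σ * star (F.omega δ σ (.anti β)) := by
    rw [sum_omega_hol_mul_h, sub_add_cancel]
  cases d with
  | zero => exact F.e_zero_h α δ
  | hol β => exact e_hol_h β α δ
  | anti β =>
    have star_e_hol_h := congrArg star (e_hol_h β δ α)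
    simp only [F.star_e, star_h, star_add, star_sum, star_mul', star_star, Dir.conj,
      mul_comm (star _), mul_comm (F.h _ _) (F.omega _ _ _)] at star_e_hol_h ⊢
    rw [star_e_hol_h, add_comm]

theorem star_extDeriv (ϖ : Dir n → 𝒜) (i j : Dir n) :
    star (F.extDeriv ϖ i j) = F.extDeriv (fun d => star (ϖ d.conj)) i.conj j.conj := by
  simp only [MovingFrame.extDeriv, star_sub, star_sum, star_mul', F.star_e, F.star_C,
    Dir.conj_conj]
  rw [← Equiv.sum_comp Dir.conj_involutive.toPerm fun d =>
    F.C i.conj j.conj d * star (ϖ d.conj)]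
  simp only [Function.Involutive.coe_toPerm, Dir.conj_conj]

/-! ### Contractions with the Levi form -/

theorem sum_hInv_mul_sum_h_mul (a : Fin n → 𝒜) (δ : Fin n) :
    ∑ μ, F.hInv μ δ * ∑ β, F.h μ β * a β = a δ := by
  simp only [Finset.mul_sum, ← mul_assoc]
  rw [Finset.sum_comm]
  simp only [← Finset.sum_mul, sum_hInv_mul_h_left, ite_mul, one_mul, zero_mul,
    Finset.sum_ite_eq, Finset.mem_univ, if_true]

/-- The trace `h^{αβ̄} t_{αβ̄}`. -/
def trace (t : Fin n → Fin n → 𝒜) : 𝒜 := ∑ α, ∑ β, F.hInv α β * t α β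

theorem trace_h : F.trace F.h = n := by
  simp [trace, F.sum_hInv_mul_h]

theorem trace_sum_h_mul (a : Fin n → Fin n → 𝒜) :
    F.trace (fun α β => ∑ μ, F.h α μ * a β μ) = ∑ β, a β β := by
  rw [trace, Finset.sum_comm]
  simp only [sum_hInv_mul_sum_h_mul]

theorem trace_sum_mul_h (a : Fin n → Fin n → 𝒜) :
    F.trace (fun α β => ∑ μ, a α μ * F.h μ β) = ∑ α, a α α := by
  simp only [trace, ← eq_sum_hInv_mul_sum_h]

theorem sum_hInv_mul_h_mul (a : Fin n → 𝒜) (γ : Fin n) :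
    ∑ δ, ∑ β, F.hInv δ β * (F.h δ γ * a β) = a γ := by
  rw [Finset.sum_comm]
  simp only [← mul_assoc, ← Finset.sum_mul, sum_hInv_mul_h_left, ite_mul, one_mul, zero_mul,
    Finset.sum_ite_eq', Finset.mem_univ, if_true]

theorem derivation_hInv (D : Derivation ℂ 𝒜 𝒜) (α δ : Fin n) :
    D (F.hInv α δ) = -∑ μ, F.hInv μ δ * ∑ σ, F.hInv α σ * D (F.h μ σ) := by
  have leibniz (μ : Fin n) :
      ∑ σ, F.h μ σ * D (F.hInv α σ) = -∑ σ, F.hInv α σ * D (F.h μ σ) := by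
    have derivative := congrArg D (F.sum_hInv_mul_h α μ)
    simp only [map_sum, Derivation.leibniz, smul_eq_mul, Finset.sum_add_distrib, apply_ite D,
      map_zero, Derivation.map_one_eq_zero, ite_self] at derivative
    linear_combination derivative
  rw [← F.sum_hInv_mul_sum_h_mul (fun σ => D (F.hInv α σ)) δ]
  simp only [leibniz, mul_neg, Finset.sum_neg_distrib]

theorem e_hInv (d : Dir n) (α δ : Fin n) : F.e d (F.hInv α δ) =
    -∑ μ, F.hInv μ δ * F.omega μ α d - ∑ σ, F.hInv α σ * star (F.omega σ δ d.conj) := by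
  have conj_part : ∑ μ, F.hInv μ δ * ∑ σ, F.hInv α σ *
      ∑ γ, F.h μ γ * star (F.omega σ γ d.conj) =
        ∑ σ, F.hInv α σ * star (F.omega σ δ d.conj) := by
    simp only [Finset.mul_sum _ _ (F.hInv _ δ)]
    rw [Finset.sum_comm]
    refine Finset.sum_congr rfl fun σ _ => ?_
    simp only [mul_left_comm (F.hInv _ δ), ← Finset.mul_sum _ _ (F.hInv α σ),
      sum_hInv_mul_sum_h_mul]
  simp only [derivation_hInv, e_h, mul_add, Finset.sum_add_distrib, conj_part,
    ← eq_sum_hInv_mul_sum_h]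
  ring

/-! ### Covariant derivatives -/

/-- The covariant derivative `∇_d σ_α` of a form of type `(1,0)`. -/
def cov (d : Dir n) (σ : Fin n → 𝒜) (α : Fin n) : 𝒜 := F.e d (σ α) - ∑ γ, F.omega α γ d * σ γ

/-- The covariant derivative `∇_d σ_ᾱ` of a form of type `(0,1)`. -/
def covBar (d : Dir n) (σ : Fin n → 𝒜) (α : Fin n) : 𝒜 :=
  F.e d (σ α) - ∑ γ, star (F.omega α γ d.conj) * σ γ

/-- The covariant derivative `∇_d t_{αβ}`. -/
def cov2 (d : Dir n) (t : Fin n → Fin n → 𝒜) (α β : Fin n) : 𝒜 :=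
  F.e d (t α β) - ∑ γ, F.omega α γ d * t γ β - ∑ γ, F.omega β γ d * t α γ

/-- The covariant derivative `∇_d t_{αβ̄}`. -/
def covMixed (d : Dir n) (t : Fin n → Fin n → 𝒜) (α β : Fin n) : 𝒜 :=
  F.e d (t α β) - ∑ γ, F.omega α γ d * t γ β - ∑ γ, star (F.omega β γ d.conj) * t α γ

/-- The divergence `∇^α t_{αγ̄} = h^{αβ̄} ∇_β̄ t_{αγ̄}`. -/
def divMixed (t : Fin n → Fin n → 𝒜) (γ : Fin n) : 𝒜 :=
  F.trace fun α β => F.covMixed (.anti β) t α γ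

/-- The divergence `∇^β A_{αβ}` of the torsion. -/
def divA (α : Fin n) : 𝒜 := F.trace fun β γ => F.cov2 (.anti γ) F.A α β

theorem covMixed_h (d : Dir n) (α β : Fin n) : F.covMixed d F.h α β = 0 := by
  simp only [covMixed, e_h, mul_comm (F.h _ _)]
  ring

theorem covMixed_mul_h (d : Dir n) (a : 𝒜) (α β : Fin n) :
    F.covMixed d (fun α β => a * F.h α β) α β = F.h α β * F.e d a := by
  have parallel := F.covMixed_h d α β
  simp only [covMixed, Derivation.leibniz, smul_eq_mul, mul_left_comm _ a, ← Finset.mul_sum]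
    at parallel ⊢
  linear_combination a * parallel

theorem covMixed_sub (d : Dir n) (s t : Fin n → Fin n → 𝒜) (α β : Fin n) :
    F.covMixed d (fun α β => s α β - t α β) α β =
      F.covMixed d s α β - F.covMixed d t α β := by
  simp only [covMixed, map_sub, mul_sub, Finset.sum_sub_distrib]
  ring

theorem divMixed_sub (s t : Fin n → Fin n → 𝒜) (γ : Fin n) :
    F.divMixed (fun α β => s α β - t α β) γ = F.divMixed s γ - F.divMixed t γ := by
  simp only [divMixed, trace, covMixed_sub, mul_sub, Finset.sum_sub_distrib]

theorem divMixed_mul_h (a : 𝒜) (γ : Fin n) :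
    F.divMixed (fun α β => a * F.h α β) γ = F.e (.anti γ) a := by
  simp only [divMixed, trace, covMixed_mul_h]
  exact F.sum_hInv_mul_h_mul (fun β => F.e (.anti β) a) γ

theorem trace_covMixed (d : Dir n) (t : Fin n → Fin n → 𝒜) :
    F.trace (F.covMixed d t) = F.e d (F.trace t) := by
  simp only [trace, covMixed, map_sum, Derivation.leibniz, smul_eq_mul, e_hInv, mul_sub, mul_neg,
    Finset.sum_add_distrib, Finset.sum_sub_distrib, Finset.mul_sum, Finset.sum_neg_distrib]
  have hol_part : ∑ α, ∑ β, ∑ μ, t α β * (F.hInv μ β * F.omega μ α d) =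
      ∑ α, ∑ β, ∑ γ, F.hInv α β * (F.omega α γ d * t γ β) := by
    rw [Finset.sum_congr rfl fun _ _ => Finset.sum_comm, Finset.sum_comm,
      Finset.sum_congr rfl fun _ _ => Finset.sum_comm]
    exact Finset.sum_congr rfl fun _ _ => Finset.sum_congr rfl fun _ _ =>
      Finset.sum_congr rfl fun _ _ => by ring
  have anti_part : ∑ α, ∑ β, ∑ σ, t α β * (F.hInv α σ * star (F.omega σ β d.conj)) =
      ∑ α, ∑ β, ∑ γ, F.hInv α β * (star (F.omega β γ d.conj) * t α γ) := by
    rw [Finset.sum_congr rfl fun _ _ => Finset.sum_comm]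
    exact Finset.sum_congr rfl fun _ _ => Finset.sum_congr rfl fun _ _ =>
      Finset.sum_congr rfl fun _ _ => by ring
  linear_combination hol_part + anti_part

theorem star_A (α β : Fin n) :
    star (F.A α β) = -∑ γ, F.h γ α * star (F.C .zero (.hol β) (.anti γ)) := by
  simp only [A, star_neg, star_sum, star_mul', star_h]

theorem cov2_A (d : Dir n) (α β : Fin n) : F.cov2 d F.A α β =
    -∑ μ, F.h β μ * (F.e d (F.C .zero (.hol α) (.anti μ)) +
      ∑ κ, star (F.omega κ μ d.conj) * F.C .zero (.hol α) (.anti κ) -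
      ∑ δ, F.omega α δ d * F.C .zero (.hol δ) (.anti μ)) := by
  rw [cov2, F.A_symm α β]
  simp only [F.A_symm _ β, F.A_symm α]
  simp only [A, map_neg, map_sum, Derivation.leibniz, e_h, smul_eq_mul, mul_add, mul_sub,
    Finset.sum_add_distrib, Finset.sum_sub_distrib, Finset.mul_sum, mul_neg,
    Finset.sum_neg_distrib]
  have beta_part : ∑ μ, ∑ δ, F.C .zero (.hol α) (.anti μ) * (F.omega β δ d * F.h δ μ) =
      ∑ δ, ∑ μ, F.omega β δ d * (F.h δ μ * F.C .zero (.hol α) (.anti μ)) := by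
    rw [Finset.sum_comm]
    exact Finset.sum_congr rfl fun _ _ => Finset.sum_congr rfl fun _ _ => by ring
  have conj_part : ∑ μ, ∑ σ, F.C .zero (.hol α) (.anti μ) *
      (F.h β σ * star (F.omega μ σ d.conj)) =
      ∑ μ, ∑ κ, F.h β μ * (star (F.omega κ μ d.conj) * F.C .zero (.hol α) (.anti κ)) := by
    rw [Finset.sum_comm]
    exact Finset.sum_congr rfl fun _ _ => Finset.sum_congr rfl fun _ _ => by ring
  have alpha_part : ∑ δ, ∑ μ, F.omega α δ d * (F.h β μ * F.C .zero (.hol δ) (.anti μ)) =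
      ∑ μ, ∑ δ, F.h β μ * (F.omega α δ d * F.C .zero (.hol δ) (.anti μ)) := by
    rw [Finset.sum_comm]
    exact Finset.sum_congr rfl fun _ _ => Finset.sum_congr rfl fun _ _ => by ring
  linear_combination -beta_part - conj_part + alpha_part

theorem divA_eq (α : Fin n) : F.divA α =
    -∑ ν, (F.e (.anti ν) (F.C .zero (.hol α) (.anti ν)) +
      ∑ κ, star (F.omega κ ν (.hol ν)) * F.C .zero (.hol α) (.anti κ) -
      ∑ δ, F.omega α δ (.anti ν) * F.C .zero (.hol δ) (.anti ν)) := by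
  simp only [divA, cov2_A, trace, mul_neg, Finset.sum_neg_distrib]
  exact congrArg Neg.neg (F.trace_sum_h_mul fun ν μ => F.e (.anti ν) (F.C .zero (.hol α) (.anti μ))
    + ∑ κ, star (F.omega κ μ (.hol ν)) * F.C .zero (.hol α) (.anti κ) -
      ∑ δ, F.omega α δ (.anti ν) * F.C .zero (.hol δ) (.anti μ))

/-! ### The Ricci form -/

/-- The trace `ω_γ^γ` of the connection form. -/
def omegaTrace (d : Dir n) : 𝒜 := ∑ γ, F.omega γ γ d

/-- The Ricci form `dω_γ^γ`, the trace of the curvature form. -/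
def ricciForm : Dir n → Dir n → 𝒜 := F.extDeriv F.omegaTrace

/-- The Ricci tensor `R_{αβ̄}`. -/
def ricci (α β : Fin n) : 𝒜 := F.ricciForm (.hol α) (.anti β)

/-- The Webster scalar curvature. -/
def R : 𝒜 := F.trace F.ricci

theorem ricciForm_anti_hol (β α : Fin n) : F.ricciForm (.anti β) (.hol α) = -F.ricci α β :=
  F.extDeriv_antisymm F.omegaTrace _ _

theorem ricciForm_anti_anti (β γ : Fin n) : F.ricciForm (.anti β) (.anti γ) = 0 := by
  have jacobi (δ : Fin n) :
      F.e (.anti β) (F.omega δ δ (.anti γ)) +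
        (-(imagUnit 𝒜 * F.h δ γ * star (F.C .zero (.hol β) (.anti δ))) +
          ∑ μ, F.omega δ μ (.anti γ) * F.omega μ δ (.anti β)) +
      (-F.e (.anti γ) (F.omega δ δ (.anti β)) +
        (imagUnit 𝒜 * F.h δ β * star (F.C .zero (.hol γ) (.anti δ)) -
          ∑ μ, F.omega δ μ (.anti β) * F.omega μ δ (.anti γ))) -
      ∑ μ, F.C (.anti β) (.anti γ) (.anti μ) * F.omega δ δ (.anti μ) = 0 := by
    simpa [Dir.sum_eq, sub_eq_add_neg] using
      F.jacobi (.anti β) (.anti γ) (.hol δ) (.hol δ)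
  have sum_jacobi := Finset.sum_eq_zero fun δ (_ : δ ∈ Finset.univ) => jacobi δ
  have torsion := congrArg star (F.A_symm γ β)
  have omega_sq : ∑ δ, ∑ μ, F.omega δ μ (.anti γ) * F.omega μ δ (.anti β) =
      ∑ δ, ∑ μ, F.omega δ μ (.anti β) * F.omega μ δ (.anti γ) := by
    rw [Finset.sum_comm]
    simp only [mul_comm]
  have swap : ∑ δ, ∑ μ, F.C (.anti β) (.anti γ) (.anti μ) * F.omega δ δ (.anti μ) =
      ∑ μ, ∑ δ, F.C (.anti β) (.anti γ) (.anti μ) * F.omega δ δ (.anti μ) := Finset.sum_comm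
  simp only [star_A] at torsion
  simp only [Finset.sum_add_distrib, Finset.sum_sub_distrib, Finset.sum_neg_distrib, mul_assoc,
    ← Finset.mul_sum _ _ (imagUnit 𝒜)] at sum_jacobi
  simp only [ricciForm, MovingFrame.extDeriv, Dir.sum_eq, omegaTrace, map_sum, Finset.mul_sum,
    C_anti_anti_zero, C_anti_anti_hol, zero_mul, Finset.sum_const_zero, zero_add]
  linear_combination sum_jacobi - imagUnit 𝒜 * torsion - omega_sq + swap

theorem ricciForm_zero_anti (γ : Fin n) : F.ricciForm .zero (.anti γ) = star (F.divA γ) := by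
  have jacobi (δ : Fin n) :
      F.e .zero (F.omega δ δ (.anti γ)) + (∑ μ, F.omega δ μ (.anti γ) * F.omega μ δ .zero -
        ∑ μ, star (F.omega γ μ (.anti δ)) * star (F.C .zero (.hol μ) (.anti δ))) +
      (-F.e (.anti γ) (F.omega δ δ .zero) - ∑ μ, F.omega δ μ .zero * F.omega μ δ (.anti γ)) +
      (F.e (.hol δ) (star (F.C .zero (.hol γ) (.anti δ))) +
        (∑ μ, star (F.C .zero (.hol γ) (.anti μ)) *
            (F.omega μ δ (.hol δ) - F.omega δ δ (.hol μ)) -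
          ∑ μ, star (F.omega γ μ .zero) * F.omega δ δ (.anti μ))) = 0 := by
    simpa [Dir.sum_eq, sub_eq_add_neg, C_hol_hol_hol] using
      F.jacobi .zero (.anti γ) (.hol δ) (.hol δ)
  have sum_jacobi := Finset.sum_eq_zero fun δ (_ : δ ∈ Finset.univ) => jacobi δ
  have omega_sq : ∑ δ, ∑ μ, F.omega δ μ (.anti γ) * F.omega μ δ .zero =
      ∑ δ, ∑ μ, F.omega δ μ .zero * F.omega μ δ (.anti γ) := by
    rw [Finset.sum_comm]
    simp only [mul_comm]
  have swap_zero : ∑ δ, ∑ μ, star (F.omega γ μ .zero) * F.omega δ δ (.anti μ) =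
      ∑ μ, ∑ δ, star (F.omega γ μ .zero) * F.omega δ δ (.anti μ) := Finset.sum_comm
  have swap_hol : ∑ δ, ∑ μ, star (F.C .zero (.hol γ) (.anti μ)) * F.omega δ δ (.hol μ) =
      ∑ μ, ∑ δ, star (F.C .zero (.hol γ) (.anti μ)) * F.omega δ δ (.hol μ) := Finset.sum_comm
  simp only [Finset.sum_add_distrib, Finset.sum_sub_distrib, Finset.sum_neg_distrib, mul_sub]
    at sum_jacobi
  simp only [ricciForm, MovingFrame.extDeriv, Dir.sum_eq, omegaTrace, map_sum, Finset.mul_sum,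
    C_zero_anti_zero, C_zero_anti_hol, C_zero_anti_anti, zero_mul, Finset.sum_const_zero,
    zero_add, divA_eq, star_neg, star_sum, star_add, star_sub, star_mul', star_star, F.star_e,
    Dir.conj, Finset.sum_add_distrib, Finset.sum_sub_distrib,
    mul_comm (F.omega _ _ (.hol _)) (star (F.C _ _ _))]
  linear_combination sum_jacobi - omega_sq + swap_zero + swap_hol

theorem omegaTrace_add_star (d : Dir n) : F.omegaTrace d + star (F.omegaTrace d.conj) =
    F.trace fun α β => F.e d (F.h α β) := by
  have hol_part := F.trace_sum_mul_h fun α γ => F.omega α γ d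
  have anti_part := F.trace_sum_h_mul fun δ σ => star (F.omega δ σ d.conj)
  simp only [trace] at hol_part anti_part
  simp only [e_h, trace, mul_add, Finset.sum_add_distrib, hol_part, anti_part, omegaTrace,
    star_sum]

theorem sum_e_h_mul_e_hInv_comm (i j : Dir n) :
    ∑ α, ∑ β, F.e j (F.h α β) * F.e i (F.hInv α β) =
      ∑ α, ∑ β, F.e i (F.h α β) * F.e j (F.hInv α β) := by
  simp only [derivation_hInv, mul_neg, Finset.sum_neg_distrib, Finset.mul_sum]
  congr 1
  simp only [← Fintype.sum_prod_type']
  refine Fintype.sum_equiv ⟨fun p => ⟨p.2.2.1, p.2.2.2, p.1, p.2.1⟩,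
    fun p => ⟨p.2.2.1, p.2.2.2, p.1, p.2.1⟩, fun _ => rfl, fun _ => rfl⟩ _ _ fun p => ?_
  simp only [Equiv.coe_fn_mk]
  ring

-- `h^{αβ̄} dh_{αβ̄}` is closed because it is `d log det h`.
theorem extDeriv_trace_e_h (i j : Dir n) :
    F.extDeriv (fun d => F.trace fun α β => F.e d (F.h α β)) i j = 0 := by
  have bracket : ∑ α, ∑ β, F.hInv α β * (F.e i (F.e j (F.h α β)) - F.e j (F.e i (F.h α β))) =
      ∑ k, F.C i j k * ∑ α, ∑ β, F.hInv α β * F.e k (F.h α β) := by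
    simp only [F.lie, Finset.mul_sum]
    rw [Finset.sum_congr rfl fun α _ => Finset.sum_comm, Finset.sum_comm]
    exact Finset.sum_congr rfl fun _ _ => Finset.sum_congr rfl fun _ _ =>
      Finset.sum_congr rfl fun _ _ => mul_left_comm _ _ _
  simp only [MovingFrame.extDeriv, trace, map_sum, Derivation.leibniz, smul_eq_mul,
    Finset.sum_add_distrib, ← bracket, mul_sub, Finset.sum_sub_distrib]
  linear_combination F.sum_e_h_mul_e_hInv_comm i j

theorem ricciForm_add_star (i j : Dir n) :
    F.ricciForm i j + star (F.ricciForm i.conj j.conj) = 0 := by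
  simp only [ricciForm, star_extDeriv, Dir.conj_conj, ← MovingFrame.extDeriv_add,
    omegaTrace_add_star, extDeriv_trace_e_h]

theorem star_ricci (α β : Fin n) : star (F.ricci α β) = F.ricci β α := by
  have skew_hermitian := F.ricciForm_add_star (.anti α) (.hol β)
  rw [ricciForm_anti_hol] at skew_hermitian
  simp only [Dir.conj] at skew_hermitian
  rw [ricci]
  linear_combination skew_hermitian

theorem star_R : star F.R = F.R := by
  simp only [R, trace, star_sum, star_mul', star_ricci, star_hInv]
  exact Finset.sum_comm

theorem C_anti_anti_anti (α β γ : Fin n) : F.C (.anti α) (.anti β) (.anti γ) =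
    star (F.omega β γ (.hol α)) - star (F.omega α γ (.hol β)) := by
  rw [← star_sub, ← C_hol_hol_hol, star_C]
  rfl

theorem covMixed_ricci (β γ δ : Fin n) : F.covMixed (.anti β) F.ricci δ γ =
    F.covMixed (.anti γ) F.ricci δ β + imagUnit 𝒜 * F.h δ β * star (F.divA γ) -
      imagUnit 𝒜 * F.h δ γ * star (F.divA β) := by
  have ricciForm_hol_anti (α β : Fin n) : F.ricciForm (.hol α) (.anti β) = F.ricci α β := rfl
  have closed : ∑ μ, F.omega δ μ (.anti β) * F.ricci μ γ +
        imagUnit 𝒜 * F.h δ β * star (F.divA γ) +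
      (-F.e (.anti β) (F.ricci δ γ) + ∑ μ, (star (F.omega γ μ (.hol β)) -
        star (F.omega β μ (.hol γ))) * F.ricci δ μ) +
      (F.e (.anti γ) (F.ricci δ β) + (-∑ μ, F.omega δ μ (.anti γ) * F.ricci μ β -
        imagUnit 𝒜 * F.h δ γ * star (F.divA β))) = 0 := by
    simpa [← show F.ricciForm = F.extDeriv F.omegaTrace from rfl, Dir.sum_eq, C_anti_anti_anti,
      ricciForm_anti_hol, ricciForm_hol_anti, ricciForm_anti_anti, ricciForm_zero_anti,
      sub_eq_add_neg] using F.extDeriv_extDeriv F.omegaTrace (.hol δ) (.anti β) (.anti γ)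
  simp only [sub_mul, Finset.sum_sub_distrib] at closed
  simp only [covMixed, Dir.conj]
  linear_combination -closed

theorem divMixed_ricci (γ : Fin n) :
    F.divMixed F.ricci γ = F.e (.anti γ) F.R + imagUnit 𝒜 * (n - 1) * star (F.divA γ) := by
  have trace_part : ∑ δ, ∑ β, F.hInv δ β * (imagUnit 𝒜 * F.h δ β * star (F.divA γ)) =
      imagUnit 𝒜 * n * star (F.divA γ) := by
    simp only [← F.trace_h, trace, Finset.mul_sum, Finset.sum_mul]
    exact Finset.sum_congr rfl fun _ _ => Finset.sum_congr rfl fun _ _ => by ring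
  have divergence_part : ∑ δ, ∑ β, F.hInv δ β * (imagUnit 𝒜 * F.h δ γ * star (F.divA β)) =
      imagUnit 𝒜 * star (F.divA γ) := by
    simpa only [mul_left_comm, mul_assoc] using
      F.sum_hInv_mul_h_mul (fun β => imagUnit 𝒜 * star (F.divA β)) γ
  have trace_cov := F.trace_covMixed (.anti γ) F.ricci
  rw [trace, ← R] at trace_cov
  simp only [divMixed, trace, F.covMixed_ricci _ γ, mul_sub, mul_add, Finset.sum_add_distrib,
    Finset.sum_sub_distrib, trace_cov, trace_part, divergence_part]
  ring

/-! ### The sublaplacian and the torsion operator -/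

/-- The gradient `∇^α u`. -/
def gradUp (u : 𝒜) (α : Fin n) : 𝒜 := ∑ β, F.hInv α β * F.e (.anti β) u

/-- The gradient `∇^ᾱ u`. -/
def gradBarUp (u : 𝒜) (α : Fin n) : 𝒜 := ∑ β, F.hInv β α * F.e (.hol β) u

/-- The divergence `∇^α σ_α` of a form of type `(1,0)`. -/
def div (σ : Fin n → 𝒜) : 𝒜 := F.trace fun α β => F.cov (.anti β) σ α

/-- The divergence `∇^ᾱ σ_ᾱ` of a form of type `(0,1)`. -/
def divBar (σ : Fin n → 𝒜) : 𝒜 := F.trace fun α β => F.covBar (.hol α) σ β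

theorem div_smul (c : ℂ) (σ : Fin n → 𝒜) : F.div (fun α => c • σ α) = c • F.div σ := by
  simp only [div, trace, cov, Derivation.map_smul, mul_smul_comm, ← Finset.smul_sum, ← smul_sub]

/-- The sublaplacian `Δ_b u = -(∇^α ∇_α u + ∇_α ∇^α u)`. -/
def sublaplacian (u : 𝒜) : 𝒜 :=
  -(F.div (fun α => F.e (.hol α) u) + F.divBar (fun α => F.e (.anti α) u))

/-- The torsion operator `∇^α (A_{αβ} ∇^β u)`. -/
def torsionDiv (u : 𝒜) : 𝒜 := F.div fun α => ∑ β, F.A α β * F.gradUp u β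

theorem star_gradUp (u : 𝒜) (α : Fin n) : star (F.gradUp u α) = F.gradBarUp (star u) α := by
  simp only [gradUp, gradBarUp, star_sum, star_mul', star_hInv, F.star_e, Dir.conj]

theorem star_div (σ : Fin n → 𝒜) : star (F.div σ) = F.divBar fun α => star (σ α) := by
  simp only [div, divBar, trace, star_sum, star_mul', star_hInv, cov, covBar, star_sub, F.star_e,
    Dir.conj]
  exact Finset.sum_comm

theorem star_sublaplacian (u : 𝒜) : star (F.sublaplacian u) = F.sublaplacian (star u) := by
  have star_div_grad (u : 𝒜) : star (F.div fun α => F.e (.hol α) u) =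
      F.divBar fun α => F.e (.anti α) (star u) := by
    simp only [star_div, F.star_e, Dir.conj]
  rw [sublaplacian, sublaplacian, star_neg, star_add, star_div_grad, add_comm,
    ← star_star u, ← star_div_grad (star u), star_star, star_star]

theorem star_torsionDiv (u : 𝒜) : star (F.torsionDiv u) =
    F.divBar fun α => ∑ β, star (F.A α β) * F.gradBarUp (star u) β := by
  simp only [torsionDiv, star_div, star_sum, star_mul', star_gradUp]

theorem cov_anti_e_hol (α β : Fin n) (u : 𝒜) :
    F.cov (.anti β) (fun α => F.e (.hol α) u) α =
      F.covBar (.hol α) (fun β => F.e (.anti β) u) β + imagUnit 𝒜 * F.h α β * F.e .zero u := by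
  have commutator : F.e (.hol α) (F.e (.anti β) u) - F.e (.anti β) (F.e (.hol α) u) =
      -(imagUnit 𝒜 * F.h α β * F.e .zero u) +
        -∑ γ, F.omega α γ (.anti β) * F.e (.hol γ) u +
        ∑ γ, star (F.omega β γ (.anti α)) * F.e (.anti γ) u := by
    simpa [Dir.sum_eq] using F.lie (.hol α) (.anti β) u
  simp only [cov, covBar, Dir.conj]
  linear_combination -commutator

theorem div_grad (u : 𝒜) : F.div (fun α => F.e (.hol α) u) =
    F.divBar (fun α => F.e (.anti α) u) + imagUnit 𝒜 * n * F.e .zero u := by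
  have levi_part : F.trace (fun α β => imagUnit 𝒜 * F.h α β * F.e .zero u) =
      imagUnit 𝒜 * n * F.e .zero u := by
    simp only [← F.trace_h, trace, Finset.mul_sum, Finset.sum_mul, mul_left_comm (F.hInv _ _),
      mul_assoc]
  rw [← levi_part]
  simp only [div, divBar, trace, cov_anti_e_hol, mul_add, Finset.sum_add_distrib]

theorem sublaplacian_eq (u : 𝒜) : F.sublaplacian u =
    -(2 * F.divBar (fun α => F.e (.anti α) u) + imagUnit 𝒜 * n * F.e .zero u) := by
  rw [sublaplacian, div_grad]
  ring

theorem sublaplacian_add (u v : 𝒜) :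
    F.sublaplacian (u + v) = F.sublaplacian u + F.sublaplacian v := by
  simp only [sublaplacian, div, divBar, trace, cov, covBar, map_add, mul_add, mul_sub,
    Finset.sum_add_distrib, Finset.sum_sub_distrib]
  ring

theorem sublaplacian_smul (c : ℂ) (u : 𝒜) : F.sublaplacian (c • u) = c • F.sublaplacian u := by
  simp only [sublaplacian, div, divBar, trace, cov, covBar, Derivation.map_smul, mul_smul_comm,
    ← Finset.smul_sum, ← smul_sub, ← smul_add, smul_neg]

theorem torsionDiv_add (u v : 𝒜) : F.torsionDiv (u + v) = F.torsionDiv u + F.torsionDiv v := by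
  simp only [torsionDiv, gradUp, div, trace, cov, map_add, mul_add, mul_sub,
    Finset.sum_add_distrib, Finset.sum_sub_distrib]
  ring

/-! ### CR functions and pluriharmonic functions -/

section CRFunction

variable {v : 𝒜} (hv : ∀ α, F.e (.anti α) v = 0)
include hv

theorem sublaplacian_of_cr : F.sublaplacian v = -(imagUnit 𝒜 * n * F.e .zero v) := by
  simp [sublaplacian_eq, hv, divBar, covBar, trace]

theorem torsionDiv_of_cr : F.torsionDiv v = 0 := by
  simp [torsionDiv, hv, gradUp, div, trace, cov]

theorem sum_star_A_mul_gradBarUp_of_cr (β : Fin n) :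
    ∑ γ, star (F.A β γ) * F.gradBarUp v γ = F.e (.anti β) (F.e .zero v) := by
  have commutator : -F.e (.anti β) (F.e .zero v) =
      ∑ γ, star (F.C .zero (.hol β) (.anti γ)) * F.e (.hol γ) v := by
    simpa [Dir.sum_eq, hv] using F.lie .zero (.anti β) v
  have lower_index (κ : Fin n) : ∑ γ, F.h κ γ * F.gradBarUp v γ = F.e (.hol κ) v := by
    simp only [gradBarUp, Finset.mul_sum]
    rw [Finset.sum_comm]
    simp only [mul_left_comm (F.h _ _), mul_comm (F.h _ _)]
    simp only [← mul_assoc, mul_right_comm _ (F.e _ v), ← Finset.sum_mul, sum_hInv_mul_h,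
      ite_mul, one_mul, zero_mul, Finset.sum_ite_eq', Finset.mem_univ, if_true]
  simp only [F.A_symm β, star_A, neg_mul, Finset.sum_neg_distrib, Finset.sum_mul]
  rw [Finset.sum_comm]
  simp only [mul_comm (F.h _ _) (star _), mul_assoc, ← Finset.mul_sum, lower_index, ← commutator,
    neg_neg]

theorem sublaplacian_e_zero_of_cr : F.sublaplacian (F.e .zero v) =
    -(2 * star (F.torsionDiv (star v)) + imagUnit 𝒜 * n * F.e .zero (F.e .zero v)) := by
  simp only [sublaplacian_eq, star_torsionDiv, star_star, F.sum_star_A_mul_gradBarUp_of_cr hv]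

theorem sublaplacian_sublaplacian_of_cr : F.sublaplacian (F.sublaplacian v) =
    2 * imagUnit 𝒜 * n * star (F.torsionDiv (star v)) -
      (n : 𝒜) ^ 2 * F.e .zero (F.e .zero v) := by
  have sublaplacian_v : F.sublaplacian v = (-(Complex.I * n)) • F.e .zero v := by
    rw [F.sublaplacian_of_cr hv, Algebra.smul_def, map_neg, map_mul, map_natCast, ← imagUnit,
      neg_mul]
  rw [sublaplacian_v, sublaplacian_smul, F.sublaplacian_e_zero_of_cr hv, Algebra.smul_def,
    map_neg, map_mul, map_natCast, ← imagUnit]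
  linear_combination (n : 𝒜) ^ 2 * F.e .zero (F.e .zero v) * imagUnit_mul_self 𝒜

theorem sublaplacian_sublaplacian_of_pluriharmonic :
    F.sublaplacian (F.sublaplacian (v + star v)) +
        (n : 𝒜) ^ 2 * F.e .zero (F.e .zero (v + star v)) =
      2 * imagUnit 𝒜 * n * (star (F.torsionDiv (v + star v)) - F.torsionDiv (v + star v)) := by
  have cr_part := F.sublaplacian_sublaplacian_of_cr hv
  have conj_part := congrArg star cr_part
  simp only [star_sublaplacian, star_sub, star_mul', star_star, star_imagUnit, star_pow, F.star_e,
    star_natCast, star_ofNat, Dir.conj] at conj_part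
  simp only [sublaplacian_add, map_add, torsionDiv_add, F.torsionDiv_of_cr hv, zero_add, cr_part,
    conj_part]
  ring

theorem e_anti_gradBarUp_of_cr (β γ : Fin n) : F.e (.anti β) (F.gradBarUp v γ) =
    (if γ = β then imagUnit 𝒜 * F.e .zero v else 0) -
      ∑ ν, star (F.omega ν γ (.hol β)) * F.gradBarUp v ν := by
  have hessian (μ : Fin n) : F.e (.anti β) (F.e (.hol μ) v) =
      ∑ γ, F.omega μ γ (.anti β) * F.e (.hol γ) v + imagUnit 𝒜 * F.h μ β * F.e .zero v := by
    have := F.cov_anti_e_hol μ β v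
    simp only [cov, covBar, hv, map_zero, mul_zero, Finset.sum_const_zero, sub_zero] at this
    linear_combination this
  have levi_part : ∑ μ, F.hInv μ γ * (imagUnit 𝒜 * F.h μ β * F.e .zero v) =
      if γ = β then imagUnit 𝒜 * F.e .zero v else 0 := by
    simp only [mul_assoc, mul_left_comm _ (imagUnit 𝒜), ← Finset.mul_sum]
    simp only [← mul_assoc, ← Finset.sum_mul, sum_hInv_mul_h_left, mul_ite, mul_one, mul_zero,
      ite_mul, zero_mul]
  rw [← levi_part]
  simp only [gradBarUp, map_sum, Derivation.leibniz, smul_eq_mul, e_hInv, hessian, mul_add,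
    mul_sub, mul_neg, Finset.sum_add_distrib, Finset.sum_sub_distrib, Finset.sum_neg_distrib,
    Finset.mul_sum, Dir.conj]
  have hol_part : ∑ μ, ∑ κ, F.hInv μ γ * (F.omega μ κ (.anti β) * F.e (.hol κ) v) =
      ∑ κ, ∑ μ, F.e (.hol κ) v * (F.hInv μ γ * F.omega μ κ (.anti β)) := by
    rw [Finset.sum_comm]
    exact Finset.sum_congr rfl fun _ _ => Finset.sum_congr rfl fun _ _ => by ring
  have anti_part :
      ∑ ν, ∑ μ, star (F.omega ν γ (.hol β)) * (F.hInv μ ν * F.e (.hol μ) v) =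
        ∑ μ, ∑ ν, F.e (.hol μ) v * (F.hInv μ ν * star (F.omega ν γ (.hol β))) := by
    rw [Finset.sum_comm]
    exact Finset.sum_congr rfl fun _ _ => Finset.sum_congr rfl fun _ _ => by ring
  linear_combination hol_part + anti_part

theorem cov_anti_sum_mul_gradBarUp_of_cr (t : Fin n → Fin n → 𝒜) (δ β : Fin n) :
    F.cov (.anti β) (fun δ => ∑ γ, t δ γ * F.gradBarUp v γ) δ =
      ∑ γ, F.covMixed (.anti β) t δ γ * F.gradBarUp v γ +
        t δ β * (imagUnit 𝒜 * F.e .zero v) := by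
  have anti_part : ∑ γ, ∑ ν, t δ γ * (star (F.omega ν γ (.hol β)) * F.gradBarUp v ν) =
      ∑ γ, ∑ ν, star (F.omega γ ν (.hol β)) * t δ ν * F.gradBarUp v γ := by
    rw [Finset.sum_comm]
    exact Finset.sum_congr rfl fun _ _ => Finset.sum_congr rfl fun _ _ => by ring
  have hol_part : ∑ ν, ∑ γ, F.omega δ ν (.anti β) * (t ν γ * F.gradBarUp v γ) =
      ∑ γ, ∑ ν, F.omega δ ν (.anti β) * t ν γ * F.gradBarUp v γ := by
    rw [Finset.sum_comm]
    exact Finset.sum_congr rfl fun _ _ => Finset.sum_congr rfl fun _ _ => by ring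
  simp only [cov, covMixed, map_sum, Derivation.leibniz, smul_eq_mul,
    F.e_anti_gradBarUp_of_cr hv, mul_sub, mul_ite, mul_zero, sub_mul, Finset.sum_add_distrib,
    Finset.sum_sub_distrib, Finset.sum_ite_eq', Finset.mem_univ, if_true, Finset.mul_sum,
    Finset.sum_mul, anti_part, hol_part, mul_comm (F.gradBarUp v _), Dir.conj]
  ring

theorem div_tracefree_mul_gradBarUp_of_cr (t : Fin n → Fin n → 𝒜) (ht : F.trace t = 0) :
    F.div (fun δ => ∑ γ, t δ γ * F.gradBarUp v γ) =
      ∑ γ, F.divMixed t γ * F.gradBarUp v γ := by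
  have trace_part : ∑ δ, ∑ β, F.hInv δ β * (t δ β * (imagUnit 𝒜 * F.e .zero v)) = 0 := by
    rw [trace] at ht
    simp only [← mul_assoc, ← Finset.sum_mul, ht, zero_mul]
  simp only [div, divMixed, trace, F.cov_anti_sum_mul_gradBarUp_of_cr hv, mul_add,
    Finset.sum_add_distrib, trace_part, add_zero, Finset.mul_sum, Finset.sum_mul]
  rw [Finset.sum_congr rfl fun _ _ => Finset.sum_comm, Finset.sum_comm]
  exact Finset.sum_congr rfl fun _ _ => Finset.sum_congr rfl fun _ _ =>
    Finset.sum_congr rfl fun _ _ => (mul_assoc _ _ _).symm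

end CRFunction

/-- The tracefree part of the Ricci tensor. -/
def ricci0 (α β : Fin n) : 𝒜 := F.ricci α β - algebraMap ℂ 𝒜 (n : ℂ)⁻¹ * F.R * F.h α β

theorem trace_ricci0 (hn : n ≠ 0) : F.trace F.ricci0 = 0 := by
  have trace_levi := F.trace_h
  rw [trace] at trace_levi
  simp only [trace, ricci0, mul_sub, Finset.sum_sub_distrib, mul_left_comm (F.hInv _ _),
    ← Finset.mul_sum, trace_levi]
  rw [← trace, ← R]
  linear_combination -F.R * algebraMap_inv_natCast_mul (𝒜 := 𝒜) hn

theorem natCast_mul_divMixed_ricci0 (hn : n ≠ 0) (γ : Fin n) : (n : 𝒜) * F.divMixed F.ricci0 γ =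
    (n - 1) * (F.e (.anti γ) F.R + imagUnit 𝒜 * n * star (F.divA γ)) := by
  have divMixed_ricci0 : F.divMixed F.ricci0 γ = F.divMixed F.ricci γ -
      algebraMap ℂ 𝒜 (n : ℂ)⁻¹ * F.e (.anti γ) F.R := by
    rw [← Algebra.smul_def, ← Derivation.map_smul, Algebra.smul_def, ← F.divMixed_mul_h,
      ← divMixed_sub]
    rfl
  rw [divMixed_ricci0, divMixed_ricci]
  linear_combination -F.e (.anti γ) F.R * algebraMap_inv_natCast_mul (𝒜 := 𝒜) hn

theorem natCast_mul_div_ricci0_gradBarUp_of_pluriharmonic (hn : n ≠ 0) {v : 𝒜}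
    (hv : ∀ α, F.e (.anti α) v = 0) :
    (n : 𝒜) * F.div (fun δ => ∑ γ, F.ricci0 δ γ * F.gradBarUp (v + star v) γ) =
      (n - 1) * star (∑ γ, (F.e (.hol γ) F.R - imagUnit 𝒜 * n * F.divA γ) *
        F.gradUp (v + star v) γ) := by
  have gradBarUp_eq : F.gradBarUp (v + star v) = F.gradBarUp v := by
    have e_hol_star (α : Fin n) : F.e (.hol α) (star v) = 0 := by
      simpa [Dir.conj, hv] using (F.star_e (.anti α) v).symm
    funext γ
    simp only [gradBarUp, map_add, e_hol_star, add_zero]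
  have star_gradUp_eq (γ : Fin n) : star (F.gradUp (v + star v) γ) = F.gradBarUp v γ := by
    rw [star_gradUp, star_add, star_star, add_comm, gradBarUp_eq]
  simp only [gradBarUp_eq, F.div_tracefree_mul_gradBarUp_of_cr hv _ (F.trace_ricci0 hn),
    Finset.mul_sum, ← mul_assoc, F.natCast_mul_divMixed_ricci0 hn, star_sum, star_mul',
    star_gradUp_eq, star_sub, F.star_e, star_R, star_imagUnit, star_natCast, Dir.conj]
  exact Finset.sum_congr rfl fun γ _ => by ring

end CRFrame

/-! ### Calculus of complex vector fields on a manifold -/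


section Pullback

variable {E H M E' H' M' F : Type*} [NormedAddCommGroup E] [NormedSpace ℝ E] [TopologicalSpace H]
  {I : ModelWithCorners ℝ E H} [TopologicalSpace M] [ChartedSpace H M]
  [NormedAddCommGroup E'] [NormedSpace ℝ E'] [TopologicalSpace H']
  {I' : ModelWithCorners ℝ E' H'} [TopologicalSpace M'] [ChartedSpace H' M']
  [NormedAddCommGroup F] [NormedSpace ℝ F]

theorem mfderiv_comp_apply_mpullback {f : M' → M} {u : M → F} {q : M'}
    (hf : (mfderiv I' I f q).IsInvertible) (hu : MDifferentiableAt I 𝓘(ℝ, F) u (f q))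
    (X : ∀ x : M, TangentSpace I x) :
    mfderiv I' 𝓘(ℝ, F) (u ∘ f) q (VectorField.mpullback I' I f X q) =
      mfderiv I 𝓘(ℝ, F) u (f q) (X (f q)) := by
  rw [mfderiv_comp q hu (mdifferentiableAt_of_isInvertible_mfderiv hf)]
  exact congrArg (mfderiv I 𝓘(ℝ, F) u (f q)) (hf.self_apply_inverse (X (f q)))

variable [I.Boundaryless] [IsManifold I 1 M]

theorem isInvertible_mfderiv_extChartAt_symm {x : M} {q : E} (hq : q ∈ (extChartAt I x).target) :
    (mfderiv 𝓘(ℝ, E) I (extChartAt I x).symm q).IsInvertible := by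
  rw [← mfderivWithin_univ, ← I.range_eq_univ]
  exact isInvertible_mfderivWithin_extChartAt_symm hq

end Pullback

variable {n : ℕ} {M : Type*} [TopologicalSpace M]
  [ChartedSpace (EuclideanSpace ℝ (Fin (2 * n + 1))) M]

/-- Smoothness of a complex-valued function on a set. -/
abbrev SmoothFnOn (n : ℕ) {M : Type*} [TopologicalSpace M]
    [ChartedSpace (EuclideanSpace ℝ (Fin (2 * n + 1))) M] (u : M → ℂ) (V : Set M) : Prop :=
  ContMDiffOn (𝓡 (2 * n + 1)) 𝓘(ℝ, ℂ) ∞ u V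

section Differential

variable {u w : M → ℂ} {x : M}

theorem differential_congr (h : u =ᶠ[𝓝 x] w) :
    (differential u x : TangentSpace (𝓡 (2 * n + 1)) x →L[ℝ] ℂ) = differential w x :=
  h.mfderiv_eq

theorem differential_const (c : ℂ) :
    (differential (fun _ => c) x : TangentSpace (𝓡 (2 * n + 1)) x →L[ℝ] ℂ) = 0 :=
  mfderiv_const

theorem ComplexField.deriv_congr (W : ComplexField n M) (h : u =ᶠ[𝓝 x] w) :
    W.deriv u x = W.deriv w x := by
  simp only [ComplexField.deriv, differential_congr h]

theorem ComplexField.deriv_congr_on (W : ComplexField n M) {V : Set M} (hV : IsOpen V)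
    (h : ∀ y ∈ V, u y = w y) (hx : x ∈ V) : W.deriv u x = W.deriv w x :=
  W.deriv_congr (Filter.eventuallyEq_of_mem (hV.mem_nhds hx) h)

theorem ComplexField.deriv_const (W : ComplexField n M) (c : ℂ) (x : M) :
    W.deriv (fun _ => c) x = 0 := by
  simp [ComplexField.deriv, differential_const]

variable (hu : MDifferentiableAt (𝓡 (2 * n + 1)) 𝓘(ℝ, ℂ) u x)
  (hw : MDifferentiableAt (𝓡 (2 * n + 1)) 𝓘(ℝ, ℂ) w x)

include hu

theorem differential_clm_comp (L : ℂ →L[ℝ] ℂ) :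
    (differential (fun y => L (u y)) x : TangentSpace (𝓡 (2 * n + 1)) x →L[ℝ] ℂ) =
      L ∘L differential u x :=
  (L.hasFDerivAt.hasMFDerivAt.comp x hu.hasMFDerivAt).mfderiv

theorem ComplexField.deriv_star (W : ComplexField n M) :
    starRingEnd ℂ (W.deriv u x) = W.conj.deriv (fun y => starRingEnd ℂ (u y)) x := by
  have differential_star (X : TangentSpace (𝓡 (2 * n + 1)) x) :
      differential (fun y => starRingEnd ℂ (u y)) x X = starRingEnd ℂ (differential u x X) :=
    congrArg (· X) (differential_clm_comp hu (Complex.conjCLE : ℂ →L[ℝ] ℂ))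
  simp only [ComplexField.deriv, ComplexField.conj, differential_star, map_neg, map_add, map_mul,
    Complex.conj_I]
  ring

include hw

theorem differential_add :
    (differential (fun y => u y + w y) x : TangentSpace (𝓡 (2 * n + 1)) x →L[ℝ] ℂ) =
      differential u x + differential w x :=
  (hu.hasMFDerivAt.add hw.hasMFDerivAt).mfderiv

theorem differential_mul :
    (differential (fun y => u y * w y) x : TangentSpace (𝓡 (2 * n + 1)) x →L[ℝ] ℂ) =
      u x • differential w x + w x • differential u x :=
  (hu.hasMFDerivAt.mul hw.hasMFDerivAt).mfderiv

theorem ComplexField.deriv_add (W : ComplexField n M) :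
    W.deriv (fun y => u y + w y) x = W.deriv u x + W.deriv w x := by
  simp only [ComplexField.deriv, differential_add hu hw, add_apply]
  ring

theorem ComplexField.deriv_mul (W : ComplexField n M) :
    W.deriv (fun y => u y * w y) x = u x * W.deriv w x + w x * W.deriv u x := by
  simp only [ComplexField.deriv, differential_mul hu hw, add_apply, smul_apply, smul_eq_mul]
  ring

end Differential

section Smooth

variable {u w : M → ℂ} {V : Set M}

theorem SmoothFnOn.mdifferentiableAt (hu : SmoothFnOn n u V) (hV : IsOpen V) {x : M}
    (hx : x ∈ V) : MDifferentiableAt (𝓡 (2 * n + 1)) 𝓘(ℝ, ℂ) u x :=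
  (hu.contMDiffAt (hV.mem_nhds hx)).mdifferentiableAt (by simp)

theorem SmoothFnOn.mul (hu : SmoothFnOn n u V) (hw : SmoothFnOn n w V) :
    SmoothFnOn n (fun y => u y * w y) V :=
  (contDiff_mul (𝕜 := ℝ) (𝔸 := ℂ) (n := ∞)).contMDiff.comp_contMDiffOn (hu.prodMk_space hw)

theorem SmoothFnOn.add (hu : SmoothFnOn n u V) (hw : SmoothFnOn n w V) :
    SmoothFnOn n (fun y => u y + w y) V :=
  ContMDiffOn.add hu hw

theorem SmoothFnOn.const (c : ℂ) (V : Set M) : SmoothFnOn n (fun _ : M => c) V :=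
  contMDiffOn_const

theorem SmoothFnOn.star (hu : SmoothFnOn n u V) : SmoothFnOn n (fun y => starRingEnd ℂ (u y)) V :=
  (Complex.conjCLE : ℂ →L[ℝ] ℂ).contMDiff.comp_contMDiffOn hu

variable [IsManifold (𝓡 (2 * n + 1)) ∞ M]

theorem isManifold_of_natCast (k : ℕ) : IsManifold (𝓡 (2 * n + 1)) k M :=
  IsManifold.of_le (n := ∞) (by exact_mod_cast le_top)

theorem SmoothFnOn.differential (hu : SmoothFnOn n u V) (hV : IsOpen V) {X : RealField n M}
    (hX : X.SmoothOn V) : SmoothFnOn n (fun y => differential u y (X y)) V := by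
  have tangentMap_comp_field := (hu.contMDiffOn_tangentMapWithin (m := ∞) (by simp)
    hV.uniqueMDiffOn).comp hX fun y hy => hy
  refine ((contMDiff_snd_tangentBundle_modelSpace ℂ 𝓘(ℝ, ℂ)).comp_contMDiffOn
    tangentMap_comp_field).congr fun y hy => ?_
  exact congrArg (fun L : TangentSpace (𝓡 (2 * n + 1)) y →L[ℝ] ℂ => L (X y))
    (mfderivWithin_of_isOpen hV hy).symm

theorem SmoothFnOn.deriv (hu : SmoothFnOn n u V) (hV : IsOpen V) {W : ComplexField n M}
    (hW : W.SmoothOn V) : SmoothFnOn n (W.deriv u) V :=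
  (hu.differential hV hW.1).add ((SmoothFnOn.const _ _).mul (hu.differential hV hW.2))

theorem ComplexForm.SmoothOn.apply {η : ComplexForm n M} (hη : η.SmoothOn V)
    {X : RealField n M} (hX : X.SmoothOn V) : SmoothFnOn n (fun y => η y (X y)) V := by
  have smooth_section := ContMDiffOn.clm_bundle_apply (F₁ := EuclideanSpace ℝ (Fin (2 * n + 1)))
    (F₂ := ℂ) (E₁ := fun x : M => TangentSpace (𝓡 (2 * n + 1)) x) (E₂ := Bundle.Trivial M ℂ) hη hX
  intro x hx
  simpa using (Bundle.contMDiffWithinAt_totalSpace.1 (smooth_section x hx)).2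

theorem ComplexForm.SmoothOn.app {η : ComplexForm n M} (hη : η.SmoothOn V)
    {W : ComplexField n M} (hW : W.SmoothOn V) : SmoothFnOn n (η.app W) V :=
  (hη.apply hW.1).add ((SmoothFnOn.const _ _).mul (hη.apply hW.2))

theorem RealField.SmoothOn.mlieBracket {X Y : RealField n M} (hV : IsOpen V)
    (hX : X.SmoothOn V) (hY : Y.SmoothOn V) :
    RealField.SmoothOn (VectorField.mlieBracket (𝓡 (2 * n + 1)) X Y) V := by
  intro x hx
  have := isManifold_of_natCast (n := n) (M := M) 2
  have : IsManifold (𝓡 (2 * n + 1)) (minSmoothness ℝ 2) M := by simpa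
  have : IsManifold (𝓡 (2 * n + 1)) ((⊤ : ℕ∞) + 1) M := by simpa
  exact (ContMDiffAt.mlieBracket_vectorField (m := ⊤) (n := ⊤) (hX.contMDiffAt (hV.mem_nhds hx))
    (hY.contMDiffAt (hV.mem_nhds hx)) (by simp)).contMDiffWithinAt

/-- The vector field `X` read in the extended chart centred at `x`. -/
def chartField (x : M) (X : RealField n M) :
    EuclideanSpace ℝ (Fin (2 * n + 1)) → EuclideanSpace ℝ (Fin (2 * n + 1)) :=
  VectorField.mpullback 𝓘(ℝ, EuclideanSpace ℝ (Fin (2 * n + 1))) (𝓡 (2 * n + 1))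
    (extChartAt (𝓡 (2 * n + 1)) x).symm X

theorem fderiv_apply_chartField {x : M} {q : EuclideanSpace ℝ (Fin (2 * n + 1))}
    (hq : q ∈ (extChartAt (𝓡 (2 * n + 1)) x).target)
    (hu : MDifferentiableAt (𝓡 (2 * n + 1)) 𝓘(ℝ, ℂ) u ((extChartAt (𝓡 (2 * n + 1)) x).symm q))
    (X : RealField n M) :
    fderiv ℝ (u ∘ (extChartAt (𝓡 (2 * n + 1)) x).symm) q (chartField x X q) =
      differential u ((extChartAt (𝓡 (2 * n + 1)) x).symm q)
        (X ((extChartAt (𝓡 (2 * n + 1)) x).symm q)) := by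
  have := isManifold_of_natCast (n := n) (M := M) 1
  rw [← mfderiv_eq_fderiv]
  exact mfderiv_comp_apply_mpullback (isInvertible_mfderiv_extChartAt_symm hq) hu X

theorem fderiv_apply_chartField_self {x : M} (hu : MDifferentiableAt (𝓡 (2 * n + 1)) 𝓘(ℝ, ℂ) u x)
    (X : RealField n M) :
    fderiv ℝ (u ∘ (extChartAt (𝓡 (2 * n + 1)) x).symm) (extChartAt (𝓡 (2 * n + 1)) x x)
      (chartField x X (extChartAt (𝓡 (2 * n + 1)) x x)) = differential u x (X x) := by
  have := fderiv_apply_chartField (mem_extChartAt_target x) (by rwa [extChartAt_to_inv]) X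
  rwa [extChartAt_to_inv] at this

theorem fderiv_fderiv_apply_chartField (hV : IsOpen V) (hu : SmoothFnOn n u V)
    {X : RealField n M} (hX : X.SmoothOn V) (Y : RealField n M) {x : M} (hx : x ∈ V) :
    fderiv ℝ (fun q => fderiv ℝ (u ∘ (extChartAt (𝓡 (2 * n + 1)) x).symm) q (chartField x X q))
      (extChartAt (𝓡 (2 * n + 1)) x x) (chartField x Y (extChartAt (𝓡 (2 * n + 1)) x x)) =
    differential (fun y => differential u y (X y)) x (Y x) := by
  have chart_preimage_mem : (extChartAt (𝓡 (2 * n + 1)) x).symm ⁻¹' V ∈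
      𝓝 (extChartAt (𝓡 (2 * n + 1)) x x) :=
    (continuousAt_extChartAt_symm x).preimage_mem_nhds (by
      rw [extChartAt_to_inv]; exact hV.mem_nhds hx)
  have first_derivative : (fun q => fderiv ℝ (u ∘ (extChartAt (𝓡 (2 * n + 1)) x).symm) q
      (chartField x X q)) =ᶠ[𝓝 (extChartAt (𝓡 (2 * n + 1)) x x)]
      (fun y => differential u y (X y)) ∘ (extChartAt (𝓡 (2 * n + 1)) x).symm := by
    filter_upwards [extChartAt_target_mem_nhds x, chart_preimage_mem] with q hq hqV
    exact fderiv_apply_chartField hq (hu.mdifferentiableAt hV hqV) X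
  rw [first_derivative.fderiv_eq]
  exact fderiv_apply_chartField_self ((hu.differential hV hX).mdifferentiableAt hV hx) Y

theorem contMDiffAt_extChartAt_symm_self (x : M) :
    ContMDiffAt 𝓘(ℝ, EuclideanSpace ℝ (Fin (2 * n + 1))) (𝓡 (2 * n + 1)) ∞
      (extChartAt (𝓡 (2 * n + 1)) x).symm (extChartAt (𝓡 (2 * n + 1)) x x) :=
  (contMDiffOn_extChartAt_symm x).contMDiffAt (extChartAt_target_mem_nhds x)

theorem differentiableAt_chartField {X : RealField n M} (hV : IsOpen V) (hX : X.SmoothOn V)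
    {x : M} (hx : x ∈ V) :
    DifferentiableAt ℝ (chartField x X) (extChartAt (𝓡 (2 * n + 1)) x x) := by
  have := isManifold_of_natCast (n := n) (M := M) 2
  have differentiableWithinAt := ((hX.contMDiffAt (hV.mem_nhds hx)).mdifferentiableAt
    (by simp)).mdifferentiableWithinAt (s := Set.univ)
      |>.differentiableWithinAt_mpullbackWithin_vectorField
  rw [Set.preimage_univ, Set.univ_inter, ModelWithCorners.range_eq_univ,
    VectorField.mpullbackWithin_univ] at differentiableWithinAt
  exact differentiableWithinAt.differentiableAt Filter.univ_mem

theorem chartField_mlieBracket {X Y : RealField n M} (hV : IsOpen V) (hX : X.SmoothOn V)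
    (hY : Y.SmoothOn V) {x : M} (hx : x ∈ V) :
    chartField x (VectorField.mlieBracket (𝓡 (2 * n + 1)) X Y)
        (extChartAt (𝓡 (2 * n + 1)) x x) =
      VectorField.lieBracket ℝ (chartField x X) (chartField x Y)
        (extChartAt (𝓡 (2 * n + 1)) x x) := by
  have := isManifold_of_natCast (n := n) (M := M) 2
  have field_mdifferentiableAt {Z : RealField n M} (hZ : Z.SmoothOn V) :=
    (hZ.contMDiffAt (hV.mem_nhds hx)).mdifferentiableAt (by simp)
  have : IsManifold (𝓡 (2 * n + 1)) (minSmoothness ℝ 2) M := by simpa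
  refine (VectorField.mpullback_mlieBracket (n := ∞) ?_ ?_ (contMDiffAt_extChartAt_symm_self x)
    ?_).trans ?_
  · rw [extChartAt_to_inv]; exact field_mdifferentiableAt hX
  · rw [extChartAt_to_inv]; exact field_mdifferentiableAt hY
  · rw [minSmoothness_of_isRCLikeNormedField]; exact ENat.LEInfty.out
  · rw [← VectorField.mlieBracketWithin_univ, VectorField.mlieBracketWithin_eq_lieBracketWithin]
    exact congrFun (VectorField.lieBracketWithin_univ (V := chartField x X)
      (W := chartField x Y)) _

theorem differential_mlieBracket (hV : IsOpen V) (hu : SmoothFnOn n u V) {X Y : RealField n M}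
    (hX : X.SmoothOn V) (hY : Y.SmoothOn V) {x : M} (hx : x ∈ V) :
    differential u x (VectorField.mlieBracket (𝓡 (2 * n + 1)) X Y x) =
      differential (fun y => differential u y (Y y)) x (X x) -
      differential (fun y => differential u y (X y)) x (Y x) := by
  have contDiffAt_chart : ContDiffAt ℝ ∞ (u ∘ (extChartAt (𝓡 (2 * n + 1)) x).symm)
      (extChartAt (𝓡 (2 * n + 1)) x x) :=
    (ContMDiffAt.comp _ (by rw [extChartAt_to_inv]; exact hu.contMDiffAt (hV.mem_nhds hx))
      (contMDiffAt_extChartAt_symm_self x)).contDiffAt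
  rw [← fderiv_apply_chartField_self (hu.mdifferentiableAt hV hx),
    chartField_mlieBracket hV hX hY hx, VectorField.fderiv_apply_lieBracket contDiffAt_chart
      (by rw [minSmoothness_of_isRCLikeNormedField]; exact ENat.LEInfty.out)
      (differentiableAt_chartField hV hY hx) (differentiableAt_chartField hV hX hx),
    fderiv_fderiv_apply_chartField hV hu hY X hx, fderiv_fderiv_apply_chartField hV hu hX Y hx]

theorem differential_deriv_apply (hV : IsOpen V) (hu : SmoothFnOn n u V) {W : ComplexField n M}
    (hW : W.SmoothOn V) {x : M} (hx : x ∈ V) (X : TangentSpace (𝓡 (2 * n + 1)) x) :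
    differential (W.deriv u) x X = differential (fun y => differential u y (W.re y)) x X +
      Complex.I * differential (fun y => differential u y (W.im y)) x X := by
  have re_diff := (hu.differential hV hW.1).mdifferentiableAt hV hx
  have im_diff := (hu.differential hV hW.2).mdifferentiableAt hV hx
  have I_diff := (SmoothFnOn.const (n := n) Complex.I V).mdifferentiableAt hV hx
  have differential_I_mul :
      differential (fun y => Complex.I * differential u y (W.im y)) x X =
        Complex.I * differential (fun y => differential u y (W.im y)) x X := by
    rw [differential_mul I_diff im_diff, differential_const]
    exact (congrArg (Complex.I * _ + ·) (mul_zero _)).trans (add_zero _)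
  rw [← differential_I_mul]
  exact congrArg (fun L : TangentSpace (𝓡 (2 * n + 1)) x →L[ℝ] ℂ => L X)
    (differential_add re_diff (I_diff.mul im_diff))

theorem ComplexField.deriv_bracket (hV : IsOpen V) (hu : SmoothFnOn n u V)
    {X Y : ComplexField n M} (hX : X.SmoothOn V) (hY : Y.SmoothOn V) {x : M} (hx : x ∈ V) :
    (X.bracket Y).deriv u x = X.deriv (Y.deriv u) x - Y.deriv (X.deriv u) x := by
  rw [ComplexField.deriv, ComplexField.deriv, ComplexField.deriv]
  simp only [ComplexField.bracket, map_sub, map_add,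
    differential_mlieBracket hV hu hX.1 hY.1 hx, differential_mlieBracket hV hu hX.1 hY.2 hx,
    differential_mlieBracket hV hu hX.2 hY.1 hx, differential_mlieBracket hV hu hX.2 hY.2 hx,
    differential_deriv_apply hV hu hX hx, differential_deriv_apply hV hu hY hx]
  linear_combination (differential (fun y => differential u y (X.im y)) x (Y.im x) -
    differential (fun y => differential u y (Y.im y)) x (X.im x)) * Complex.I_mul_I

theorem eq_zero_of_differential_eq_zero (x₀ : M)
    (hV : V ⊆ (chartAt (EuclideanSpace ℝ (Fin (2 * n + 1))) x₀).source)
    {x : M} (hx : x ∈ V) (w : TangentSpace (𝓡 (2 * n + 1)) x)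
    (hw : ∀ u : M → ℂ, SmoothFnOn n u V → differential u x w = 0) : w = 0 := by
  have := isManifold_of_natCast (n := n) (M := M) 1
  let φ := extChartAt (𝓡 (2 * n + 1)) x₀
  have chart_smooth : ContMDiffOn (𝓡 (2 * n + 1)) 𝓘(ℝ, EuclideanSpace ℝ (Fin (2 * n + 1))) ∞
      φ V := contMDiffOn_extChartAt.mono hV
  let z : EuclideanSpace ℝ (Fin (2 * n + 1)) :=
    mfderiv (𝓡 (2 * n + 1)) 𝓘(ℝ, EuclideanSpace ℝ (Fin (2 * n + 1))) φ x w
  have coordinate_eq_zero (i : Fin (2 * n + 1)) : z i = 0 := by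
    let coord : EuclideanSpace ℝ (Fin (2 * n + 1)) →L[ℝ] ℂ :=
      Complex.ofRealCLM ∘L (EuclideanSpace.proj i)
    have differential_coord : differential (coord ∘ φ) x w = coord z :=
      congrArg (fun L : TangentSpace (𝓡 (2 * n + 1)) x →L[ℝ] ℂ => L w)
        (coord.hasFDerivAt.hasMFDerivAt.comp x
          (mdifferentiableAt_extChartAt (I := 𝓡 (2 * n + 1)) (hV hx)).hasMFDerivAt).mfderiv
    exact Complex.ofReal_eq_zero.1 (differential_coord.symm.trans
      (hw _ (coord.contMDiff.comp_contMDiffOn chart_smooth)))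
  have chart_invertible := isInvertible_mfderiv_extChartAt (I := 𝓡 (2 * n + 1)) (x := x₀) (y := x)
    (by rw [extChartAt_source]; exact hV hx)
  apply chart_invertible.injective
  rw [map_zero]
  exact (PiLp.ext coordinate_eq_zero : z = 0)

end Smooth

section Brackets

theorem ComplexForm.app_bracket_swap (η : ComplexForm n M) (V W : ComplexField n M) (x : M) :
    η.app (W.bracket V) x = -η.app (V.bracket W) x := by
  simp only [ComplexForm.app, ComplexField.bracket,
    VectorField.mlieBracket_swap_apply (V := W.re), VectorField.mlieBracket_swap_apply (V := W.im),
    map_sub, map_add, map_neg]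
  ring

theorem ComplexForm.conj_app (η : ComplexForm n M) (W : ComplexField n M) (x : M) :
    η.conj.app W x = starRingEnd ℂ (η.app W.conj x) := by
  simp [ComplexForm.app, ComplexForm.conj, ComplexField.conj]

theorem ComplexForm.conj_conj (η : ComplexForm n M) : η.conj.conj = η := by
  ext x w
  exact Complex.conj_conj (η x w)

theorem ComplexField.conj_conj (V : ComplexField n M) : V.conj.conj = V := by
  simp [ComplexField.conj]

theorem RealField.toComplex_conj (X : RealField n M) : X.toComplex.conj = X.toComplex := by
  simp [ComplexField.conj, RealField.toComplex]

theorem ComplexForm.d_of_const {U : Set M} (hU : IsOpen U) (η : ComplexForm n M)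
    {V W : ComplexField n M} {a b : ℂ} (hV : ∀ x ∈ U, η.app V x = a) (hW : ∀ x ∈ U, η.app W x = b)
    {x : M} (hx : x ∈ U) : η.d V W x = -η.app (V.bracket W) x := by
  rw [ComplexForm.d, V.deriv_congr_on hU hW hx, W.deriv_congr_on hU hV hx, V.deriv_const,
    W.deriv_const]
  ring

theorem ComplexForm.app_toComplex_bracket (η : ComplexForm n M) (X : RealField n M)
    (W : ComplexField n M) (x : M) :
    η.app (X.toComplex.bracket W) x = η.app (X.toComplex.bracket W.re.toComplex) x +
      Complex.I * η.app (X.toComplex.bracket W.im.toComplex) x := by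
  have zero_bracket (Y : RealField n M) :
      VectorField.mlieBracket (𝓡 (2 * n + 1)) (fun _ => 0) Y x = 0 :=
    congrFun VectorField.mlieBracket_zero_left x
  have bracket_zero (Y : RealField n M) :
      VectorField.mlieBracket (𝓡 (2 * n + 1)) Y (fun _ => 0) x = 0 :=
    congrFun VectorField.mlieBracket_zero_right x
  simp [ComplexForm.app, ComplexField.bracket, RealField.toComplex, zero_bracket, bracket_zero]

/-- The complex linear combination `∑ c i • Z i` with constant coefficients. -/
def ComplexField.linComb {ι : Type*} [Fintype ι] (c : ι → ℂ) (Z : ι → ComplexField n M) :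
    ComplexField n M where
  re x := ∑ i, ((c i).re • (Z i).re x + (-(c i).im) • (Z i).im x)
  im x := ∑ i, ((c i).im • (Z i).re x + (c i).re • (Z i).im x)

variable {ι : Type*} [Fintype ι] (c : ι → ℂ) (Z : ι → ComplexField n M)

theorem ComplexForm.app_linComb (η : ComplexForm n M) (x : M) :
    η.app (ComplexField.linComb c Z) x = ∑ i, c i * η.app (Z i) x := by
  simp only [ComplexForm.app, ComplexField.linComb, map_sum, map_add, map_smul, Complex.real_smul,
    Finset.mul_sum, ← Finset.sum_add_distrib]
  refine Finset.sum_congr rfl fun i _ => ?_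
  push_cast
  linear_combination (η x ((Z i).re x) + Complex.I * η x ((Z i).im x)) * Complex.re_add_im (c i) -
    (c i).im * η x ((Z i).im x) * Complex.I_mul_I

theorem ComplexField.conj_linComb :
    (linComb c Z).conj = linComb (fun i => starRingEnd ℂ (c i)) fun i => (Z i).conj := by
  simp [ComplexField.linComb, ComplexField.conj, ← Finset.sum_neg_distrib, add_comm]

variable [IsManifold (𝓡 (2 * n + 1)) ∞ M] {U : Set M}

theorem RealField.SmoothOn.neg {X : RealField n M} (hX : X.SmoothOn U) :
    RealField.SmoothOn (fun x => -X x) U :=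
  ContMDiffOn.neg_section hX

theorem RealField.SmoothOn.add {X Y : RealField n M} (hX : X.SmoothOn U) (hY : Y.SmoothOn U) :
    RealField.SmoothOn (fun x => X x + Y x) U :=
  ContMDiffOn.add_section hX hY

theorem RealField.SmoothOn.sub {X Y : RealField n M} (hX : X.SmoothOn U) (hY : Y.SmoothOn U) :
    RealField.SmoothOn (fun x => X x - Y x) U :=
  ContMDiffOn.sub_section hX hY

theorem RealField.SmoothOn.const_smul {X : RealField n M} (hX : X.SmoothOn U) (a : ℝ) :
    RealField.SmoothOn (fun x => a • X x) U :=
  ContMDiffOn.const_smul_section hX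

theorem RealField.SmoothOn.sum {X : ι → RealField n M} (hX : ∀ i, (X i).SmoothOn U) :
    RealField.SmoothOn (fun x => ∑ i, X i x) U :=
  ContMDiffOn.sum_section fun i _ => hX i

theorem RealField.SmoothOn.mdifferentiableAt {X : RealField n M} (hU : IsOpen U)
    (hX : X.SmoothOn U) {x : M} (hx : x ∈ U) :
    MDifferentiableAt (𝓡 (2 * n + 1)) (𝓡 (2 * n + 1)).tangent
      (fun x => (⟨x, X x⟩ : TangentBundle (𝓡 (2 * n + 1)) M)) x :=
  (hX.contMDiffAt (hU.mem_nhds hx)).mdifferentiableAt (by simp)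

theorem ComplexField.SmoothOn.conj {W : ComplexField n M} (hW : W.SmoothOn U) :
    W.conj.SmoothOn U :=
  ⟨hW.1, hW.2.neg⟩

theorem RealField.SmoothOn.toComplex {X : RealField n M} (hX : X.SmoothOn U) :
    X.toComplex.SmoothOn U :=
  ⟨hX, (Bundle.contMDiff_zeroSection ℝ _).contMDiffOn⟩

theorem ComplexField.SmoothOn.bracket (hU : IsOpen U) {V W : ComplexField n M}
    (hV : V.SmoothOn U) (hW : W.SmoothOn U) : (V.bracket W).SmoothOn U :=
  ⟨(hV.1.mlieBracket hU hW.1).sub (hV.2.mlieBracket hU hW.2),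
    (hV.1.mlieBracket hU hW.2).add (hV.2.mlieBracket hU hW.1)⟩

variable {Z}

theorem ComplexField.SmoothOn.linComb (hZ : ∀ i, (Z i).SmoothOn U) :
    (ComplexField.linComb c Z).SmoothOn U :=
  ⟨.sum fun i => ((hZ i).1.const_smul _).add ((hZ i).2.const_smul _),
    .sum fun i => ((hZ i).1.const_smul _).add ((hZ i).2.const_smul _)⟩

variable {x : M} (hU : IsOpen U) (hx : x ∈ U)

include hU hx in
theorem mlieBracket_sum_right {κ : Type*} (s : Finset κ) (X : RealField n M)
    {Y : κ → RealField n M} (hY : ∀ i, (Y i).SmoothOn U) :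
    VectorField.mlieBracket (𝓡 (2 * n + 1)) X (fun y => ∑ i ∈ s, Y i y) x =
      ∑ i ∈ s, VectorField.mlieBracket (𝓡 (2 * n + 1)) X (Y i) x := by
  classical
  induction s using Finset.induction_on with
  | empty => exact congrFun VectorField.mlieBracket_zero_right x
  | insert i s hi ih =>
    have sum_smooth : RealField.SmoothOn (fun y => ∑ i ∈ s, Y i y) U :=
      ContMDiffOn.sum_section fun i _ => hY i
    simp only [Finset.sum_insert hi]
    rw [← ih, ← VectorField.mlieBracket_add_right ((hY i).mdifferentiableAt hU hx)
      (sum_smooth.mdifferentiableAt hU hx)]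
    rfl

include hU hx in
theorem mlieBracket_sum_smul_add_smul_right (X : RealField n M) {Y Y' : ι → RealField n M}
    (hY : ∀ i, (Y i).SmoothOn U) (hY' : ∀ i, (Y' i).SmoothOn U) (a b : ι → ℝ) :
    VectorField.mlieBracket (𝓡 (2 * n + 1)) X (fun y => ∑ i, (a i • Y i y + b i • Y' i y)) x =
      ∑ i, (a i • VectorField.mlieBracket (𝓡 (2 * n + 1)) X (Y i) x +
        b i • VectorField.mlieBracket (𝓡 (2 * n + 1)) X (Y' i) x) := by
  rw [mlieBracket_sum_right hU hx _ X fun i => ((hY i).const_smul (a i)).add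
    ((hY' i).const_smul (b i))]
  refine Finset.sum_congr rfl fun i _ => ?_
  rw [← VectorField.mlieBracket_const_smul_right ((hY i).mdifferentiableAt hU hx),
    ← VectorField.mlieBracket_const_smul_right ((hY' i).mdifferentiableAt hU hx)]
  exact VectorField.mlieBracket_add_right (((hY i).const_smul _).mdifferentiableAt hU hx)
    (((hY' i).const_smul _).mdifferentiableAt hU hx)

include hU hx in
theorem mlieBracket_neg_right (X : RealField n M) {Y : RealField n M} (hY : Y.SmoothOn U) :
    VectorField.mlieBracket (𝓡 (2 * n + 1)) X (fun y => -Y y) x =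
      -VectorField.mlieBracket (𝓡 (2 * n + 1)) X Y x := by
  have neg_one_smul_eq : (-1 : ℝ) • Y = fun y => -Y y := neg_one_smul ℝ Y
  rw [← neg_one_smul_eq,
    VectorField.mlieBracket_const_smul_right (hY.mdifferentiableAt hU hx), neg_one_smul]

include hU hx in
theorem ComplexForm.app_bracket_linComb_right (η : ComplexForm n M) (V : ComplexField n M)
    (hZ : ∀ i, (Z i).SmoothOn U) :
    η.app (V.bracket (ComplexField.linComb c Z)) x = ∑ i, c i * η.app (V.bracket (Z i)) x := by
  have bracket_sum (X : RealField n M) (a b : ι → ℝ) :=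
    mlieBracket_sum_smul_add_smul_right hU hx X (fun i => (hZ i).1) (fun i => (hZ i).2) a b
  simp only [ComplexForm.app, ComplexField.bracket, ComplexField.linComb, bracket_sum, map_sub,
    map_add, map_sum, map_smul, Complex.real_smul, ← Finset.sum_sub_distrib,
    ← Finset.sum_add_distrib, Finset.mul_sum]
  refine Finset.sum_congr rfl fun i _ => ?_
  have mul_add_I_mul (a b p q : ℂ) :
      (a + b * Complex.I) * (p + Complex.I * q) = a * p - b * q + Complex.I * (b * p + a * q) := by
    linear_combination b * q * Complex.I_mul_I
  conv_rhs => rw [← Complex.re_add_im (c i), mul_add_I_mul]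
  push_cast
  ring

include hU hx in
theorem ComplexForm.app_bracket_linComb_left (η : ComplexForm n M) (V : ComplexField n M)
    (hZ : ∀ i, (Z i).SmoothOn U) :
    η.app ((ComplexField.linComb c Z).bracket V) x = ∑ i, c i * η.app ((Z i).bracket V) x := by
  rw [η.app_bracket_swap V, η.app_bracket_linComb_right c hU hx V hZ, ← Finset.sum_neg_distrib]
  exact Finset.sum_congr rfl fun i _ => by rw [η.app_bracket_swap V, mul_neg]

end Brackets

namespace PseudohermitianStructure

variable [IsManifold (𝓡 (2 * n + 1)) ∞ M]

section Structure

variable (S : PseudohermitianStructure n M) {U : Set M} {x : M}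

theorem theta_smoothOn (U : Set M) : S.theta.SmoothOn U :=
  ContMDiffOn.mono S.form_smooth (Set.subset_univ U)

theorem theta_conj : S.theta.conj = S.theta := by
  ext x w
  exact Complex.conj_ofReal (S.form x w)

theorem theta_app (V : ComplexField n M) (x : M) :
    S.theta.app V x = S.form x (V.re x) + Complex.I * S.form x (V.im x) := by
  simp [ComplexForm.app, theta]

variable {S} in
theorem IsT10At.theta_app_eq_zero {V : ComplexField n M} (hV : S.IsT10At V x) :
    S.theta.app V x = 0 := by
  simp [theta_app, hV.1, hV.2, S.J_mem x _ hV.1]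

variable {S} in
theorem IsT10At.J_re {V : ComplexField n M} (hV : S.IsT10At V x) :
    S.J x (V.re x) = -V.im x := by
  rw [hV.2, neg_neg]

variable {S} in
theorem IsT10At.form_im {V : ComplexField n M} (hV : S.IsT10At V x) :
    S.form x (V.im x) = 0 := by
  rw [hV.2, map_neg, S.J_mem x _ hV.1, neg_zero]

variable {S} in
theorem IsT10At.J_im {V : ComplexField n M} (hV : S.IsT10At V x) :
    S.J x (V.im x) = V.re x := by
  rw [hV.2, map_neg, S.J_sq x _ hV.1, neg_neg]

variable {S} in
theorem IsT10At.linComb {ι : Type*} [Fintype ι] {Z : ι → ComplexField n M}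
    (hZ : ∀ i, S.IsT10At (Z i) x) (c : ι → ℂ) : S.IsT10At (ComplexField.linComb c Z) x := by
  constructor
  · simp [ComplexField.linComb, (hZ _).1, (hZ _).form_im]
  · simp [ComplexField.linComb, (hZ _).J_re, (hZ _).J_im, ← Finset.sum_neg_distrib, add_comm]

variable (hU : IsOpen U) (hx : x ∈ U)
include hU hx

/-- With `W = X - i J X` one has `[W, W̄] = 2 i [X, J X]`. -/
theorem theta_app_bracket_conj_ne_zero {W : ComplexField n M} (hW : W.SmoothOn U)
    (W_mem : ∀ y ∈ U, S.IsT10At W y) (hne : W.re x ≠ 0) :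
    S.theta.app (W.bracket W.conj) x ≠ 0 := by
  have levi_pos := S.pseudoconvex U hU W.re hW.1 (fun y hy => (W_mem y hy).1) x hx hne
  have bracket_J : VectorField.mlieBracket (𝓡 (2 * n + 1)) W.re (fun y => S.J y (W.re y)) x =
      -VectorField.mlieBracket (𝓡 (2 * n + 1)) W.re W.im x := by
    rw [← mlieBracket_neg_right hU hx _ hW.2]
    refine Filter.EventuallyEq.mlieBracket_vectorField_eq (Filter.EventuallyEq.refl _ _) ?_
    filter_upwards [hU.mem_nhds hx] with y hy using (W_mem y hy).J_re
  rw [bracket_J, map_neg, neg_neg] at levi_pos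
  intro theta_eq_zero
  have im_eq_zero := congrArg Complex.im ((S.theta_app _ _).symm.trans theta_eq_zero)
  have bracket_swap := VectorField.mlieBracket_swap_apply (I := 𝓡 (2 * n + 1)) (V := W.im)
    (W := W.re) (x := x)
  simp only [ComplexField.bracket, ComplexField.conj, mlieBracket_neg_right hU hx _ hW.2,
    bracket_swap, map_add, map_neg] at im_eq_zero
  simp at im_eq_zero
  linarith

end Structure

theorem IsCRFunctionOn.deriv_conj_eq_zero {S : PseudohermitianStructure n M}
    {U : Set M} {v : M → ℂ}
    (hv : S.IsCRFunctionOn v U) {x : M} (hx : x ∈ U) {W : ComplexField n M}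
    (hW : S.IsT10At W x) : W.conj.deriv v x = 0 := by
  have cauchy_riemann := hv.2 x hx (W.re x) hW.1
  rwa [hW.J_re] at cauchy_riemann

namespace AdmissibleFrame

variable {S : PseudohermitianStructure n M} {U : Set M} (F : S.AdmissibleFrame U)

/-- The coframe `θ`, `θ^α`, `θ^ᾱ` dual to `AdmissibleFrame.field`. -/
def coform : Dir n → ComplexForm n M
  | .zero => S.theta
  | .hol α => F.coframe α
  | .anti α => (F.coframe α).conj

theorem field_conj (i : Dir n) : (F.field i).conj = F.field i.conj := by
  cases i
  exacts [F.T.toComplex_conj, rfl, ComplexField.conj_conj _]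

theorem coform_conj (i : Dir n) : (F.coform i).conj = F.coform i.conj := by
  cases i
  exacts [S.theta_conj, rfl, ComplexForm.conj_conj _]

theorem coform_conj_app_field_conj (i j : Dir n) (x : M) :
    (F.coform i.conj).app (F.field j.conj) x = starRingEnd ℂ ((F.coform i).app (F.field j) x) := by
  rw [← coform_conj, ← field_conj, ComplexForm.conj_app, ComplexField.conj_conj]

theorem field_smoothOn (i : Dir n) : (F.field i).SmoothOn U := by
  cases i with
  | zero => exact F.T_smooth.toComplex
  | hol α => exact F.Z_smooth α
  | anti α => exact (F.Z_smooth α).conj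

section Pointwise

variable {x : M} (hx : x ∈ U)
include hx

theorem theta_app_field_hol (α : Fin n) : S.theta.app (F.Z α) x = 0 :=
  (F.Z_mem α x hx).theta_app_eq_zero

open Classical in
theorem coform_app_field (i j : Dir n) :
    (F.coform i).app (F.field j) x = if i = j then 1 else 0 := by
  have conj_eq {i j : Dir n} (h : (F.coform i).app (F.field j) x = 0) :
      (F.coform i.conj).app (F.field j.conj) x = 0 := by
    rw [coform_conj_app_field_conj, h, map_zero]
  have theta_hol (α : Fin n) : (F.coform .zero).app (F.field (.hol α)) x = 0 :=
    F.theta_app_field_hol hx α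
  have hol_zero (α : Fin n) : (F.coform (.hol α)).app (F.field .zero) x = 0 := by
    simp [coform, field, ComplexForm.app, RealField.toComplex, F.coframe_T α x hx]
  have hol_anti (α β : Fin n) : (F.coform (.hol α)).app (F.field (.anti β)) x = 0 :=
    F.coframe_Zbar α β x hx
  have hol_hol (α β : Fin n) :
      (F.coform (.hol α)).app (F.field (.hol β)) x = if α = β then 1 else 0 :=
    F.coframe_Z α β x hx
  rcases i with _ | α | α <;> rcases j with _ | β | β
  · simp [coform, field, theta_app, RealField.toComplex, F.form_T x hx]
  · simpa using theta_hol β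
  · simpa [Dir.conj] using conj_eq (theta_hol β)
  · simpa using hol_zero α
  · simpa using hol_hol α β
  · simpa using hol_anti α β
  · simpa [Dir.conj] using conj_eq (hol_zero α)
  · simpa [Dir.conj] using conj_eq (hol_anti α β)
  · have := F.coform_conj_app_field_conj (.hol α) (.hol β) x
    rw [hol_hol, apply_ite (starRingEnd ℂ), map_one, map_zero] at this
    simpa [Dir.conj] using this

theorem linearIndependent_coform :
    LinearIndependent ℂ fun i : Dir n =>
      (F.coform i x : TangentSpace (𝓡 (2 * n + 1)) x →ₗ[ℝ] ℂ) := by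
  classical
  refine Fintype.linearIndependent_iff.2 fun g hg j => ?_
  have apply_eq_zero (w : TangentSpace (𝓡 (2 * n + 1)) x) : ∑ i, g i * F.coform i x w = 0 := by
    simpa using LinearMap.congr_fun hg w
  calc g j = ∑ i, g i * (F.coform i).app (F.field j) x := by simp [F.coform_app_field hx]
    _ = ∑ i, g i * F.coform i x ((F.field j).re x) +
        Complex.I * ∑ i, g i * F.coform i x ((F.field j).im x) := by
      rw [Finset.mul_sum, ← Finset.sum_add_distrib]
      exact Finset.sum_congr rfl fun i _ => by rw [ComplexForm.app]; ring
    _ = 0 := by rw [apply_eq_zero, apply_eq_zero, mul_zero, add_zero]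

theorem span_coform :
    Submodule.span ℂ (Set.range fun i : Dir n =>
      (F.coform i x : TangentSpace (𝓡 (2 * n + 1)) x →ₗ[ℝ] ℂ)) = ⊤ := by
  have finrank_tangentSpace : Module.finrank ℝ (TangentSpace (𝓡 (2 * n + 1)) x) = 2 * n + 1 :=
    finrank_euclideanSpace_fin
  have : FiniteDimensional ℝ (TangentSpace (𝓡 (2 * n + 1)) x) :=
    inferInstanceAs (FiniteDimensional ℝ (EuclideanSpace ℝ (Fin (2 * n + 1))))
  refine (F.linearIndependent_coform hx).span_eq_top_of_card_eq_finrank' ?_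
  rw [Module.finrank_linearMap, finrank_tangentSpace, Module.finrank_self,
    ← Fintype.card_congr (Dir.equivOption n)]
  simp
  ring

/-- Evaluating both sides on the frame fields identifies the coefficients in the expansion of `L`
in the coframe. -/
theorem apply_eq_sum_coform (L : TangentSpace (𝓡 (2 * n + 1)) x →ₗ[ℝ] ℂ)
    (w : TangentSpace (𝓡 (2 * n + 1)) x) :
    L w = ∑ i, F.coform i x w * (L ((F.field i).re x) + Complex.I * L ((F.field i).im x)) := by
  classical
  obtain ⟨g, hg⟩ := (Submodule.mem_span_range_iff_exists_fun ℂ).1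
    ((F.span_coform hx).symm ▸ Submodule.mem_top : L ∈ Submodule.span ℂ _)
  have apply_eq (w : TangentSpace (𝓡 (2 * n + 1)) x) : L w = ∑ i, g i * F.coform i x w := by
    simpa using (LinearMap.congr_fun hg w).symm
  have coefficient_eq (j : Dir n) :
      L ((F.field j).re x) + Complex.I * L ((F.field j).im x) = g j := by
    calc L ((F.field j).re x) + Complex.I * L ((F.field j).im x)
        = ∑ i, g i * (F.coform i).app (F.field j) x := by
          rw [apply_eq, apply_eq, Finset.mul_sum, ← Finset.sum_add_distrib]
          exact Finset.sum_congr rfl fun i _ => by rw [ComplexForm.app]; ring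
      _ = g j := by simp [F.coform_app_field hx]
  rw [apply_eq]
  exact Finset.sum_congr rfl fun i _ => by rw [coefficient_eq, mul_comm]

theorem deriv_eq_sum_coform (V : ComplexField n M) (u : M → ℂ) :
    V.deriv u x = ∑ i, (F.coform i).app V x * (F.field i).deriv u x := by
  have expand := F.apply_eq_sum_coform hx
    (differential u x : TangentSpace (𝓡 (2 * n + 1)) x →L[ℝ] ℂ)
  simp only [ContinuousLinearMap.coe_coe] at expand
  rw [ComplexField.deriv, expand (V.re x), expand (V.im x), Finset.mul_sum,
    ← Finset.sum_add_distrib]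
  exact Finset.sum_congr rfl fun i _ => by rw [ComplexForm.app, ComplexField.deriv]; ring

theorem coframe_J (β : Fin n) {w : TangentSpace (𝓡 (2 * n + 1)) x} (hw : S.form x w = 0) :
    F.coframe β x (S.J x w) = Complex.I * F.coframe β x w := by
  have expand := F.apply_eq_sum_coform hx (F.coframe β x ∘ₗ S.J x) w
  have theta_zero : F.coform .zero x w = 0 := by simp [coform, theta, hw]
  have hol_coefficient (α : Fin n) :
      F.coframe β x (S.J x ((F.Z α).re x)) + Complex.I * F.coframe β x (S.J x ((F.Z α).im x)) =
        Complex.I * if β = α then 1 else 0 := by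
    rw [← F.coframe_Z β α x hx, (F.Z_mem α x hx).J_re, (F.Z_mem α x hx).J_im, ComplexForm.app,
      map_neg]
    linear_combination -F.coframe β x ((F.Z α).im x) * Complex.I_mul_I
  have anti_coefficient (α : Fin n) :
      F.coframe β x (S.J x ((F.Z α).conj.re x)) +
        Complex.I * F.coframe β x (S.J x ((F.Z α).conj.im x)) = 0 := by
    have := F.coframe_Zbar β α x hx
    simp only [ComplexForm.app, ComplexField.conj, map_neg] at this ⊢
    rw [(F.Z_mem α x hx).J_re, (F.Z_mem α x hx).J_im, map_neg]
    linear_combination -Complex.I * this - F.coframe β x ((F.Z α).im x) * Complex.I_mul_I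
  rw [Dir.sum_eq, theta_zero] at expand
  simpa [field, hol_coefficient, anti_coefficient, coform, mul_comm] using expand

theorem coframe_conj_app_eq_zero {V : ComplexField n M} (hV : S.IsT10At V x) (β : Fin n) :
    (F.coframe β).conj.app V x = 0 := by
  rw [ComplexForm.conj_app, map_eq_zero]
  simp only [ComplexForm.app, ComplexField.conj, hV.2, neg_neg, F.coframe_J hx β hV.1]
  linear_combination F.coframe β x (V.re x) * Complex.I_mul_I

end Pointwise

/-- The structure functions of the frame: `[e_i, e_j] = ∑ k, structureFn i j k • e_k`. -/
def structureFn (i j k : Dir n) : M → ℂ := (F.coform k).app ((F.field i).bracket (F.field j))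

section StructureFn

variable {x : M} (hU : IsOpen U) (hx : x ∈ U)
include hx hU

theorem d_coform_field (i j k : Dir n) :
    (F.coform k).d (F.field i) (F.field j) x = -F.structureFn i j k x := by
  classical
  exact ComplexForm.d_of_const hU _ (fun y hy => F.coform_app_field hy k i)
    (fun y hy => F.coform_app_field hy k j) hx

theorem structureFn_zero_hol_zero (α : Fin n) : F.structureFn .zero (.hol α) .zero x = 0 := by
  have bracket_T_eq_zero {Y : RealField n M} (hY : Y.SmoothOn U)
      (form_Y : ∀ y ∈ U, S.form y (Y y) = 0) :
      S.theta.app (F.T.toComplex.bracket Y.toComplex) x = 0 := by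
    rw [← neg_eq_zero, ← ComplexForm.d_of_const (a := 1) (b := 0) hU S.theta
      (fun y hy => by simp [theta_app, RealField.toComplex, F.form_T y hy])
      (fun y hy => by simp [theta_app, RealField.toComplex, form_Y y hy]) hx]
    exact F.d_form_T Y hY x hx
  have re_eq_zero := bracket_T_eq_zero (F.Z_smooth α).1 fun y hy => (F.Z_mem α y hy).1
  have im_eq_zero := bracket_T_eq_zero (F.Z_smooth α).2 fun y hy => (F.Z_mem α y hy).form_im
  rw [structureFn, coform, field, field, ComplexForm.app_toComplex_bracket, re_eq_zero,
    im_eq_zero, mul_zero, add_zero]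

theorem isT10At_bracket (α β : Fin n) : S.IsT10At ((F.Z α).bracket (F.Z β)) x :=
  S.integrable U hU _ _ (F.Z_smooth α) (F.Z_smooth β) (F.Z_mem α) (F.Z_mem β) x hx

theorem structureFn_hol_hol_zero (α β : Fin n) :
    F.structureFn (.hol α) (.hol β) .zero x = 0 :=
  (F.isT10At_bracket hU hx α β).theta_app_eq_zero

theorem structureFn_hol_hol_anti (α β γ : Fin n) :
    F.structureFn (.hol α) (.hol β) (.anti γ) x = 0 :=
  F.coframe_conj_app_eq_zero hx (F.isT10At_bracket hU hx α β) γ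

theorem h_eq (α β : Fin n) :
    F.h α β x = Complex.I * F.structureFn (.hol α) (.anti β) .zero x := by
  have d_theta : S.theta.d (F.Z α) (F.Z β).conj x = _ :=
    F.d_coform_field hU hx (.hol α) (.anti β) .zero
  rw [h, d_theta, neg_mul_neg]

theorem eq_zero_of_sum_mul_h_eq_zero {c : Fin n → ℂ} (hc : ∀ β, ∑ α, c α * F.h α β x = 0) :
    c = 0 := by
  by_contra hne
  obtain ⟨γ, hγ⟩ := Function.ne_iff.1 hne
  have W_mem {y : M} (hy : y ∈ U) : S.IsT10At (ComplexField.linComb c F.Z) y :=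
    .linComb (fun α => F.Z_mem α y hy) c
  have W_ne_zero : (ComplexField.linComb c F.Z).re x ≠ 0 := by
    intro re_eq_zero
    have app_W := ComplexForm.app_linComb c F.Z (F.coframe γ) x
    rw [ComplexForm.app, (W_mem hx).2, re_eq_zero] at app_W
    exact hγ (by simpa [F.coframe_Z γ _ x hx] using app_W.symm)
  refine S.theta_app_bracket_conj_ne_zero hU hx (.linComb c F.Z_smooth) (fun y hy => W_mem hy)
    W_ne_zero ?_
  have theta_bracket (α β : Fin n) :
      S.theta.app ((F.Z α).bracket (F.Z β).conj) x = -Complex.I * F.h α β x := by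
    rw [F.h_eq hU hx, ← mul_assoc, neg_mul, Complex.I_mul_I, neg_neg, one_mul]
    rfl
  calc S.theta.app ((ComplexField.linComb c F.Z).bracket (ComplexField.linComb c F.Z).conj) x
      = ∑ β, starRingEnd ℂ (c β) * (-Complex.I * ∑ α, c α * F.h α β x) := by
        rw [ComplexField.conj_linComb, ComplexForm.app_bracket_linComb_right _ hU hx _ _
          fun β => (F.Z_smooth β).conj]
        simp only [ComplexForm.app_bracket_linComb_left c hU hx _ _ F.Z_smooth, theta_bracket,
          Finset.mul_sum]
        exact Finset.sum_congr rfl fun β _ => Finset.sum_congr rfl fun α _ => by ring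
    _ = 0 := by simp only [hc, mul_zero, Finset.sum_const_zero]

theorem det_h_ne_zero : (Matrix.of fun γ δ => F.h γ δ x).det ≠ 0 := by
  intro det_eq_zero
  obtain ⟨c, hc, vecMul_eq_zero⟩ := Matrix.exists_vecMul_eq_zero_iff.2 det_eq_zero
  exact hc (F.eq_zero_of_sum_mul_h_eq_zero hU hx (congrFun vecMul_eq_zero))

end StructureFn

end AdmissibleFrame

end PseudohermitianStructure

/-! ### The algebra of smooth functions on an open set -/

section SmoothFunctions

variable {V : Set M}

theorem SmoothFnOn.inv {u : M → ℂ} (hu : SmoothFnOn n u V) (u_ne_zero : ∀ x ∈ V, u x ≠ 0) :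
    SmoothFnOn n (fun y => (u y)⁻¹) V := fun x hx =>
  ((contDiffAt_inv (n := ∞) ℝ (u_ne_zero x hx)).contMDiffAt).comp_contMDiffWithinAt x (hu x hx)

/-- The algebra of those functions on `V` that are restrictions of functions on `M` smooth
on `V`. -/
def smoothSubalgebra (n : ℕ) {M : Type*} [TopologicalSpace M]
    [ChartedSpace (EuclideanSpace ℝ (Fin (2 * n + 1))) M] (V : Set M) :
    StarSubalgebra ℂ (V → ℂ) where
  carrier := {g | ∃ u : M → ℂ, SmoothFnOn n u V ∧ ∀ y : V, g y = u y}
  mul_mem' := by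
    rintro f g ⟨u, hu, hfu⟩ ⟨w, hw, hgw⟩
    exact ⟨_, hu.mul hw, fun y => by rw [Pi.mul_apply, hfu, hgw]⟩
  add_mem' := by
    rintro f g ⟨u, hu, hfu⟩ ⟨w, hw, hgw⟩
    exact ⟨_, hu.add hw, fun y => by rw [Pi.add_apply, hfu, hgw]⟩
  algebraMap_mem' c := ⟨_, SmoothFnOn.const c V, fun _ => rfl⟩
  star_mem' := by
    rintro f ⟨u, hu, hfu⟩
    exact ⟨_, hu.star, fun y => congrArg star (hfu y)⟩

/-- The type underlying `smoothSubalgebra`. -/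
abbrev SmoothAlg (n : ℕ) {M : Type*} [TopologicalSpace M]
    [ChartedSpace (EuclideanSpace ℝ (Fin (2 * n + 1))) M] (V : Set M) : Type _ :=
  smoothSubalgebra n V

instance : CommRing (SmoothAlg n V) :=
  inferInstanceAs (CommRing (smoothSubalgebra n V).toSubalgebra)

namespace SmoothAlg

/-- `a` is the restriction to `V` of the function `u` on `M`. -/
def IsRestriction (a : SmoothAlg n V) (u : M → ℂ) : Prop := ∀ y : V, a.1 y = u y

/-- The restriction to `V` of a function that is smooth on `V`. -/
def restrict (u : M → ℂ) (hu : SmoothFnOn n u V) : SmoothAlg n V :=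
  ⟨fun y => u y, u, hu, fun _ => rfl⟩

theorem isRestriction_restrict (u : M → ℂ) (hu : SmoothFnOn n u V) :
    IsRestriction (restrict u hu) u := fun _ => rfl

/-- The extension by zero to `M`. -/
def extend (a : SmoothAlg n V) : M → ℂ := Function.extend Subtype.val a.1 0

theorem isRestriction_extend (a : SmoothAlg n V) : IsRestriction a a.extend := fun y =>
  (Subtype.val_injective.extend_apply a.1 0 y).symm

/-- Evaluation at a point. -/
def eval (y : V) : SmoothAlg n V →+* ℂ :=
  (Pi.evalRingHom (fun _ => ℂ) y).comp (smoothSubalgebra n V).subtype.toRingHom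

theorem isRestriction_algebraMap (c : ℂ) :
    IsRestriction (algebraMap ℂ (SmoothAlg n V) c) fun _ => c := fun _ => rfl

theorem isRestriction_zero : IsRestriction (0 : SmoothAlg n V) fun _ => 0 := fun _ => rfl

theorem isRestriction_one : IsRestriction (1 : SmoothAlg n V) fun _ => 1 := fun _ => rfl

theorem isRestriction_natCast (m : ℕ) :
    IsRestriction (m : SmoothAlg n V) fun _ => (m : ℂ) := fun _ => rfl

namespace IsRestriction

variable {a b : SmoothAlg n V} {u w : M → ℂ}

theorem smoothFnOn (ha : IsRestriction a u) : SmoothFnOn n u V := by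
  obtain ⟨w, hw, haw⟩ := a.2
  exact hw.congr fun x hx => by rw [← haw ⟨x, hx⟩, ha ⟨x, hx⟩]

theorem ext (ha : IsRestriction a u) (hb : IsRestriction b w) (huw : ∀ y ∈ V, u y = w y) :
    a = b :=
  Subtype.ext <| funext fun y => by rw [ha y, hb y, huw y y.2]

theorem congr (ha : IsRestriction a u) (huw : ∀ y ∈ V, u y = w y) : IsRestriction a w :=
  fun y => by rw [ha y, huw y y.2]

theorem eq (ha : IsRestriction a u) (ha' : IsRestriction a w) {x : M} (hx : x ∈ V) :
    u x = w x := by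
  rw [← ha ⟨x, hx⟩, ha' ⟨x, hx⟩]

theorem add (ha : IsRestriction a u) (hb : IsRestriction b w) :
    IsRestriction (a + b) fun y => u y + w y := fun y => congrArg₂ (· + ·) (ha y) (hb y)

theorem sub (ha : IsRestriction a u) (hb : IsRestriction b w) :
    IsRestriction (a - b) fun y => u y - w y := fun y => congrArg₂ (· - ·) (ha y) (hb y)

theorem mul (ha : IsRestriction a u) (hb : IsRestriction b w) :
    IsRestriction (a * b) fun y => u y * w y := fun y => congrArg₂ (· * ·) (ha y) (hb y)

theorem neg (ha : IsRestriction a u) : IsRestriction (-a) fun y => -u y :=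
  fun y => congrArg Neg.neg (ha y)

theorem star (ha : IsRestriction a u) :
    IsRestriction (Star.star a) fun y => starRingEnd ℂ (u y) :=
  fun y => congrArg Star.star (ha y)

theorem smul (ha : IsRestriction a u) (c : ℂ) : IsRestriction (c • a) fun y => c * u y :=
  fun y => congrArg (c * ·) (ha y)

theorem sum {ι : Type*} [Fintype ι] {a : ι → SmoothAlg n V} {u : ι → M → ℂ}
    (h : ∀ i, IsRestriction (a i) (u i)) : IsRestriction (∑ i, a i) fun y => ∑ i, u i y :=
  fun y => (map_sum (eval y) a _).trans (Finset.sum_congr rfl fun i _ => h i y)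

theorem deriv_extend (ha : IsRestriction a u) (hV : IsOpen V) (W : ComplexField n M) (y : V) :
    W.deriv a.extend y = W.deriv u y :=
  W.deriv_congr_on hV (fun _ hz => (isRestriction_extend a).eq ha hz) y.2

end IsRestriction

theorem smoothFnOn_extend (a : SmoothAlg n V) : SmoothFnOn n a.extend V :=
  a.isRestriction_extend.smoothFnOn

theorem mdifferentiableAt_extend (a : SmoothAlg n V) (hV : IsOpen V) (y : V) :
    MDifferentiableAt (𝓡 (2 * n + 1)) 𝓘(ℝ, ℂ) a.extend y :=
  a.smoothFnOn_extend.mdifferentiableAt hV y.2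

theorem isUnit_of_forall_ne_zero (a : SmoothAlg n V) (ha : ∀ y, eval y a ≠ 0) : IsUnit a := by
  have extend_ne_zero (x : M) (hx : x ∈ V) : a.extend x ≠ 0 := by
    rw [← a.isRestriction_extend ⟨x, hx⟩]
    exact ha ⟨x, hx⟩
  have smooth_inv := a.smoothFnOn_extend.inv extend_ne_zero
  refine IsUnit.of_mul_eq_one (restrict _ smooth_inv) ?_
  exact (a.isRestriction_extend.mul (isRestriction_restrict _ smooth_inv)).ext
    isRestriction_one fun y hy => mul_inv_cancel₀ (extend_ne_zero y hy)

variable [IsManifold (𝓡 (2 * n + 1)) ∞ M]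

/-- The derivation of the algebra of smooth functions given by a smooth complex vector field. -/
def derivation (hV : IsOpen V) (W : ComplexField n M) (hW : W.SmoothOn V) :
    Derivation ℂ (SmoothAlg n V) (SmoothAlg n V) :=
  Derivation.mk'
    { toFun := fun a => restrict (W.deriv a.extend) (a.smoothFnOn_extend.deriv hV hW)
      map_add' := fun a b => Subtype.ext <| funext fun y => by
        change W.deriv (a + b).extend y = W.deriv a.extend y + W.deriv b.extend y
        rw [(a.isRestriction_extend.add b.isRestriction_extend).deriv_extend hV,
          W.deriv_add (a.mdifferentiableAt_extend hV y) (b.mdifferentiableAt_extend hV y)]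
      map_smul' := fun c a => Subtype.ext <| funext fun y => by
        change W.deriv (c • a).extend y = c * W.deriv a.extend y
        rw [(a.isRestriction_extend.smul c).deriv_extend hV,
          W.deriv_mul mdifferentiableAt_const (a.mdifferentiableAt_extend hV y), W.deriv_const,
          mul_zero, add_zero] }
    fun a b => Subtype.ext <| funext fun y => by
      change W.deriv (a * b).extend y = a.1 y * W.deriv b.extend y + b.1 y * W.deriv a.extend y
      rw [(a.isRestriction_extend.mul b.isRestriction_extend).deriv_extend hV,
        W.deriv_mul (a.mdifferentiableAt_extend hV y) (b.mdifferentiableAt_extend hV y),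
        a.isRestriction_extend, b.isRestriction_extend]

theorem IsRestriction.derivation {a : SmoothAlg n V} {u : M → ℂ} (ha : IsRestriction a u)
    (hV : IsOpen V) {W : ComplexField n M} (hW : W.SmoothOn V) :
    IsRestriction (SmoothAlg.derivation hV W hW a) (W.deriv u) := ha.deriv_extend hV W

end SmoothAlg

variable [IsManifold (𝓡 (2 * n + 1)) ∞ M]

theorem ComplexField.SmoothOn.mono {W : ComplexField n M} {U V : Set M} (hW : W.SmoothOn U)
    (hVU : V ⊆ U) : W.SmoothOn V := ⟨ContMDiffOn.mono hW.1 hVU, ContMDiffOn.mono hW.2 hVU⟩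

theorem ComplexForm.SmoothOn.conj_app {η : ComplexForm n M} (hη : η.SmoothOn V)
    {W : ComplexField n M} (hW : W.SmoothOn V) : SmoothFnOn n (η.conj.app W) V :=
  (hη.app hW.conj).star.congr fun x _ => η.conj_app W x

theorem ComplexForm.app_eq_zero_of_deriv_eq_zero (x₀ : M) (hVo : IsOpen V)
    (hV : V ⊆ (chartAt (EuclideanSpace ℝ (Fin (2 * n + 1))) x₀).source)
    {x : M} (hx : x ∈ V) (W : ComplexField n M)
    (hW : ∀ u : M → ℂ, SmoothFnOn n u V → W.deriv u x = 0) (η : ComplexForm n M) :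
    η.app W x = 0 := by
  -- `W` and its conjugate kill all smooth functions, hence so do its real and imaginary parts.
  have conj_deriv_eq_zero (u : M → ℂ) (hu : SmoothFnOn n u V) : W.conj.deriv u x = 0 := by
    have star_deriv := W.conj.deriv_star (hu.mdifferentiableAt hVo hx)
    rwa [ComplexField.conj_conj, hW _ hu.star, map_eq_zero] at star_deriv
  have re_eq_zero : W.re x = 0 := eq_zero_of_differential_eq_zero x₀ hV hx _ fun u hu => by
    have deriv_eq := hW u hu
    have conj_deriv_eq := conj_deriv_eq_zero u hu
    simp only [ComplexField.deriv, ComplexField.conj, map_neg] at deriv_eq conj_deriv_eq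
    linear_combination (deriv_eq + conj_deriv_eq) / 2
  have im_eq_zero : W.im x = 0 := eq_zero_of_differential_eq_zero x₀ hV hx _ fun u hu => by
    simpa [ComplexField.deriv, re_eq_zero] using hW u hu
  simp [ComplexForm.app, re_eq_zero, im_eq_zero]

end SmoothFunctions

namespace PseudohermitianStructure.AdmissibleFrame

open SmoothAlg

variable [IsManifold (𝓡 (2 * n + 1)) ∞ M]
  {S : PseudohermitianStructure n M} {U : Set M} (F : S.AdmissibleFrame U)

theorem smoothFnOn_structureFn (hU : IsOpen U) (i j k : Dir n) :
    SmoothFnOn n (F.structureFn i j k) U := by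
  have smooth_bracket := (F.field_smoothOn i).bracket hU (F.field_smoothOn j)
  cases k with
  | zero => exact (S.theta_smoothOn U).app smooth_bracket
  | hol γ => exact (F.coframe_smooth γ).app smooth_bracket
  | anti γ => exact (F.coframe_smooth γ).conj_app smooth_bracket

section Model

variable (hU : IsOpen U) {V : Set M} (hVU : V ⊆ U)

/-- The structure functions of a frame, restricted to a smaller set. -/
def structureConst (i j k : Dir n) : SmoothAlg n V :=
  restrict (F.structureFn i j k) ((F.smoothFnOn_structureFn hU i j k).mono hVU)

theorem isRestriction_structureConst (i j k : Dir n) :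
    IsRestriction (F.structureConst hU hVU i j k) (F.structureFn i j k) :=
  isRestriction_restrict _ _

/-- The matrix of the Levi form, restricted to a smaller set. -/
def leviMatrix : Matrix (Fin n) (Fin n) (SmoothAlg n V) :=
  Matrix.of fun α β => imagUnit _ * F.structureConst hU hVU (.hol α) (.anti β) .zero

theorem isRestriction_leviMatrix (α β : Fin n) :
    IsRestriction (F.leviMatrix hU hVU α β) (F.h α β) :=
  ((isRestriction_algebraMap Complex.I).mul (F.isRestriction_structureConst hU hVU _ _ _)).congr
    fun _ hy => (F.h_eq hU (hVU hy) α β).symm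

theorem eval_mapMatrix_leviMatrix (y : V) :
    (eval y).mapMatrix (F.leviMatrix hU hVU) = Matrix.of fun α β => F.h α β y := by
  ext α β
  exact F.isRestriction_leviMatrix hU hVU α β y

theorem isUnit_det_leviMatrix : IsUnit (F.leviMatrix hU hVU).det :=
  isUnit_of_forall_ne_zero _ fun y => by
    rw [RingHom.map_det, eval_mapMatrix_leviMatrix]
    exact F.det_h_ne_zero hU (hVU y.2)

theorem isRestriction_leviMatrix_inv (α β : Fin n) :
    IsRestriction ((F.leviMatrix hU hVU)⁻¹ β α) (F.hInv α β) := by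
  intro y
  have h_mul_inv : (Matrix.of fun α β => F.h α β y) *
      (eval y).mapMatrix (F.leviMatrix hU hVU)⁻¹ = 1 := by
    rw [← F.eval_mapMatrix_leviMatrix hU hVU, ← map_mul,
      Matrix.mul_nonsing_inv _ (F.isUnit_det_leviMatrix hU hVU), map_one]
  rw [hInv, Matrix.inv_eq_right_inv h_mul_inv]
  rfl

variable (hV : IsOpen V)

/-- Differentiation of smooth functions along a field of the frame. -/
def fieldDerivation (i : Dir n) : Derivation ℂ (SmoothAlg n V) (SmoothAlg n V) :=
  derivation hV (F.field i) ((F.field_smoothOn i).mono hVU)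

theorem isRestriction_fieldDerivation {a : SmoothAlg n V} {u : M → ℂ} (ha : IsRestriction a u)
    (i : Dir n) : IsRestriction (F.fieldDerivation hVU hV i a) ((F.field i).deriv u) :=
  ha.derivation hV _

theorem fieldDerivation_lie (i j : Dir n) (a : SmoothAlg n V) :
    F.fieldDerivation hVU hV i (F.fieldDerivation hVU hV j a) -
        F.fieldDerivation hVU hV j (F.fieldDerivation hVU hV i a) =
      ∑ k, F.structureConst hU hVU i j k * F.fieldDerivation hVU hV k a := by
  have deriv_a := F.isRestriction_fieldDerivation hVU hV a.isRestriction_extend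
  refine ((F.isRestriction_fieldDerivation hVU hV (deriv_a j) i).sub
    (F.isRestriction_fieldDerivation hVU hV (deriv_a i) j)).ext
    (.sum fun k => (F.isRestriction_structureConst hU hVU i j k).mul (deriv_a k)) fun y hy => ?_
  rw [← ComplexField.deriv_bracket hV a.smoothFnOn_extend ((F.field_smoothOn i).mono hVU)
    ((F.field_smoothOn j).mono hVU) hy, F.deriv_eq_sum_coform (hVU hy)]
  rfl

theorem star_fieldDerivation (i : Dir n) (a : SmoothAlg n V) :
    star (F.fieldDerivation hVU hV i a) = F.fieldDerivation hVU hV i.conj (star a) :=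
  (F.isRestriction_fieldDerivation hVU hV a.isRestriction_extend i).star.ext
    (F.isRestriction_fieldDerivation hVU hV a.isRestriction_extend.star i.conj) fun y hy => by
      rw [ComplexField.deriv_star (a.mdifferentiableAt_extend hV ⟨y, hy⟩), field_conj]

theorem eq_zero_of_sum_mul_fieldDerivation_eq_zero (x₀ : M)
    (hV₀ : V ⊆ (chartAt (EuclideanSpace ℝ (Fin (2 * n + 1))) x₀).source)
    {a : Dir n → SmoothAlg n V} (ha : ∀ f, ∑ k, a k * F.fieldDerivation hVU hV k f = 0)
    (k : Dir n) : a k = 0 := by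
  classical
  refine Subtype.ext (funext fun y => (?_ : eval y (a k) = 0))
  have coform_app := ComplexForm.app_eq_zero_of_deriv_eq_zero x₀ hV hV₀ y.2
    (ComplexField.linComb (fun k => eval y (a k)) F.field) (fun u hu => ?_) (F.coform k)
  · rw [ComplexForm.app_linComb] at coform_app
    simpa [F.coform_app_field (hVU y.2)] using coform_app
  · have eval_sum := congrArg (eval y) (ha (restrict u hu))
    simp only [map_sum, map_mul, map_zero] at eval_sum
    change (differential u).app _ y = 0
    rw [ComplexForm.app_linComb, ← eval_sum]
    exact Finset.sum_congr rfl fun i _ => congrArg (_ * ·)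
      (F.isRestriction_fieldDerivation hVU hV (isRestriction_restrict u hu) i y).symm

/-- The frame induced on the algebra of smooth functions on an open subset `V` of a chart domain:
inside a chart there are enough functions for the fields of the frame to be independent as
derivations. -/
def toCRFrame (x₀ : M) (hV₀ : V ⊆ (chartAt (EuclideanSpace ℝ (Fin (2 * n + 1))) x₀).source) :
    CRFrame n (SmoothAlg n V) where
  e := F.fieldDerivation hVU hV
  C := F.structureConst hU hVU
  lie := F.fieldDerivation_lie hU hVU hV
  indep _ ha := F.eq_zero_of_sum_mul_fieldDerivation_eq_zero hVU hV x₀ hV₀ ha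
  hInv α β := (F.leviMatrix hU hVU)⁻¹ β α
  star_e := F.star_fieldDerivation hVU hV
  C_zero_hol_zero α :=
    (F.isRestriction_structureConst hU hVU _ _ _).ext isRestriction_zero fun _ hy =>
      F.structureFn_zero_hol_zero hU (hVU hy) α
  C_hol_hol_zero α β :=
    (F.isRestriction_structureConst hU hVU _ _ _).ext isRestriction_zero fun _ hy =>
      F.structureFn_hol_hol_zero hU (hVU hy) α β
  C_hol_hol_anti α β γ :=
    (F.isRestriction_structureConst hU hVU _ _ _).ext isRestriction_zero fun _ hy =>
      F.structureFn_hol_hol_anti hU (hVU hy) α β γ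
  sum_hInv_mul_levi α γ := by
    have levi_mul_inv := congrFun₂ (Matrix.mul_nonsing_inv _ (F.isUnit_det_leviMatrix hU hVU)) γ α
    rw [Matrix.mul_apply, Matrix.one_apply] at levi_mul_inv
    simp only [eq_comm (a := α), ← levi_mul_inv]
    exact Finset.sum_congr rfl fun β _ => mul_comm _ _

end Model

section Pointwise

variable (hU : IsOpen U) {x : M} (hx : x ∈ U)
include hU hx

theorem trace_h : F.trace F.h x = n := by
  have h_isUnit : IsUnit (Matrix.of fun γ δ => F.h γ δ x).det :=
    (F.det_h_ne_zero hU hx).isUnit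
  have sum_hInv_mul_h (α : Fin n) : ∑ β, F.hInv α β x * F.h α β x = 1 := by
    have h_mul_inv := congrFun₂ (Matrix.mul_nonsing_inv _ h_isUnit) α α
    rw [Matrix.mul_apply, Matrix.one_apply_eq] at h_mul_inv
    rw [← h_mul_inv]
    exact Finset.sum_congr rfl fun β _ => mul_comm _ _
  simp [trace, sum_hInv_mul_h]

theorem P_eq : F.P x = 1 / (2 * ((n : ℂ) + 1)) * F.R x := by
  have trace_schouten : F.P x = 1 / ((n : ℂ) + 2) *
      (F.R x - 1 / (2 * ((n : ℂ) + 1)) * F.R x * F.trace F.h x) := by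
    simp only [P, R, trace, schouten, Finset.mul_sum, ← Finset.sum_sub_distrib]
    exact Finset.sum_congr rfl fun _ _ => Finset.sum_congr rfl fun _ _ => by ring
  rw [trace_schouten, F.trace_h hU hx]
  have : (n : ℂ) + 1 ≠ 0 := by exact_mod_cast Nat.succ_ne_zero n
  have : (n : ℂ) + 2 ≠ 0 := by exact_mod_cast Nat.succ_ne_zero (n + 1)
  field_simp
  ring

theorem schouten0_eq (hn : n ≠ 0) (α β : Fin n) : F.schouten0 α β x =
    1 / ((n : ℂ) + 2) * (F.ricci α β x - (n : ℂ)⁻¹ * F.R x * F.h α β x) := by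
  rw [schouten0, schouten, F.P_eq hU hx]
  have : (n : ℂ) + 1 ≠ 0 := by exact_mod_cast Nat.succ_ne_zero n
  have : (n : ℂ) + 2 ≠ 0 := by exact_mod_cast Nat.succ_ne_zero (n + 1)
  have : (n : ℂ) ≠ 0 := by exact_mod_cast hn
  field_simp
  ring

end Pointwise

theorem omegaApp_bracket_field (α γ : Fin n) (i j : Dir n) (x : M) :
    F.omegaApp α γ ((F.field i).bracket (F.field j)) x =
      ∑ k, F.structureFn i j k x * F.omega α γ k x := by
  rw [Dir.sum_eq]
  rfl

theorem ricci_eq_sum (α β : Fin n) (x : M) : F.ricci α β x = ∑ γ,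
    ((F.field (.hol α)).deriv (F.omega γ γ (.anti β)) x -
      (F.field (.anti β)).deriv (F.omega γ γ (.hol α)) x -
      ∑ k, F.structureFn (.hol α) (.anti β) k x * F.omega γ γ k x) := by
  have quadratic_part_eq_zero : ∑ γ, ∑ μ, (F.omega γ μ (.hol α) x * F.omega μ γ (.anti β) x -
      F.omega γ μ (.anti β) x * F.omega μ γ (.hol α) x) = 0 := by
    simp only [Finset.sum_sub_distrib]
    rw [sub_eq_zero, Finset.sum_comm]
    simp only [mul_comm]
  simp only [ricci, curvature]
  rw [Finset.sum_sub_distrib, quadratic_part_eq_zero, sub_zero]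
  exact Finset.sum_congr rfl fun γ _ =>
    congrArg (_ - ·) (F.omegaApp_bracket_field γ γ (.hol α) (.anti β) x)

/-- `G` is the frame that `F` induces on the algebra of smooth functions on `V`. This is stated
for the basic operations only; the lemmas in this namespace extend it to the derived ones. -/
structure IsModel {V : Set M} (G : CRFrame n (SmoothAlg n V)) : Prop where
  isOpen : IsOpen U
  subset : V ⊆ U
  e {a : SmoothAlg n V} {u : M → ℂ} (ha : IsRestriction a u) (i : Dir n) :
    IsRestriction (G.e i a) ((F.field i).deriv u)
  C (i j k : Dir n) : IsRestriction (G.C i j k) (F.structureFn i j k)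
  hInv (α β : Fin n) : IsRestriction (G.hInv α β) (F.hInv α β)

theorem isModel_toCRFrame (hU : IsOpen U) {V : Set M} (hVU : V ⊆ U) (hV : IsOpen V) (x₀ : M)
    (hV₀ : V ⊆ (chartAt (EuclideanSpace ℝ (Fin (2 * n + 1))) x₀).source) :
    F.IsModel (F.toCRFrame hU hVU hV x₀ hV₀) where
  isOpen := hU
  subset := hVU
  e ha i := F.isRestriction_fieldDerivation hVU hV ha i
  C := F.isRestriction_structureConst hU hVU
  hInv α β := F.isRestriction_leviMatrix_inv hU hVU α β

namespace IsModel

variable {F} {V : Set M} {G : CRFrame n (SmoothAlg n V)} (model : F.IsModel G)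
include model

theorem h (α β : Fin n) : IsRestriction (G.h α β) (F.h α β) :=
  ((isRestriction_algebraMap Complex.I).mul (model.C _ _ _)).congr
    fun _ hy => (F.h_eq model.isOpen (model.subset hy) α β).symm

theorem d_coform (i j k : Dir n) :
    IsRestriction (G.C i j k) ((F.coform k).d (F.field j) (F.field i)) := by
  rw [G.C_antisymm]
  exact (model.C j i k).neg.congr
    fun _ hy => (F.d_coform_field model.isOpen (model.subset hy) j i k).symm

theorem omega (α γ : Fin n) (i : Dir n) : IsRestriction (G.omega α γ i) (F.omega α γ i) := by
  cases i with
  | zero => exact model.d_coform .zero (.hol α) (.hol γ)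
  | hol β =>
    exact .sum fun δ => (model.hInv γ δ).mul ((model.e (model.h α δ) (.hol β)).sub
      (.sum fun σ => (model.h α σ).mul (model.d_coform (.anti β) (.hol δ) (.hol σ)).star))
  | anti β => exact model.d_coform (.anti β) (.hol α) (.hol γ)

theorem A (α β : Fin n) : IsRestriction (G.A α β) (F.A α β) := by
  have A_eq : G.A α β = star (∑ γ, G.h γ α * G.C (.anti β) .zero (.hol γ)) := by
    simp [CRFrame.A, G.star_h]
  rw [A_eq]
  exact (IsRestriction.sum fun γ => (model.h γ α).mul (model.d_coform _ _ _)).star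

section Tensors

variable {a : Fin n → SmoothAlg n V} {σ : Fin n → M → ℂ} {b : Fin n → Fin n → SmoothAlg n V}
  {t : Fin n → Fin n → M → ℂ}

theorem trace (hb : ∀ α β, IsRestriction (b α β) (t α β)) :
    IsRestriction (G.trace b) (F.trace t) :=
  .sum fun α => .sum fun β => (model.hInv α β).mul (hb α β)

theorem cov (ha : ∀ α, IsRestriction (a α) (σ α)) (i : Dir n) (α : Fin n) :
    IsRestriction (G.cov i a α) (F.cov i σ α) :=
  (model.e (ha α) i).sub (.sum fun γ => (model.omega α γ i).mul (ha γ))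

theorem covBar (ha : ∀ α, IsRestriction (a α) (σ α)) (i : Dir n) (α : Fin n) :
    IsRestriction (G.covBar i a α) (F.covBar i σ α) :=
  (model.e (ha α) i).sub (.sum fun γ => (model.omega α γ i.conj).star.mul (ha γ))

theorem cov2 (hb : ∀ α β, IsRestriction (b α β) (t α β)) (i : Dir n) (α β : Fin n) :
    IsRestriction (G.cov2 i b α β) (F.cov2 i t α β) :=
  ((model.e (hb α β) i).sub (.sum fun γ => (model.omega α γ i).mul (hb γ β))).sub
    (.sum fun γ => (model.omega β γ i).mul (hb α γ))

theorem div (ha : ∀ α, IsRestriction (a α) (σ α)) : IsRestriction (G.div a) (F.div σ) :=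
  model.trace fun α β => model.cov ha (.anti β) α

theorem divBar (ha : ∀ α, IsRestriction (a α) (σ α)) : IsRestriction (G.divBar a) (F.divBar σ) :=
  model.trace fun α β => model.covBar ha (.hol α) β

theorem divA (α : Fin n) : IsRestriction (G.divA α) (F.divA α) :=
  model.trace fun β γ => model.cov2 model.A (.anti γ) α β

end Tensors

section Operators

variable {a : SmoothAlg n V} {u : M → ℂ} (ha : IsRestriction a u)
include ha

theorem sublaplacian : IsRestriction (G.sublaplacian a) (F.sublaplacian u) :=
  ((model.div fun α => model.e ha (.hol α)).add
    (model.divBar fun α => model.e ha (.anti α))).neg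

theorem gradUp (α : Fin n) : IsRestriction (G.gradUp a α) (F.gradUp u α) :=
  .sum fun β => (model.hInv α β).mul (model.e ha (.anti β))

theorem gradBarUp (α : Fin n) : IsRestriction (G.gradBarUp a α) (F.gradBarUp u α) :=
  .sum fun β => (model.hInv β α).mul (model.e ha (.hol β))

theorem torsionDiv : IsRestriction (G.torsionDiv a) (F.torsionDiv u) :=
  model.div fun α => .sum fun β => (model.A α β).mul (model.gradUp ha β)

end Operators

theorem ricci (α β : Fin n) : IsRestriction (G.ricci α β) (F.ricci α β) := by
  have ricci_eq : G.ricci α β = ∑ γ, (G.e (.hol α) (G.omega γ γ (.anti β)) -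
      G.e (.anti β) (G.omega γ γ (.hol α)) -
      ∑ k, G.C (.hol α) (.anti β) k * G.omega γ γ k) := by
    rw [CRFrame.ricci, CRFrame.ricciForm, MovingFrame.extDeriv]
    simp only [CRFrame.omegaTrace, map_sum, Finset.mul_sum, Finset.sum_sub_distrib]
    rw [Finset.sum_comm (f := fun k γ => G.C _ _ k * G.omega γ γ k)]
  rw [ricci_eq]
  refine (IsRestriction.sum fun γ => ?_).congr fun y _ => (F.ricci_eq_sum α β y).symm
  exact ((model.e (model.omega γ γ (.anti β)) (.hol α)).sub
    (model.e (model.omega γ γ (.hol α)) (.anti β))).sub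
    (.sum fun k => (model.C _ _ k).mul (model.omega γ γ k))

theorem R : IsRestriction G.R F.R := model.trace model.ricci

theorem P : IsRestriction ((1 / (2 * ((n : ℂ) + 1))) • G.R) F.P :=
  (model.R.smul _).congr fun _ hy => (F.P_eq model.isOpen (model.subset hy)).symm

theorem schouten0 (hn : n ≠ 0) (α β : Fin n) :
    IsRestriction ((1 / ((n : ℂ) + 2)) • G.ricci0 α β) (F.schouten0 α β) :=
  (((model.ricci α β).sub (((isRestriction_algebraMap _).mul model.R).mul
    (model.h α β))).smul _).congr fun _ hy =>
      (F.schouten0_eq model.isOpen (model.subset hy) hn α β).symm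

theorem schoutenDiv (hn : n ≠ 0) {a : SmoothAlg n V} {u : M → ℂ} (ha : IsRestriction a u) :
    IsRestriction (G.div fun δ => ∑ γ, ((1 / ((n : ℂ) + 2)) • G.ricci0 δ γ) * G.gradBarUp a γ)
      (F.schoutenDiv u) :=
  model.div fun δ => .sum fun γ => (model.schouten0 hn δ γ).mul (model.gradBarUp ha γ)

end IsModel

theorem exists_isModel_of_isPluriharmonic (hU : IsOpen U) {f : M → ℝ}
    (hf : S.IsPluriharmonic f) {x : M} (hx : x ∈ U) :
    ∃ (V : Set M) (G : CRFrame n (SmoothAlg n V)) (v : SmoothAlg n V), x ∈ V ∧ F.IsModel G ∧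
      (∀ α, G.e (.anti α) v = 0) ∧ IsRestriction (v + star v) fun y => (f y : ℂ) := by
  obtain ⟨U', hU', hxU', v, hv, f_eq_re⟩ := hf.2 x
  let V := U ∩ U' ∩ (chartAt (EuclideanSpace ℝ (Fin (2 * n + 1))) x).source
  have hV : IsOpen V := (hU.inter hU').inter (chartAt _ x).open_source
  have hVU : V ⊆ U := fun y hy => hy.1.1
  have hVU' : V ⊆ U' := fun y hy => hy.1.2
  have model := F.isModel_toCRFrame hU hVU hV x fun y hy => hy.2
  have v_restrict := isRestriction_restrict v (ContMDiffOn.mono hv.1 hVU')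
  refine ⟨V, _, (1 / 2 : ℂ) • restrict v _, ⟨⟨hx, hxU'⟩, mem_chart_source _ x⟩, model,
    fun α => ?_, ((v_restrict.smul _).add (v_restrict.smul _).star).congr fun y hy => ?_⟩
  · rw [Derivation.map_smul, (model.e v_restrict (.anti α)).ext isRestriction_zero
      fun y hy => hv.deriv_conj_eq_zero (hVU' hy) (F.Z_mem α y (hVU hy)), smul_zero]
  · rw [f_eq_re y (hVU' hy), Complex.re_eq_add_conj, map_mul]
    simp only [one_div, map_inv₀, Complex.conj_ofNat]
    ring

/-- The first order term `(∇_α P - iν/(2(ν+1)) ∇^β A_{αβ}) ∇^α u` of the `P'`-operator. -/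
def firstOrderTerm (ν : ℂ) (u : M → ℂ) (x : M) : ℂ :=
  ∑ α, (F.grad F.P α x - Complex.I * ν / (2 * (ν + 1)) * F.divA α x) * F.gradUp u α x

theorem re_firstOrderTerm (ν : ℝ) (u : M → ℂ) (x : M) : (F.firstOrderTerm ν u x).re =
    (∑ α, F.grad F.P α x * F.gradUp u α x).re -
      ν / (2 * (ν + 1)) * (∑ α, Complex.I * F.divA α x * F.gradUp u α x).re := by
  rw [← Complex.re_ofReal_mul, ← Complex.sub_re, Finset.mul_sum, ← Finset.sum_sub_distrib,
    firstOrderTerm]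
  congr! 2 with α
  push_cast
  ring

namespace IsModel

variable {F} {V : Set M} {G : CRFrame n (SmoothAlg n V)} (model : F.IsModel G)
  {x : M} (hx : x ∈ V) {u : M → ℂ}
include model hx

theorem grad_P (α : Fin n) : F.grad F.P α x = 1 / (2 * ((n : ℂ) + 1)) * F.grad F.R α x := by
  have grad_smul_R := model.e model.P (.hol α)
  rw [Derivation.map_smul] at grad_smul_R
  exact grad_smul_R.eq ((model.e model.R (.hol α)).smul _) hx

theorem sublaplacian_P :
    F.sublaplacian F.P x = 1 / (2 * ((n : ℂ) + 1)) * F.sublaplacian F.R x := by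
  have sublaplacian_smul_R := model.sublaplacian model.P
  rw [CRFrame.sublaplacian_smul] at sublaplacian_smul_R
  exact sublaplacian_smul_R.eq ((model.sublaplacian model.R).smul _) hx

theorem div_P_grad {a : SmoothAlg n V} (ha : IsRestriction a u) :
    F.div (fun α y => F.P y * F.grad u α y) x =
      1 / (2 * ((n : ℂ) + 1)) * F.div (fun α y => F.R y * F.grad u α y) x := by
  have div_smul_R_grad := model.div fun α => model.P.mul (model.e ha (.hol α))
  simp only [smul_mul_assoc, CRFrame.div_smul] at div_smul_R_grad
  exact div_smul_R_grad.eq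
    ((model.div fun α => model.R.mul (model.e ha (.hol α))).smul _) hx

theorem firstOrderTerm_natCast (u : M → ℂ) : 2 * ((n : ℂ) + 1) * F.firstOrderTerm n u x =
    ∑ α, (F.grad F.R α x - Complex.I * n * F.divA α x) * F.gradUp u α x := by
  have : (n : ℂ) + 1 ≠ 0 := by exact_mod_cast Nat.succ_ne_zero n
  rw [firstOrderTerm, Finset.mul_sum]
  refine Finset.sum_congr rfl fun α _ => ?_
  rw [model.grad_P hx]
  field_simp

section Pluriharmonic

variable {v : SmoothAlg n V} (hv : ∀ α, G.e (.anti α) v = 0) (hu : IsRestriction (v + star v) u)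
include hv hu

theorem sublaplacian_sublaplacian_of_pluriharmonic :
    F.sublaplacian (F.sublaplacian u) x + (n : ℂ) ^ 2 * F.nabla0 (F.nabla0 u) x =
      4 * n * (F.torsionDiv u x).im := by
  have lhs := (model.sublaplacian (model.sublaplacian hu)).add
    ((isRestriction_natCast (n ^ 2)).mul (model.e (model.e hu .zero) .zero))
  have torsionDiv := model.torsionDiv hu
  have rhs := (((isRestriction_natCast 2).mul (isRestriction_algebraMap Complex.I)).mul
    (isRestriction_natCast n)).mul (torsionDiv.star.sub torsionDiv)
  rw [Nat.cast_pow, G.sublaplacian_sublaplacian_of_pluriharmonic hv] at lhs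
  have identity := lhs.eq rhs hx
  have two_im := Complex.sub_conj (F.torsionDiv u x)
  push_cast at identity two_im
  change _ + _ * F.nabla0 (F.nabla0 u) x = _ at identity
  linear_combination identity - 2 * Complex.I * n * two_im -
    4 * n * (F.torsionDiv u x).im * Complex.I_mul_I

theorem schoutenDiv_of_pluriharmonic (hn : n ≠ 0) : F.schoutenDiv u x =
    (2 * ((n : ℝ) - 1) * (n + 1) / (n * (n + 2)) : ℝ) *
      starRingEnd ℂ (F.firstOrderTerm n u x) := by
  have lhs := (isRestriction_natCast n).mul (model.schoutenDiv hn hu)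
  simp only [smul_mul_assoc, ← Finset.smul_sum, CRFrame.div_smul, mul_smul_comm,
    G.natCast_mul_div_ricci0_gradBarUp_of_pluriharmonic hn hv] at lhs
  have rhs := (((isRestriction_natCast n).sub isRestriction_one).mul
    (IsRestriction.sum fun γ => ((model.e model.R (.hol γ)).sub
      (((isRestriction_algebraMap Complex.I).mul (isRestriction_natCast n)).mul
        (model.divA γ))).mul (model.gradUp hu γ)).star).smul (1 / ((n : ℂ) + 2))
  have identity : (n : ℂ) * F.schoutenDiv u x = 1 / ((n : ℂ) + 2) * (((n : ℂ) - 1) *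
      starRingEnd ℂ (2 * ((n : ℂ) + 1) * F.firstOrderTerm n u x)) := by
    rw [model.firstOrderTerm_natCast hx]
    exact lhs.eq rhs hx
  have : (n : ℂ) ≠ 0 := by exact_mod_cast hn
  have : (n : ℂ) + 2 ≠ 0 := by exact_mod_cast Nat.succ_ne_zero (n + 1)
  simp only [map_mul, map_add, map_natCast, map_one, Complex.conj_ofNat] at identity
  refine mul_left_cancel₀ ‹(n : ℂ) ≠ 0› (identity.trans ?_)
  push_cast
  field_simp

theorem paneitz_of_pluriharmonic (hn : 2 ≤ n) :
    2 / ((n : ℂ) - 1) * F.paneitz u x = F.pPrime n u x := by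
  have n_ne_zero : n ≠ 0 := by omega
  have n_ne_one : n ≠ 1 := by omega
  have : (n : ℂ) ≠ 0 := by exact_mod_cast n_ne_zero
  have : (n : ℂ) - 1 ≠ 0 := by
    rw [sub_ne_zero]
    exact_mod_cast n_ne_one
  have : (n : ℂ) + 2 ≠ 0 := by exact_mod_cast Nat.succ_ne_zero (n + 1)
  have nabla0_nabla0 : F.nabla0 (F.nabla0 u) x = (4 * n * (F.torsionDiv u x).im -
      F.sublaplacian (F.sublaplacian u) x) / (n : ℂ) ^ 2 := by
    rw [eq_div_iff (pow_ne_zero 2 ‹_›)]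
    linear_combination model.sublaplacian_sublaplacian_of_pluriharmonic hx hv hu
  have re_schoutenDiv : (F.schoutenDiv u x).re =
      2 * ((n : ℝ) - 1) * (n + 1) / (n * (n + 2)) * (F.firstOrderTerm n u x).re := by
    rw [model.schoutenDiv_of_pluriharmonic hx hv hu n_ne_zero, Complex.re_ofReal_mul,
      Complex.conj_re]
  have pPrime_eq : F.pPrime n u x =
      2 * ((n : ℂ) + 1) / n ^ 2 * F.sublaplacian (F.sublaplacian u) x -
        8 / (n : ℂ) * (F.torsionDiv u x).im -
        8 * ((n : ℂ) + 1) / n * (F.div (fun α y => F.P y * F.grad u α y) x).re +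
        16 * ((n : ℂ) + 1) / (n * (n + 2)) * (F.firstOrderTerm n u x).re + F.Q4 x * u x := by
    simp only [pPrime, Q4, firstOrderTerm, Complex.ofReal_natCast]
  rw [pPrime_eq, paneitz, nabla0_nabla0, re_schoutenDiv]
  push_cast
  field_simp
  ring

end Pluriharmonic

end IsModel

theorem pPrime_eq_sum {ν : ℝ} (hν : 0 < ν) (u : M → ℂ) (x : M) :
    F.pPrime ν u x = ∑ t : PPrimeTerm, (PPrimeTerm.coeff ν t : ℂ) * PPrimeTerm.eval F u x t := by
  have sum_eq (g : PPrimeTerm → ℂ) : ∑ t, g t = g .sublaplacianSq + (g .imTorsionDiv +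
      (g .reDivPGrad + (g .reGradPGrad + (g .reIDivAGrad + (g .sublaplacianP + (g .imDivDivA +
        (g .normSqA + (g .normSqSchouten0 + g .PSq)))))))) := by
    simp [Finset.univ, Fintype.elems]
  have pPrime_firstOrderTerm : F.pPrime ν u x = _ + 16 * ((ν : ℂ) + 1) / (ν * (ν + 2)) *
    (F.firstOrderTerm ν u x).re + _ := rfl
  have : (ν : ℂ) ≠ 0 := by exact_mod_cast hν.ne'
  have : (ν : ℂ) + 1 ≠ 0 := by exact_mod_cast (by positivity : ν + 1 ≠ 0)
  have : (ν : ℂ) + 2 ≠ 0 := by exact_mod_cast (by positivity : ν + 2 ≠ 0)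
  rw [sum_eq, pPrime_firstOrderTerm, re_firstOrderTerm]
  simp only [PPrimeTerm.coeff, PPrimeTerm.eval]
  push_cast
  field_simp
  ring

section DimensionThree

variable {F} {V : Set M} {G : CRFrame n (SmoothAlg n V)} (model : F.IsModel G)

theorem normSqSchouten0_eq_zero (hU : IsOpen U) (hn : n = 1) {x : M} (hx : x ∈ U) :
    F.normSqSchouten0 x = 0 := by
  subst hn
  have schouten0_eq_zero (α β : Fin 1) : F.schouten0 α β x = 0 := by
    have trace_h := F.trace_h hU hx
    rw [F.schouten0_eq hU hx one_ne_zero, R]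
    obtain rfl := Subsingleton.elim α 0
    obtain rfl := Subsingleton.elim β 0
    simp only [trace, Finset.univ_unique, Fin.default_eq_zero, Finset.sum_singleton,
      Nat.cast_one] at trace_h ⊢
    linear_combination -(1 / ((1 : ℂ) + 2) * F.ricci 0 0 x) * trace_h
  simp [normSqSchouten0, schouten0_eq_zero]

include model in
theorem IsModel.pPrime_one (hn : n = 1) {x : M} (hx : x ∈ V) {u : M → ℂ} {a : SmoothAlg n V}
    (ha : IsRestriction a u) : F.pPrime 1 u x = F.criticalPPrime u x := by
  have trace_factor : 1 / (2 * ((n : ℂ) + 1)) = ((1 / 4 : ℝ) : ℂ) := by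
    rw [hn]
    norm_num
  have re_firstOrderTerm_one : (F.firstOrderTerm (1 : ℝ) u x).re =
      1 / 4 * (∑ α, F.W α x * F.gradUp u α x).re := by
    have n_cast : (n : ℂ) = 1 := by simp [hn]
    have four_mul := model.firstOrderTerm_natCast hx u
    simp only [n_cast, mul_one] at four_mul
    have firstOrderTerm_one : F.firstOrderTerm (1 : ℝ) u x =
        ((1 / 4 : ℝ) : ℂ) * ∑ α, F.W α x * F.gradUp u α x := by
      simp only [W, Complex.ofReal_one]
      push_cast
      linear_combination 1 / 4 * four_mul
    rw [firstOrderTerm_one, Complex.re_ofReal_mul]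
  have pPrime_firstOrderTerm : F.pPrime 1 u x = _ + 16 * (((1 : ℝ) : ℂ) + 1) / _ *
    (F.firstOrderTerm (1 : ℝ) u x).re + _ := rfl
  rw [pPrime_firstOrderTerm, criticalPPrime, re_firstOrderTerm_one, model.div_P_grad hx ha,
    model.sublaplacian_P hx, trace_factor, Complex.re_ofReal_mul,
    normSqSchouten0_eq_zero model.isOpen hn (model.subset hx)]
  push_cast
  ring

end DimensionThree

end PseudohermitianStructure.AdmissibleFrame

theorem PPrimeTerm.isRationalRegularAt {a : ℝ} (ha : 0 < a) (t : PPrimeTerm) :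
    IsRationalRegularAt (fun ν => PPrimeTerm.coeff ν t) a := by
  open Polynomial in
  have a_ne_zero : a ≠ 0 := ha.ne'
  have a_add_two_ne_zero : a + 2 ≠ 0 := by positivity
  cases t with
  | sublaplacianSq => exact ⟨2 * (X + 1), X ^ 2, by simp [*], fun ν _ => by simp [coeff]⟩
  | imTorsionDiv => exact ⟨-8, X, by simp [*], fun ν _ => by simp [coeff, neg_div]⟩
  | reDivPGrad => exact ⟨-(8 * (X + 1)), X, by simp [*], fun ν _ => by simp [coeff, neg_div]⟩
  | reGradPGrad => exact ⟨16 * (X + 1), X * (X + 2), by simp [*], fun ν _ => by simp [coeff]⟩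
  | reIDivAGrad => exact ⟨-8, X + 2, by simp [*], fun ν _ => by simp [coeff, neg_div]⟩
  | sublaplacianP =>
    exact ⟨2 * (X + 1) ^ 2, X * (X + 2), by simp [*], fun ν _ => by simp [coeff]⟩
  | imDivDivA => exact ⟨-4, X * (X + 2), by simp [*], fun ν _ => by simp [coeff, neg_div]⟩
  | normSqA => exact ⟨-(2 * (X - 1)), X, by simp [*], fun ν _ => by simp [coeff, neg_div]⟩
  | normSqSchouten0 =>
    exact ⟨-(2 * (X + 1)), X, by simp [*], fun ν _ => by simp [coeff, neg_div]⟩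
  | PSq => exact ⟨2 * (X - 1) * (X + 1) ^ 2, X ^ 2, by simp [*], fun ν _ => by simp [coeff]⟩

theorem IsRationalRegularAt.continuousAt {c : ℝ → ℝ} {a : ℝ} (hc : IsRationalRegularAt c a) :
    ContinuousAt c a := by
  obtain ⟨p, q, q_ne_zero, c_eq⟩ := hc
  have continuousAt_div : ContinuousAt (fun ν => p.eval ν / q.eval ν) a :=
    p.continuous.continuousAt.div q.continuous.continuousAt q_ne_zero
  refine continuousAt_div.congr ?_
  filter_upwards [q.continuous.continuousAt.eventually_ne q_ne_zero] with ν hν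
    using (c_eq ν hν).symm

theorem PseudohermitianStructure.AdmissibleFrame.continuousAt_pPrime
    [IsManifold (𝓡 (2 * n + 1)) ∞ M] {S : PseudohermitianStructure n M} {U : Set M}
    (F : S.AdmissibleFrame U)
    {a : ℝ} (ha : 0 < a) (u : M → ℂ) (x : M) : ContinuousAt (fun ν : ℝ => F.pPrime ν u x) a := by
  have continuousAt_sum : ContinuousAt (fun ν : ℝ => ∑ t : PPrimeTerm,
      (PPrimeTerm.coeff ν t : ℂ) * PPrimeTerm.eval F u x t) a :=
    tendsto_finsetSum _ fun t _ => ((Complex.continuous_ofReal.tendsto _).comp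
      (t.isRationalRegularAt ha).continuousAt).mul_const _
  refine continuousAt_sum.congr ?_
  filter_upwards [lt_mem_nhds ha] with ν hν using (F.pPrime_eq_sum hν u x).symm

end CRGeom

end

theorem mainTheorem5 {n : ℕ} (hn : 1 ≤ n) {M : Type*} [TopologicalSpace M]
    [ChartedSpace (EuclideanSpace ℝ (Fin (2 * n + 1))) M]
    [IsManifold (𝓡 (2 * n + 1)) ∞ M]
    (S : CRGeom.PseudohermitianStructure n M) {U : Set M} (hU : IsOpen U)
    (F : S.AdmissibleFrame U) (f : M → ℝ) (hf : S.IsPluriharmonic f) :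
    (2 ≤ n → ∀ x ∈ U,
      2 / ((n : ℂ) - 1) * F.paneitz (fun y => (f y : ℂ)) x =
        F.pPrime (n : ℝ) (fun y => (f y : ℂ)) x) ∧
    (∀ t : CRGeom.PPrimeTerm,
      CRGeom.IsRationalRegularAt (fun ν => CRGeom.PPrimeTerm.coeff ν t) 1) ∧
    (∀ x ∈ U, ∀ ν : ℝ, 0 < ν →
      F.pPrime ν (fun y => (f y : ℂ)) x =
        ∑ t : CRGeom.PPrimeTerm,
          (CRGeom.PPrimeTerm.coeff ν t : ℂ) *
            CRGeom.PPrimeTerm.eval F (fun y => (f y : ℂ)) x t) ∧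
    (n = 1 → ∀ x ∈ U,
      Filter.Tendsto (fun ν : ℝ => F.pPrime ν (fun y => (f y : ℂ)) x) (𝓝[≠] 1)
        (𝓝 (F.criticalPPrime (fun y => (f y : ℂ)) x))) := by
  refine ⟨fun two_le x hx => ?_, CRGeom.PPrimeTerm.isRationalRegularAt one_pos,
    fun x _ ν hν => F.pPrime_eq_sum hν _ x, fun n_eq_one x hx => ?_⟩
  · obtain ⟨V, G, v, hxV, model, hv, hf_eq⟩ := F.exists_isModel_of_isPluriharmonic hU hf hx
    exact model.paneitz_of_pluriharmonic hxV hv hf_eq two_le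
  · obtain ⟨V, G, v, hxV, model, -, hf_eq⟩ := F.exists_isModel_of_isPluriharmonic hU hf hx
    rw [← model.pPrime_one n_eq_one hxV hf_eq]
    exact (F.continuousAt_pPrime one_pos _ x).tendsto.mono_left nhdsWithin_le_nhds
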